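/- Let $0<\tau\le T$, $\sigma>0$, $\varepsilon>0$, $c\ge 0$, $H=L^2([-\tau,0];\mathbb R)$, and write $z=(z_0,z_1)\in\mathbb R\times H$, with $\langle z,p\rangle=z_0p_0+\int_{-\tau}^0 z_1p_1\,ds$. Let $A(z_0,z_1)=(z_1(0),-\tfrac{dz_1}{ds})$ on $D(A)=\{z: z_1\in W^{1,2},\ z_1(-\tau)=0\}$; its adjoint is $A^*(p_0,p_1)=(0,\tfrac{dp_1}{ds})$ on $D(A^*)=\{p: p_1\in W^{1,2},\ p_0=p_1(0)\}$. Let $\mathcal P_1$ be the set of Borel probability measures $\nu$ on $\mathbb R\times H$ with finite first moment, with marginals $\mu_0,\mu_1$ and means $m_0=\int y_0\,d\mu_0$, $m_1=\int y_1\,d\mu_1$. For $F:\mathcal P_1\to\mathbb R$, $\frac{\delta F}{\delta\nu}(\nu,\cdot)$ is a $C^1$ function on $\mathbb R\times H$ with $\lim_{h\to0^+}\frac{F(\nu+h(\nu'-\nu))-F(\nu)}{h}=\int\frac{\delta F}{\delta\nu}(\nu,y)\,d(\nu'-\nu)(y)$ for all $\nu'\in\mathcal P_1$, and $D_{\mu_0}F=\partial_{y_0}\frac{\delta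 F}{\delta\nu}$, $D_{\mu_1}F=\partial_{y_1}\frac{\delta F}{\delta\nu}$, $D_\nu F=(D_{\mu_0}F,D_{\mu_1}F)$. For $p\in H$, $[p](-\tau)$ is the limit at $-\tau^+$ of a representative of $p$. Write $\partial_zU=(\partial_{z_0}U,\partial_{z_1}U)$. **Master equation.** A function $U(t,z,\nu)$ solves the master equation if $t\mapsto U(t,z,\nu)$ is continuous on $[0,T]$ and $U(T,z,\nu)=\frac c2(m_0-z_0)^2$ for all $z\in\mathbb R\times H$, $\nu\in\mathcal P_1$, and if for all $t\in(0,T)\setminus\{T-\tau\}$, all $z\in D(A)$ and all $\nu\in\mathcal P_1$ carried by $D(A)$ with $\int\|Ay\|\,d\nu(y)<\infty$, all the derivatives and integrals below exist and $$\begin{aligned} &\partial_tU+\tfrac12\sigma^2\partial_{z_0z_0}U+\tfrac12\sigma^2\!\int\partial_{y_0}D_{\mu_0}U(t,z,\nu,y)\,d\nu(y)+\langle Az,\partial_zU\rangle+\int\langle Ay,D_\nu U(t,z,\nu,y)\rangle\,d\nu(y)\\ &-\int\big(\partial_{y_0}U(t,y,\nu)-[\partial_{y_1}U(t,y,\nu)](-\tau)\big)\,D_{\mu_0}U(t,z,\nu,y)\,d\nu(y)\\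 &+\int\big(\partial_{y_0}U(t,y,\nu)-[\partial_{y_1}U(t,y,\nu)](-\tau)\big)\,[D_{\mu_1}U(t,z,\nu,y)](-\tau)\,d\nu(y)\\ &-\tfrac12\big(\partial_{z_0}U-[\partial_{z_1}U](-\tau)\big)^2+\tfrac\varepsilon2(m_0-z_0)^2=0 . \end{aligned}\tag{M}$$ Where $\partial_zU$ and $D_\nu U$ lie in $D(A^*)$, the transport terms can be written in the form $$\langle z,A^*\partial_zU\rangle=\int_{-\tau}^0 z_1\tfrac{d}{ds}\partial_{z_1}U\,ds,\qquad \int\langle y,A^*D_\nu U\rangle\,d\nu=\int_H\int_{-\tau}^0y_1\tfrac{d}{ds}[D_{\mu_1}U]\,ds\,d\mu_1(y_1),\tag{M*}$$ which makes sense for all $z\in\mathbb R\times H$ and $\nu\in\mathcal P_1$. **Ansatz.** Let $\mathcal E$ be the class of $(E_0,E_1,E_2,E_3)$ with $E_0,E_3$ continuous on $[0,T]$, $E_1(t,s)$ continuous and bounded on $\{(t,s)\in[0,T]\times[-\tau,0]: T-t\ne s+\tau\}$, $E_2(t,s,r)$ continuous, bounded and symmetric in $(s,r)$ on $\{(t,s,r)\in[0,T]\times[-\tau,0]^2: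 T-t\neq\max(s,r)+\tau\}$ (values off these sets are irrelevant). For $E\in\mathcal E$ let $$\begin{aligned}U(t,z,\nu)={}&E_0(t)(m_0-z_0)^2-2(m_0-z_0)\int_{-\tau}^0E_1(t,-\tau-s)(m_1-z_1)(s)\,ds\\&+\int_{-\tau}^0\!\int_{-\tau}^0E_2(t,-\tau-s,-\tau-r)(m_1-z_1)(s)(m_1-z_1)(r)\,ds\,dr+E_3(t).\end{aligned}$$ **Riccati system.** For $t\in(0,T)$, $s,r\in(-\tau,0)$, $$\begin{aligned} &E_0'(t)-2(E_0(t)+E_1(t,0))^2+\tfrac\varepsilon2=0,\\ &(\partial_t-\partial_s)E_1(t,s)-2(E_0(t)+E_1(t,0))(E_1(t,s)+E_2(t,s,0))=0,\\ &(\partial_t-\partial_s-\partial_r)E_2(t,s,r)-2(E_1(t,s)+E_2(t,s,0))(E_1(t,r)+E_2(t,r,0))=0,\\ &E_3'(t)+\sigma^2E_0(t)=0, \end{aligned}$$ where $\partial_t-\partial_s$ and $\partial_t-\partial_s-\partial_r$ are the derivatives in the directions $(1,-1)$ and $(1,-1,-1)$; the first three equations are required for $T-t\ne\tau$, and those for $E_1$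 and $E_2$ moreover only for $T-t\neq s+\tau$ and, in the case of $E_2$, $T-t\ne r+\tau$. The boundary conditions are $$E_0(T)=\tfrac c2,\quad E_1(T,s)=0,\quad E_2(T,s,r)=0,\quad E_3(T)=0,\quad E_1(t,-\tau)=-E_0(t),\quad E_2(t,s,-\tau)=-E_1(t,s),$$ at all points of the domains above (so $E_1(T,s)=0$ for $s>-\tau$, and $E_1(t,-\tau)=-E_0(t)$ for $t<T$), together with the symmetry $E_2(t,s,r)=E_2(t,r,s)$. **Theorem.** (i) The Riccati system with its boundary conditions has a solution in $\mathcal E$, and any two solutions in $\mathcal E$ agree on the domains above. (ii) For $E\in\mathcal E$, the ansatz $U$ solves the master equation if and only if $E$ solves the Riccati system with its boundary conditions. (iii) If $E\in\mathcal E$ solves the Riccati system with its boundary conditions, then for every $t\in(0,T)$ with $t<T-\tau$ (for every $t\in(0,T)\setminus\{T-\tau\}$ if $c=0$), every $z\in\mathbb R\times H$ and every $\nu\in\mathcal P_1$, $\partial_zU(t,z,\nu)\in D(A^*)$, $D_\nu U(t,z,\nu,y)\in D(A^*)$ for $\nu$-a.e. $y$, and (M) holds with the transport terms in the form (M*). 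-/

import Mathlib

open MeasureTheory Set Filter Topology

noncomputable section

namespace DelayMFG

/-- Lebesgue measure on `[-τ, 0]`. -/
abbrev delayMeasure (τ : ℝ) : Measure ℝ := volume.restrict (Icc (-τ) 0)

/-- The Hilbert space `H = L²([-τ, 0]; ℝ)` of past controls. -/
abbrev PastControl (τ : ℝ) : Type := Lp ℝ 2 (delayMeasure τ)

/-- `H` carries its Borel σ-algebra. -/
instance instMeasurableSpacePastControl (τ : ℝ) : MeasurableSpace (PastControl τ) :=
  borel (PastControl τ)

instance instBorelSpacePastControl (τ : ℝ) : BorelSpace (PastControl τ) := ⟨rfl⟩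

/-- The state space `ℝ × H`, with elements `z = (z₀, z₁)`. Its inner product is `pairing`. -/
abbrev State (τ : ℝ) : Type := ℝ × PastControl τ

/-- `⟨z, p⟩ = z₀ p₀ + ∫_{-τ}^0 z₁(s) p₁(s) ds`. -/
def pairing {τ : ℝ} (z p : State τ) : ℝ := z.1 * p.1 + inner ℝ z.2 p.2

/-! ### The operators `A`, `A*` and the evaluation at `-τ` -/

/-- `x ∈ W^{1,2}([-τ, 0])`, with absolutely continuous representative `f` and weak derivative
`g ∈ H`. -/
def IsSobolevRep {τ : ℝ} (x : PastControl τ) (f : ℝ → ℝ) (g : PastControl τ) : Prop :=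
  (x : ℝ → ℝ) =ᵐ[delayMeasure τ] f ∧
    ∀ s ∈ Icc (-τ) 0, f s = f (-τ) + ∫ r in (-τ)..s, g r

/-- The graph of `A : (z₀, z₁) ↦ (z₁(0), -dz₁/ds)`, with domain
`D(A) = {z | z₁ ∈ W^{1,2}, z₁(-τ) = 0}`: `z ∈ D(A)` and `A z = w`. -/
def GraphA {τ : ℝ} (z w : State τ) : Prop :=
  ∃ f g, IsSobolevRep z.2 f g ∧ f (-τ) = 0 ∧ w = (f 0, -g)

/-- The graph of the adjoint `A* : (p₀, p₁) ↦ (0, dp₁/ds)`, with domain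
`D(A*) = {p | p₁ ∈ W^{1,2}, p₀ = p₁(0)}`: `p ∈ D(A*)` and `A* p = w`. -/
def GraphAdjoint {τ : ℝ} (p w : State τ) : Prop :=
  ∃ f g, IsSobolevRep p.2 f g ∧ p.1 = f 0 ∧ w = (0, g)

/-- `ℓ = ⟨A z, p⟩` with `z ∈ D(A)`. -/
def OperatorPairing {τ : ℝ} (z p : State τ) (ℓ : ℝ) : Prop :=
  ∃ w, GraphA z w ∧ ℓ = pairing w p

/-- `ℓ = ⟨z, A* p⟩ = ∫_{-τ}^0 z₁ (dp₁/ds) ds` with `p ∈ D(A*)`. -/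
def AdjointPairing {τ : ℝ} (z p : State τ) (ℓ : ℝ) : Prop :=
  ∃ w, GraphAdjoint p w ∧ ℓ = pairing z w

/-- `[x](-τ) = a`: the class `x ∈ H` has a representative with right limit `a` at `-τ`. -/
def HasTrace {τ : ℝ} (x : PastControl τ) (a : ℝ) : Prop :=
  ∃ f : ℝ → ℝ, (x : ℝ → ℝ) =ᵐ[delayMeasure τ] f ∧ Tendsto f (𝓝[>] (-τ)) (𝓝 a)

/-! ### Probability measures on `ℝ × H` and derivatives with respect to them -/

/-- Borel probability measures on `ℝ × H` with a finite first moment. -/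
def IsP1 {τ : ℝ} (ν : Measure (State τ)) : Prop :=
  IsProbabilityMeasure ν ∧ Integrable (fun y : State τ => y) ν

/-- `ν` is carried by `D(A)`, and `∫ ‖A y‖ dν(y) < ∞`. -/
def CarriedByDomain {τ : ℝ} (ν : Measure (State τ)) : Prop :=
  ∃ w : State τ → State τ, Integrable w ν ∧ ∀ᵐ y ∂ν, GraphA y (w y)

/-- `m₀`, the mean of the first marginal `μ₀` of `ν`. -/
def mean₀ {τ : ℝ} (ν : Measure (State τ)) : ℝ := ∫ y₀, y₀ ∂ν.fst

/-- `m₁`, the mean of the second marginal `μ₁` of `ν` (Bochner integral in `H`). -/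
def mean₁ {τ : ℝ} (ν : Measure (State τ)) : PastControl τ := ∫ y₁, y₁ ∂ν.snd

/-- `ν + h (ν' - ν)`, for `0 ≤ h ≤ 1`. -/
def mix {τ : ℝ} (h : ℝ) (ν ν' : Measure (State τ)) : Measure (State τ) :=
  ENNReal.ofReal (1 - h) • ν + ENNReal.ofReal h • ν'

/-- `d = δF/δν (ν, ·)`: for every `ν'`,
`lim_{h → 0+} (F(ν + h (ν' - ν)) - F(ν)) / h = ∫ d d(ν' - ν)`. -/
def HasFlatDerivAt {τ : ℝ} (F : Measure (State τ) → ℝ) (ν : Measure (State τ))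
    (d : State τ → ℝ) : Prop :=
  ∀ ν', IsP1 ν' → Integrable d ν ∧ Integrable d ν' ∧
    Tendsto (fun h : ℝ => (F (mix h ν ν') - F ν) / h) (𝓝[>] 0)
      (𝓝 ((∫ y, d y ∂ν') - ∫ y, d y ∂ν))

/-! ### The master equation -/

/-- The master equation for `U` at `(t, z, ν)`, where all the derivatives in it exist:
`Ut = ∂_t U`, `U₀ = ∂_{z₀} U`, `U₀₀ = ∂_{z₀ z₀} U`, `U₁ = ∂_{z₁} U`, `B₁ = [∂_{z₁} U](-τ)`,
`d = δU/δν`, `D₀ = D_{μ₀} U = ∂_{y₀} δU/δν`, `D₀₀ = ∂_{y₀} D_{μ₀} U`,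
`D₁ = D_{μ₁} U = ∂_{y₁} δU/δν`, `C₁ = [D_{μ₁} U](-τ)`; `ℓ` and `L` are the transport terms,
formed by the pairing `P`, which is `⟨A z, p⟩` or `⟨z, A* p⟩`. -/
def MasterEquationAt {τ : ℝ} (P : State τ → State τ → ℝ → Prop) (σ ε : ℝ)
    (U : ℝ → State τ → Measure (State τ) → ℝ)
    (t : ℝ) (z : State τ) (ν : Measure (State τ)) : Prop :=
  ∃ (Ut U₀₀ ℓ : ℝ) (U₀ B₁ : State τ → ℝ) (U₁ : State τ → PastControl τ)
    (d D₀ D₀₀ C₁ L : State τ → ℝ) (D₁ : State τ → PastControl τ),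
    HasDerivAt (fun r => U r z ν) Ut t ∧
    (∀ y, HasDerivAt (fun x => U t (x, y.2) ν) (U₀ y) y.1) ∧
    (∀ y, HasGradientAt (fun x => U t (y.1, x) ν) (U₁ y) y.2) ∧
    (∀ y, HasTrace (U₁ y) (B₁ y)) ∧
    HasDerivAt (fun x => U₀ (x, z.2)) U₀₀ z.1 ∧
    HasFlatDerivAt (U t z) ν d ∧
    ContDiff ℝ 1 d ∧
    (∀ y, HasDerivAt (fun x => d (x, y.2)) (D₀ y) y.1) ∧
    (∀ y, HasGradientAt (fun x => d (y.1, x)) (D₁ y) y.2) ∧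
    (∀ y, HasDerivAt (fun x => D₀ (x, y.2)) (D₀₀ y) y.1) ∧
    (∀ y, HasTrace (D₁ y) (C₁ y)) ∧
    P z (U₀ z, U₁ z) ℓ ∧
    (∀ᵐ y ∂ν, P y (D₀ y, D₁ y) (L y)) ∧
    Integrable D₀₀ ν ∧
    Integrable L ν ∧
    Integrable (fun y => (U₀ y - B₁ y) * D₀ y) ν ∧
    Integrable (fun y => (U₀ y - B₁ y) * C₁ y) ν ∧
    Ut + 1 / 2 * σ ^ 2 * U₀₀ + 1 / 2 * σ ^ 2 * (∫ y, D₀₀ y ∂ν)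
      + ℓ + (∫ y, L y ∂ν)
      - (∫ y, (U₀ y - B₁ y) * D₀ y ∂ν)
      + (∫ y, (U₀ y - B₁ y) * C₁ y ∂ν)
      - 1 / 2 * (U₀ z - B₁ z) ^ 2
      + ε / 2 * (mean₀ ν - z.1) ^ 2 = 0

/-- `U` solves the master equation on `[0, T]` with its terminal condition. The transport terms are
`⟨A z, ∂_z U⟩` and `∫ ⟨A y, D_ν U⟩ dν(y)`, so that `z` and `ν`-almost every `y` lie in `D(A)`;
the equation holds at all times but `T - τ`, across which `U` is continuous. -/
structure IsMasterSolution {τ : ℝ} (T σ ε c : ℝ)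
    (U : ℝ → State τ → Measure (State τ) → ℝ) : Prop where
  continuousOn : ∀ z ν, IsP1 ν → ContinuousOn (fun t => U t z ν) (Icc 0 T)
  terminal : ∀ z ν, IsP1 ν → U T z ν = c / 2 * (mean₀ ν - z.1) ^ 2
  equation : ∀ t ∈ Ioo 0 T, t ≠ T - τ → ∀ z w, GraphA z w → ∀ ν, IsP1 ν → CarriedByDomain ν →
    MasterEquationAt OperatorPairing σ ε U t z ν

/-! ### The Riccati system -/

/-- The coefficient functions of the quadratic ansatz. -/
structure Coeffs where
  /-- `E₀(t)` -/
  E₀ : ℝ → ℝ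
  /-- `E₁(t, s)` -/
  E₁ : ℝ → ℝ → ℝ
  /-- `E₂(t, s, r)` -/
  E₂ : ℝ → ℝ → ℝ → ℝ
  /-- `E₃(t)` -/
  E₃ : ℝ → ℝ

/-- `[0, T] × [-τ, 0]` without the characteristic line through the corner `(T, -τ)`, where the
data `E₁(T, s) = 0` and `E₁(t, -τ) = -E₀(t)` do not match. -/
def dom₁ (T τ : ℝ) : Set (ℝ × ℝ) :=
  {p | p.1 ∈ Icc 0 T ∧ p.2 ∈ Icc (-τ) 0 ∧ T - p.1 ≠ p.2 + τ}

/-- The corresponding domain of `E₂`. -/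
def dom₂ (T τ : ℝ) : Set (ℝ × ℝ × ℝ) :=
  {p | p.1 ∈ Icc 0 T ∧ p.2.1 ∈ Icc (-τ) 0 ∧ p.2.2 ∈ Icc (-τ) 0 ∧
    T - p.1 ≠ max p.2.1 p.2.2 + τ}

/-- The class of coefficients: continuous and bounded on their domains, with `E₂` symmetric. -/
structure Coeffs.Admissible (T τ : ℝ) (E : Coeffs) : Prop where
  continuousOn₀ : ContinuousOn E.E₀ (Icc 0 T)
  continuousOn₁ : ContinuousOn (fun p : ℝ × ℝ => E.E₁ p.1 p.2) (dom₁ T τ)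
  continuousOn₂ : ContinuousOn (fun p : ℝ × ℝ × ℝ => E.E₂ p.1 p.2.1 p.2.2) (dom₂ T τ)
  continuousOn₃ : ContinuousOn E.E₃ (Icc 0 T)
  bounded₁ : ∃ C, ∀ t s, (t, s) ∈ dom₁ T τ → |E.E₁ t s| ≤ C
  bounded₂ : ∃ C, ∀ t s r, (t, s, r) ∈ dom₂ T τ → |E.E₂ t s r| ≤ C
  symm : ∀ t s r, (t, s, r) ∈ dom₂ T τ → E.E₂ t s r = E.E₂ t r s

/-- The Riccati system with its boundary conditions. `∂_t - ∂_s` and `∂_t - ∂_s - ∂_r` are the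
derivatives in the directions `(1, -1)` and `(1, -1, -1)`. -/
structure Coeffs.SolvesRiccati (T τ σ ε c : ℝ) (E : Coeffs) : Prop where
  ode₀ : ∀ t ∈ Ioo 0 T, t ≠ T - τ →
    HasDerivAt E.E₀ (2 * (E.E₀ t + E.E₁ t 0) ^ 2 - ε / 2) t
  pde₁ : ∀ t ∈ Ioo 0 T, ∀ s ∈ Ioo (-τ) 0, t ≠ T - τ → T - t ≠ s + τ →
    HasDerivAt (fun h => E.E₁ (t + h) (s - h))
      (2 * (E.E₀ t + E.E₁ t 0) * (E.E₁ t s + E.E₂ t s 0)) 0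
  pde₂ : ∀ t ∈ Ioo 0 T, ∀ s ∈ Ioo (-τ) 0, ∀ r ∈ Ioo (-τ) 0,
    t ≠ T - τ → T - t ≠ s + τ → T - t ≠ r + τ →
    HasDerivAt (fun h => E.E₂ (t + h) (s - h) (r - h))
      (2 * (E.E₁ t s + E.E₂ t s 0) * (E.E₁ t r + E.E₂ t r 0)) 0
  ode₃ : ∀ t ∈ Ioo 0 T, HasDerivAt E.E₃ (-(σ ^ 2 * E.E₀ t)) t
  terminal₀ : E.E₀ T = c / 2
  terminal₁ : ∀ s ∈ Ioc (-τ) 0, E.E₁ T s = 0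
  terminal₂ : ∀ s ∈ Icc (-τ) 0, ∀ r ∈ Icc (-τ) 0, (s, r) ≠ (-τ, -τ) → E.E₂ T s r = 0
  terminal₃ : E.E₃ T = 0
  lateral₁ : ∀ t ∈ Ico 0 T, E.E₁ t (-τ) = -E.E₀ t
  lateral₂ : ∀ t s, (t, s) ∈ dom₁ T τ → E.E₂ t s (-τ) = -E.E₁ t s

/-- Equality of coefficients on their domains. -/
def Coeffs.Agree (T τ : ℝ) (E E' : Coeffs) : Prop :=
  (∀ t ∈ Icc 0 T, E.E₀ t = E'.E₀ t ∧ E.E₃ t = E'.E₃ t) ∧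
  (∀ t s, (t, s) ∈ dom₁ T τ → E.E₁ t s = E'.E₁ t s) ∧
  (∀ t s r, (t, s, r) ∈ dom₂ T τ → E.E₂ t s r = E'.E₂ t s r)

/-- The quadratic ansatz `U(t, z, ν)`. -/
def ansatz (τ : ℝ) (E : Coeffs) (t : ℝ) (z : State τ) (ν : Measure (State τ)) : ℝ :=
  E.E₀ t * (mean₀ ν - z.1) ^ 2
    - 2 * (mean₀ ν - z.1) * (∫ s in Icc (-τ) 0, E.E₁ t (-τ - s) * (mean₁ ν - z.2) s)
    + (∫ s in Icc (-τ) 0, ∫ r in Icc (-τ) 0,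
        E.E₂ t (-τ - s) (-τ - r) * (mean₁ ν - z.2) s * (mean₁ ν - z.2) r)
    + E.E₃ t

end DelayMFG

end

/-! The Riccati system belongs to a linear-quadratic control problem with delay, and it is solved by
completing a square. Let `v_x` (`stepVec`) be the indicator of `[x, T]` in `L²` of the measure
`(ε/2) dx + (c/2) δ_T`, whose squared norm is running plus terminal cost. A unit control impulse at
time `u` contributes `n_u = v_u - v_{u+τ}` to the trajectory. From the deviation `x = (m₀ - z₀, m₁ -
z₁)` at time `t` the uncontrolled trajectory is `w = x₀ v_t + ∫ x₁(s) v_{t-s} ds`, and the minimum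
over `α` of `‖w + ∫ α n‖² + ½ ∫ α²` is `⟨w, Q(t) w⟩` with `Q(t) = (I + 2 ∫_t^T n_u ⊗ n_u du)⁻¹`. The
matrix elements of `Q` between step vectors are the coefficients `explicitCoeffs`. Since `Q' = 2 Q
(n_t ⊗ n_t) Q`, and since `t + s` is constant on a characteristic, so that `v_{t+s+τ}` does not move
there, the system holds (`explicitCoeffs_solvesRiccati`). No smallness or continuation argument is
needed: the operator being inverted is at least the identity.

Uniqueness is a Picard iteration on differences of coefficients along characteristics
(`Coeffs.DiffLE.step`, `Coeffs.Admissible.diffLE_zero_of_step`).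

For the master equation, the ansatz depends on `(z, ν)` only through `x`. Its flat derivative is
therefore linear in `y`, its measure derivatives are constant in `y`, and the two nonlocal drift
terms vanish because the feedback is linear and the deviations have mean zero. What remains is one
equation for the quadratic form, `Coeffs.QuadEquationAt`
(`Coeffs.Admissible.masterEquationAt_of_quad`, and conversely
`Coeffs.Admissible.quadEquationAt_of_master` at `ν = δ₀`). The explicit form satisfies it wherever
`∫ x₁(s) v_{t-s} ds` is differentiable in `t` (`explicit_quadEquationAt`). That holds for `x ∈
D(A)`, and for every `x` if the delayed times `t - s` stay below `T` or the atom is absent, which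
gives part (iii).

The direction from the master equation to the Riccati system does not differentiate the given
coefficients along characteristics. Instead, two quadratic forms solving the master equation are
compared along the flow of `A` on smooth states; bump functions turn bounds on the forms into bounds
on the coefficients, and the same Picard iteration shows that the coefficients of a master solution
are unique (`IsMasterSolution.agree`). As the explicit solution is such a solution, every solution
coincides with it. -/

noncomputable section

namespace DelayMFG

/-! ### The explicit solution of the Riccati system

The Riccati system is solved by compressing the inverse of an affine operator-valued path. -/

section Explicit

variable {T τ σ ε c : ℝ}

/-- The measure `(ε / 2) dx + (c / 2) δ_T` that carries the running and the terminal cost. -/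
def costMeasure (T ε c : ℝ) : Measure ℝ :=
  ENNReal.ofReal (ε / 2) • volume + ENNReal.ofReal (c / 2) • Measure.dirac T

/-- The Hilbert space `L²` of the cost measure. -/
abbrev CostSpace (T ε c : ℝ) : Type := Lp ℝ 2 (costMeasure T ε c)

lemma costMeasure_Icc_ne_top (T ε c x : ℝ) : costMeasure T ε c (Icc x T) ≠ ⊤ := by
  simp only [costMeasure, Measure.add_apply, Measure.smul_apply, smul_eq_mul, Real.volume_Icc]
  exact ENNReal.add_ne_top.2 ⟨ENNReal.mul_ne_top ENNReal.ofReal_ne_top ENNReal.ofReal_ne_top,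
    ENNReal.mul_ne_top ENNReal.ofReal_ne_top (measure_ne_top _ _)⟩

/-- The class of the indicator of `[x, T]`: the response of the state to a unit impulse at `x`. -/
def stepVec (T ε c x : ℝ) : CostSpace T ε c :=
  indicatorConstLp 2 (measurableSet_Icc (a := x) (b := T)) (costMeasure_Icc_ne_top T ε c x) 1

/-- The mass of `[x, T]` under the cost measure. -/
def tailMass (T ε c x : ℝ) : ℝ := if x ≤ T then ε / 2 * (T - x) + c / 2 else 0

lemma costMeasure_real_Icc (hε : 0 ≤ ε) (hc : 0 ≤ c) (x : ℝ) :
    (costMeasure T ε c).real (Icc x T) = tailMass T ε c x := by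
  simp only [Measure.real, costMeasure, Measure.add_apply, Measure.smul_apply, smul_eq_mul,
    Real.volume_Icc, tailMass]
  split_ifs with h
  · rw [Measure.dirac_apply_of_mem (right_mem_Icc.2 h), mul_one,
      ← ENNReal.ofReal_mul (by positivity),
      ← ENNReal.ofReal_add (mul_nonneg (by positivity) (by linarith)) (by positivity),
      ENNReal.toReal_ofReal]
    exact add_nonneg (mul_nonneg (by positivity) (by linarith)) (by positivity)
  · rw [ENNReal.ofReal_of_nonpos (by linarith : T - x ≤ 0)]
    simp [h]

lemma inner_stepVec (hε : 0 ≤ ε) (hc : 0 ≤ c) (x y : ℝ) :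
    inner ℝ (stepVec T ε c x) (stepVec T ε c y) = tailMass T ε c (max x y) := by
  rw [stepVec, stepVec, L2.inner_indicatorConstLp_indicatorConstLp measurableSet_Icc
    measurableSet_Icc (costMeasure_Icc_ne_top T ε c x) (costMeasure_Icc_ne_top T ε c y), Icc_inter_Icc,
    ← costMeasure_real_Icc hε hc]
  simp

lemma stepVec_of_lt {x : ℝ} (h : T < x) : stepVec T ε c x = 0 := by
  have : Icc x T = ∅ := Icc_eq_empty (not_le.2 h)
  rw [stepVec]
  simp only [this]
  exact indicatorConstLp_empty

/-- The atom at `T` lies in both tails and cancels. The curve of step vectors is thus Hölder of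
order one half up to `T`, but has no derivative in norm when `ε > 0`; time derivatives below avoid
it by using the fixed vector `v_0` or primitives. -/
lemma norm_stepVec_sub_sq (hε : 0 ≤ ε) (hc : 0 ≤ c) {x y : ℝ} (hx : x ≤ T) (hy : y ≤ T) :
    ‖stepVec T ε c x - stepVec T ε c y‖ ^ 2 = ε / 2 * |x - y| := by
  rw [← real_inner_self_eq_norm_sq, inner_sub_sub_self, inner_stepVec hε hc, inner_stepVec hε hc,
    inner_stepVec hε hc, inner_stepVec hε hc]
  simp only [tailMass, max_self, hx, hy, if_true, max_le_iff, and_self]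
  rcases le_total x y with h | h
  · rw [max_eq_right h, max_eq_left h, abs_of_nonpos (by linarith)]; ring
  · rw [max_eq_left h, max_eq_right h, abs_of_nonneg (by linarith)]; ring

lemma continuous_stepVec_min (hε : 0 ≤ ε) (hc : 0 ≤ c) :
    Continuous fun x => stepVec T ε c (min x T) := by
  rw [continuous_iff_continuousAt]
  intro x
  rw [ContinuousAt, tendsto_iff_norm_sub_tendsto_zero]
  have h1 : ∀ y, ‖stepVec T ε c (min y T) - stepVec T ε c (min x T)‖
      = √(ε / 2 * |min y T - min x T|) := fun y => by
    rw [← norm_stepVec_sub_sq hε hc (min_le_right _ _) (min_le_right _ _),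
      Real.sqrt_sq (norm_nonneg _)]
  simp only [h1]
  have h2 : Continuous fun y => √(ε / 2 * |min y T - min x T|) := by fun_prop
  simpa using h2.tendsto x

lemma stepVec_eq_indicator :
    stepVec T ε c = (Iic T).indicator fun x => stepVec T ε c (min x T) := by
  ext1 x
  by_cases h : x ≤ T
  · rw [indicator_of_mem (by exact h), min_eq_left h]
  · rw [indicator_of_notMem (by exact h), stepVec_of_lt (not_le.1 h)]

lemma stronglyMeasurable_stepVec (hε : 0 ≤ ε) (hc : 0 ≤ c) :
    StronglyMeasurable (stepVec T ε c) := by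
  rw [stepVec_eq_indicator]
  exact (continuous_stepVec_min hε hc).stronglyMeasurable.indicator measurableSet_Iic

lemma continuousOn_stepVec (hε : 0 ≤ ε) (hc : 0 ≤ c) :
    ContinuousOn (stepVec T ε c) (Iic T) :=
  (continuous_stepVec_min hε hc).continuousOn.congr fun x hx => by
    simp only [min_eq_left (mem_Iic.1 hx)]

/-- At `T` the limit from the left keeps the atom while the vector beyond `T` is zero: a jump of
squared norm `c / 2`. It is the origin of the exceptional time `T - τ` and of the excluded
characteristic. -/
lemma continuousAt_stepVec (hε : 0 ≤ ε) (hc : 0 ≤ c) {x : ℝ} (hx : x ≠ T) :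
    ContinuousAt (stepVec T ε c) x := by
  rcases lt_or_gt_of_ne hx with h | h
  · exact (continuousOn_stepVec hε hc).continuousAt (Iic_mem_nhds h)
  · refine continuousAt_const.congr (f := fun _ => (0 : CostSpace T ε c)) ?_
    filter_upwards [Ioi_mem_nhds h] with y hy
    rw [stepVec_of_lt hy]

lemma norm_stepVec_sq (hε : 0 ≤ ε) (hc : 0 ≤ c) (x : ℝ) :
    ‖stepVec T ε c x‖ ^ 2 = tailMass T ε c x := by
  rw [← real_inner_self_eq_norm_sq, inner_stepVec hε hc, max_self]

lemma norm_stepVec_le (hε : 0 ≤ ε) (hc : 0 ≤ c) {a x : ℝ} (h : a ≤ x) :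
    ‖stepVec T ε c x‖ ≤ ‖stepVec T ε c (min a T)‖ := by
  rw [← sq_le_sq₀ (norm_nonneg _) (norm_nonneg _), norm_stepVec_sq hε hc, norm_stepVec_sq hε hc]
  simp only [tailMass, min_le_right, if_true]
  split_ifs with h'
  · rw [min_eq_left (h.trans h')]
    have := mul_le_mul_of_nonneg_left (sub_le_sub_left h T) (by positivity : 0 ≤ ε / 2)
    linarith
  · exact add_nonneg (mul_nonneg (by positivity) (by linarith [min_le_right a T])) (by positivity)

/-- The response of the state to a unit control impulse at `u`, which is undone at `u + τ`. -/
def controlVec (T τ ε c u : ℝ) : CostSpace T ε c := stepVec T ε c u - stepVec T ε c (u + τ)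

lemma stronglyMeasurable_controlVec (hε : 0 ≤ ε) (hc : 0 ≤ c) :
    StronglyMeasurable (controlVec T τ ε c) :=
  (stronglyMeasurable_stepVec hε hc).sub
    ((stronglyMeasurable_stepVec hε hc).comp_measurable (measurable_id.add_const τ))

lemma continuousAt_controlVec (hε : 0 ≤ ε) (hc : 0 ≤ c) {u : ℝ} (h : u ≠ T) (h' : u ≠ T - τ) :
    ContinuousAt (controlVec T τ ε c) u := by
  refine (continuousAt_stepVec hε hc h).sub ?_
  refine ContinuousAt.comp (f := fun u => u + τ) (continuousAt_stepVec hε hc ?_) (by fun_prop)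
  intro h1; exact h' (by linarith)

/-- The rank one operator `n_u ⊗ n_u`. -/
def controlOp (T τ ε c u : ℝ) : CostSpace T ε c →L[ℝ] CostSpace T ε c :=
  InnerProductSpace.rankOne ℝ (controlVec T τ ε c u) (controlVec T τ ε c u)

lemma controlOp_apply (u : ℝ) (x : CostSpace T ε c) :
    controlOp T τ ε c u x = inner ℝ (controlVec T τ ε c u) x • controlVec T τ ε c u :=
  InnerProductSpace.rankOne_apply _ _ _

lemma continuous_rankOne_self {E : Type*} [NormedAddCommGroup E] [InnerProductSpace ℝ E] :
    Continuous fun x : E => InnerProductSpace.rankOne ℝ x x := by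
  exact (InnerProductSpace.rankOne ℝ (E := E) (F := E)).continuous.clm_apply continuous_id

lemma stronglyMeasurable_controlOp (hε : 0 ≤ ε) (hc : 0 ≤ c) :
    StronglyMeasurable (controlOp T τ ε c) :=
  continuous_rankOne_self.comp_stronglyMeasurable (stronglyMeasurable_controlVec hε hc)

lemma intervalIntegrable_controlOp (hε : 0 ≤ ε) (hc : 0 ≤ c) (hτ : 0 ≤ τ) (a b : ℝ) :
    IntervalIntegrable (controlOp T τ ε c) volume a b := by
  set M := ‖stepVec T ε c (min (min a b) T)‖ with hM
  refine (intervalIntegrable_const (c := (2 * M) * (2 * M))).mono_fun'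
    (stronglyMeasurable_controlOp hε hc).aestronglyMeasurable ?_
  refine (ae_restrict_iff' measurableSet_uIoc).2 (ae_of_all _ fun u hu => ?_)
  have hu' : min a b ≤ u := (mem_Ioc.1 hu).1.le
  have h1 : ‖controlVec T τ ε c u‖ ≤ 2 * M := by
    refine (norm_sub_le _ _).trans ?_
    linarith [norm_stepVec_le (T := T) hε hc hu',
      norm_stepVec_le (T := T) hε hc (hu'.trans (by linarith : u ≤ u + τ))]
  refine (InnerProductSpace.norm_rankOne (𝕜 := ℝ) _ _).trans_le ?_
  exact mul_le_mul h1 h1 (norm_nonneg _) ((norm_nonneg _).trans h1)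

/-- `I + 2 ∫_t^T n_u ⊗ n_u du`. -/
def gramOp (T τ ε c t : ℝ) : CostSpace T ε c →L[ℝ] CostSpace T ε c :=
  1 + (2 : ℝ) • ∫ u in t..T, controlOp T τ ε c u

/-- The inverse of `I + 2 ∫_t^T n_u ⊗ n_u du`. -/
def riccatiOp (T τ ε c t : ℝ) : CostSpace T ε c →L[ℝ] CostSpace T ε c :=
  Ring.inverse (gramOp T τ ε c t)

lemma gramOp_apply (hε : 0 ≤ ε) (hc : 0 ≤ c) (hτ : 0 ≤ τ) (t : ℝ) (x : CostSpace T ε c) :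
    gramOp T τ ε c t x = x + (2 : ℝ) • ∫ u in t..T,
      inner ℝ (controlVec T τ ε c u) x • controlVec T τ ε c u := by
  simp only [gramOp, add_apply, one_apply_eq_self,
    smul_apply]
  rw [ContinuousLinearMap.intervalIntegral_apply (intervalIntegrable_controlOp hε hc hτ t T)]
  simp only [controlOp_apply]

lemma inner_gramOp (hε : 0 ≤ ε) (hc : 0 ≤ c) (hτ : 0 ≤ τ) (t : ℝ) (x y : CostSpace T ε c) :
    inner ℝ (gramOp T τ ε c t x) y = inner ℝ x y + 2 * ∫ u in t..T,
      inner ℝ (controlVec T τ ε c u) x * inner ℝ (controlVec T τ ε c u) y := by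
  have h : IntervalIntegrable (fun u => controlOp T τ ε c u x) volume t T :=
    ⟨(intervalIntegrable_controlOp hε hc hτ t T).1.apply_continuousLinearMap x,
      (intervalIntegrable_controlOp hε hc hτ t T).2.apply_continuousLinearMap x⟩
  simp only [controlOp_apply] at h
  rw [gramOp_apply hε hc hτ, inner_add_left, real_inner_smul_left, real_inner_comm _ (∫ _ in _.._, _)]
  congr 2
  have := (innerSL ℝ y).intervalIntegral_comp_comm h
  simp only [innerSL_apply_apply] at this
  rw [← this]
  refine intervalIntegral.integral_congr fun u _ => ?_
  simp only [real_inner_smul_right]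
  rw [real_inner_comm y]

/-- The integral is a positive operator, so the quadratic form dominates the squared norm and the
operator is coercive with constant `1`. -/
lemma isUnit_gramOp (hε : 0 ≤ ε) (hc : 0 ≤ c) (hτ : 0 ≤ τ) {t : ℝ} (ht : t ≤ T) :
    IsUnit (gramOp T τ ε c t) := by
  refine ContinuousLinearMap.isUnit_of_forall_le_norm_inner_map _ (c := 1) one_pos fun x => ?_
  rw [inner_gramOp hε hc hτ, real_inner_self_eq_norm_sq]
  have : 0 ≤ ∫ u in t..T, inner ℝ (controlVec T τ ε c u) x * inner ℝ (controlVec T τ ε c u) x :=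
    intervalIntegral.integral_nonneg ht fun u _ => mul_self_nonneg _
  rw [Real.norm_of_nonneg (by positivity)]
  simp only [NNReal.coe_one, mul_one]
  linarith

lemma riccatiOp_gramOp (hε : 0 ≤ ε) (hc : 0 ≤ c) (hτ : 0 ≤ τ) {t : ℝ} (ht : t ≤ T)
    (x : CostSpace T ε c) : riccatiOp T τ ε c t (gramOp T τ ε c t x) = x := by
  have := Ring.inverse_mul_cancel _ (isUnit_gramOp (T := T) hε hc hτ ht)
  exact congrArg (fun f => f x) this

lemma gramOp_riccatiOp (hε : 0 ≤ ε) (hc : 0 ≤ c) (hτ : 0 ≤ τ) {t : ℝ} (ht : t ≤ T)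
    (x : CostSpace T ε c) : gramOp T τ ε c t (riccatiOp T τ ε c t x) = x := by
  have := Ring.mul_inverse_cancel _ (isUnit_gramOp (T := T) hε hc hτ ht)
  exact congrArg (fun f => f x) this

/-- Both vectors are written as images under the symmetric operator `gramOp`, whose inverse is then
symmetric too. -/
lemma inner_riccatiOp_left (hε : 0 ≤ ε) (hc : 0 ≤ c) (hτ : 0 ≤ τ) {t : ℝ} (ht : t ≤ T)
    (x y : CostSpace T ε c) :
    inner ℝ (riccatiOp T τ ε c t x) y = inner ℝ x (riccatiOp T τ ε c t y) := by
  conv_lhs => rw [← gramOp_riccatiOp hε hc hτ ht y]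
  conv_rhs => rw [← gramOp_riccatiOp hε hc hτ ht x]
  rw [inner_gramOp hε hc hτ, real_inner_comm (gramOp _ _ _ _ _ _), inner_gramOp hε hc hτ,
    real_inner_comm]
  congr 2
  exact intervalIntegral.integral_congr fun u _ => mul_comm _ _

lemma continuous_gramOp (hε : 0 ≤ ε) (hc : 0 ≤ c) (hτ : 0 ≤ τ) :
    Continuous (gramOp T τ ε c) := by
  have h := intervalIntegral.continuous_primitive
    (fun a b => intervalIntegrable_controlOp (T := T) hε hc hτ a b) T
  have h2 : gramOp T τ ε c = fun t => 1 - (2 : ℝ) • ∫ u in T..t, controlOp T τ ε c u := by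
    ext1 t
    rw [gramOp, intervalIntegral.integral_symm, smul_neg, sub_eq_add_neg]
  rw [h2]
  exact continuous_const.sub (h.const_smul (2 : ℝ))

lemma continuousAt_riccatiOp (hε : 0 ≤ ε) (hc : 0 ≤ c) (hτ : 0 ≤ τ) {t : ℝ} (ht : t ≤ T) :
    ContinuousAt (riccatiOp T τ ε c) t := by
  obtain ⟨u, hu⟩ := isUnit_gramOp (T := T) hε hc hτ ht
  have := NormedRing.inverse_continuousAt u
  rw [hu] at this
  exact ContinuousAt.comp (f := gramOp T τ ε c) this (continuous_gramOp hε hc hτ).continuousAt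

lemma hasDerivAt_gramOp (hε : 0 ≤ ε) (hc : 0 ≤ c) (hτ : 0 ≤ τ) {t : ℝ} (h : t ≠ T)
    (h' : t ≠ T - τ) :
    HasDerivAt (gramOp T τ ε c) (-((2 : ℝ) • controlOp T τ ε c t)) t := by
  have h1 : ContinuousAt (controlOp T τ ε c) t :=
    (continuous_rankOne_self.continuousAt).comp (continuousAt_controlVec hε hc h h')
  have := intervalIntegral.integral_hasDerivAt_left
    (intervalIntegrable_controlOp (T := T) hε hc hτ t T)
    (stronglyMeasurable_controlOp hε hc).stronglyMeasurableAtFilter h1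
  have h2 := (this.const_smul (2 : ℝ)).const_add 1
  rw [smul_neg] at h2
  exact h2

/-- The inverse has derivative `-Q G' Q`, and `G' = -2 n_t ⊗ n_t`. This is the whole Riccati system
in operator form. -/
lemma hasDerivAt_riccatiOp (hε : 0 ≤ ε) (hc : 0 ≤ c) (hτ : 0 ≤ τ) {t : ℝ} (h : t < T)
    (h' : t ≠ T - τ) :
    HasDerivAt (riccatiOp T τ ε c)
      ((2 : ℝ) • (riccatiOp T τ ε c t * controlOp T τ ε c t * riccatiOp T τ ε c t)) t := by
  obtain ⟨u, hu⟩ := isUnit_gramOp (T := T) hε hc hτ h.le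
  have h1 := hasFDerivAt_ringInverse (𝕜 := ℝ) u
  rw [hu] at h1
  have h2 := h1.comp_hasDerivAt t (hasDerivAt_gramOp hε hc hτ h.ne h')
  have h3 : (↑u⁻¹ : CostSpace T ε c →L[ℝ] CostSpace T ε c) = riccatiOp T τ ε c t := by
    rw [riccatiOp, ← hu, Ring.inverse_unit]
  refine h2.congr_deriv ?_
  rw [h3]
  simp [mul_assoc]

/-- As the derivative has rank one, each matrix element has as derivative a product of two scalars;
these products become the quadratic terms of the system. -/
lemma hasDerivAt_inner_riccatiOp (hε : 0 ≤ ε) (hc : 0 ≤ c) (hτ : 0 ≤ τ) {t : ℝ} (h : t < T)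
    (h' : t ≠ T - τ) (x y : CostSpace T ε c) :
    HasDerivAt (fun t => inner ℝ x (riccatiOp T τ ε c t y))
      (2 * inner ℝ x (riccatiOp T τ ε c t (controlVec T τ ε c t)) *
        inner ℝ y (riccatiOp T τ ε c t (controlVec T τ ε c t))) t := by
  have h1 := ((hasDerivAt_riccatiOp hε hc hτ h h').clm_apply (hasDerivAt_const t y))
  have h2 := (innerSL ℝ x).hasFDerivAt.comp_hasDerivAt t h1
  refine h2.congr_deriv ?_
  have h3 : (riccatiOp T τ ε c t * controlOp T τ ε c t * riccatiOp T τ ε c t) y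
      = inner ℝ (controlVec T τ ε c t) (riccatiOp T τ ε c t y) •
        riccatiOp T τ ε c t (controlVec T τ ε c t) := by
    rw [mul_assoc, mul_apply_eq_comp, mul_apply_eq_comp, controlOp_apply,
      map_smul]
  simp only [smul_apply, h3, map_smul, map_zero, add_zero, innerSL_apply_apply, smul_eq_mul]
  rw [← inner_riccatiOp_left hε hc hτ h.le (controlVec T τ ε c t) y, real_inner_comm y]
  ring

/-- The difference is the indicator of `[r, t)`, orthogonal to every `n_u` with `u > t`: controls
after `t` cannot change costs incurred before `t`. Hence `gramOp`, and so its inverse, fixes it. -/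
lemma riccatiOp_stepVec_sub (hε : 0 ≤ ε) (hc : 0 ≤ c) (hτ : 0 ≤ τ) {r t : ℝ} (hr : r ≤ t)
    (ht : t ≤ T) :
    riccatiOp T τ ε c t (stepVec T ε c r - stepVec T ε c t)
      = stepVec T ε c r - stepVec T ε c t := by
  have h : gramOp T τ ε c t (stepVec T ε c r - stepVec T ε c t)
      = stepVec T ε c r - stepVec T ε c t := by
    rw [gramOp_apply hε hc hτ, intervalIntegral.integral_zero_ae, smul_zero, add_zero]
    refine ae_of_all _ fun u hu => ?_
    rw [uIoc_of_le ht] at hu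
    rw [controlVec]
    simp only [inner_sub_left, inner_sub_right, inner_stepVec hε hc]
    rw [max_eq_left (hr.trans hu.1.le), max_eq_left hu.1.le,
      max_eq_left (by linarith [hu.1.le] : r ≤ u + τ), max_eq_left (by linarith [hu.1.le] : t ≤ u + τ)]
    simp
  conv_lhs => rw [← h]
  rw [riccatiOp_gramOp hε hc hτ ht]

end Explicit

end DelayMFG
end

noncomputable section

namespace DelayMFG

/-! ### Matrix elements of the inverse operator as Riccati coefficients -/

section ExplicitCoeffs

variable {T τ σ ε c : ℝ}

/-- The explicit solution of the Riccati system. -/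
def explicitCoeffs (T τ σ ε c : ℝ) : Coeffs where
  E₀ t := inner ℝ (stepVec T ε c 0) (riccatiOp T τ ε c t (stepVec T ε c 0)) - ε / 2 * t
  E₁ t s := -inner ℝ (stepVec T ε c 0) (riccatiOp T τ ε c t (stepVec T ε c (t + s + τ)))
  E₂ t s r := inner ℝ (stepVec T ε c (t + s + τ)) (riccatiOp T τ ε c t (stepVec T ε c (t + r + τ)))
  E₃ t := σ ^ 2 * ∫ u in t..T,
    (inner ℝ (stepVec T ε c 0) (riccatiOp T τ ε c u (stepVec T ε c 0)) - ε / 2 * u)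

/-- This lets a fixed vector replace the moving, nondifferentiable `v_t`, with an explicit
correction term. -/
lemma inner_stepVec_riccatiOp_of_le (hε : 0 ≤ ε) (hc : 0 ≤ c) (hτ : 0 ≤ τ) {r t : ℝ} (hr : r ≤ t)
    (ht : t ≤ T) (z : CostSpace T ε c) :
    inner ℝ (stepVec T ε c r) (riccatiOp T τ ε c t z)
      = inner ℝ (stepVec T ε c t) (riccatiOp T τ ε c t z)
        + inner ℝ (stepVec T ε c r - stepVec T ε c t) z := by
  have h := inner_riccatiOp_left hε hc hτ ht (stepVec T ε c r - stepVec T ε c t) z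
  rw [riccatiOp_stepVec_sub hε hc hτ hr ht, inner_sub_left _ _ (riccatiOp T τ ε c t z)] at h
  linarith

lemma inner_stepVec_sub_stepVec_of_le (hε : 0 ≤ ε) (hc : 0 ≤ c) {r t y : ℝ} (hr : r ≤ t)
    (hy : t ≤ y) :
    inner ℝ (stepVec T ε c r - stepVec T ε c t) (stepVec T ε c y) = 0 := by
  rw [inner_sub_left, inner_stepVec hε hc, inner_stepVec hε hc, max_eq_right hy,
    max_eq_right (hr.trans hy), sub_self]

lemma inner_stepVec_zero_riccatiOp (hε : 0 ≤ ε) (hc : 0 ≤ c) (hτ : 0 ≤ τ) {t y : ℝ} (h0 : 0 ≤ t)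
    (ht : t ≤ T) (hy : t ≤ y) :
    inner ℝ (stepVec T ε c 0) (riccatiOp T τ ε c t (stepVec T ε c y))
      = inner ℝ (stepVec T ε c t) (riccatiOp T τ ε c t (stepVec T ε c y)) := by
  rw [inner_stepVec_riccatiOp_of_le hε hc hτ h0 ht, inner_stepVec_sub_stepVec_of_le hε hc h0 hy,
    add_zero]

/-- The subtracted `ε / 2 * t` is the mass of `[0, t)`, the correction for using `v_0` instead of
`v_t`. -/
lemma explicitCoeffs_E₀_eq (hε : 0 ≤ ε) (hc : 0 ≤ c) (hτ : 0 ≤ τ) {t : ℝ} (h0 : 0 ≤ t)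
    (ht : t ≤ T) :
    (explicitCoeffs T τ σ ε c).E₀ t
      = inner ℝ (stepVec T ε c 0) (riccatiOp T τ ε c t (stepVec T ε c t)) := by
  have h1 : inner ℝ (stepVec T ε c 0) (riccatiOp T τ ε c t (stepVec T ε c 0 - stepVec T ε c t))
      = ε / 2 * t := by
    rw [riccatiOp_stepVec_sub hε hc hτ h0 ht, inner_sub_right, inner_stepVec hε hc,
      inner_stepVec hε hc, max_self, max_eq_right h0]
    simp only [tailMass, ht, h0.trans ht, if_true]
    ring
  rw [map_sub, inner_sub_right] at h1
  simp only [explicitCoeffs]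
  linarith

lemma explicitCoeffs_E₀_eq' (hε : 0 ≤ ε) (hc : 0 ≤ c) (hτ : 0 ≤ τ) {t : ℝ} (h0 : 0 ≤ t)
    (ht : t ≤ T) :
    (explicitCoeffs T τ σ ε c).E₀ t
      = inner ℝ (stepVec T ε c t) (riccatiOp T τ ε c t (stepVec T ε c t)) := by
  rw [explicitCoeffs_E₀_eq hε hc hτ h0 ht, inner_stepVec_zero_riccatiOp hε hc hτ h0 ht le_rfl]

lemma explicitCoeffs_E₁_eq (hε : 0 ≤ ε) (hc : 0 ≤ c) (hτ : 0 ≤ τ) {t s : ℝ} (h0 : 0 ≤ t)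
    (ht : t ≤ T) (hs : -τ ≤ s) :
    (explicitCoeffs T τ σ ε c).E₁ t s
      = -inner ℝ (stepVec T ε c t) (riccatiOp T τ ε c t (stepVec T ε c (t + s + τ))) := by
  simp only [explicitCoeffs]
  rw [inner_stepVec_zero_riccatiOp hε hc hτ h0 ht (by linarith)]

lemma riccatiOp_self (hε : 0 ≤ ε) (hc : 0 ≤ c) (hτ : 0 ≤ τ) (x : CostSpace T ε c) :
    riccatiOp T τ ε c T x = x := by
  have h : gramOp T τ ε c T x = x := by
    rw [gramOp_apply hε hc hτ, intervalIntegral.integral_same, smul_zero, add_zero]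
  conv_lhs => rw [← h]
  exact riccatiOp_gramOp hε hc hτ le_rfl x

lemma continuousAt_explicitCoeffs_E₀ (hε : 0 ≤ ε) (hc : 0 ≤ c) (hτ : 0 ≤ τ) {t : ℝ} (ht : t ≤ T) :
    ContinuousAt (explicitCoeffs T τ σ ε c).E₀ t := by
  have h := continuousAt_riccatiOp (T := T) hε hc hτ ht
  refine ContinuousAt.sub (continuousAt_const.inner (𝕜 := ℝ) (h.clm_apply continuousAt_const)) ?_
  fun_prop

lemma hasDerivAt_explicitCoeffs_E₃ (hε : 0 ≤ ε) (hc : 0 ≤ c) (hτ : 0 ≤ τ) {t : ℝ} (ht : t < T) :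
    HasDerivAt (explicitCoeffs T τ σ ε c).E₃ (-(σ ^ 2 * (explicitCoeffs T τ σ ε c).E₀ t)) t := by
  have hcont : ContinuousOn (explicitCoeffs T τ σ ε c).E₀ (Iic T) := fun u hu =>
    (continuousAt_explicitCoeffs_E₀ hε hc hτ hu).continuousWithinAt
  have h := intervalIntegral.integral_hasDerivAt_left (f := (explicitCoeffs T τ σ ε c).E₀)
    (a := t) (b := T) ?_ ?_ (continuousAt_explicitCoeffs_E₀ hε hc hτ ht.le)
  · have h2 := h.const_mul (σ ^ 2)
    rw [mul_neg] at h2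
    exact h2
  · refine (hcont.mono ?_).intervalIntegrable
    rw [uIcc_of_le ht.le]
    exact fun u hu => hu.2
  · exact (hcont.mono Iio_subset_Iic_self).stronglyMeasurableAtFilter isOpen_Iio t ht

lemma exists_norm_riccatiOp_le (hε : 0 ≤ ε) (hc : 0 ≤ c) (hτ : 0 ≤ τ) :
    ∃ M, 0 ≤ M ∧ ∀ t ∈ Icc 0 T, ‖riccatiOp T τ ε c t‖ ≤ M := by
  obtain ⟨M, hM⟩ := (isCompact_Icc (a := (0 : ℝ)) (b := T)).exists_bound_of_continuousOn
    (f := riccatiOp T τ ε c) fun t ht =>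
      (continuousAt_riccatiOp (T := T) hε hc hτ ht.2).continuousWithinAt
  exact ⟨max M 0, le_max_right _ _, fun t ht => (hM t ht).trans (le_max_left _ _)⟩

lemma abs_inner_riccatiOp_le {M : ℝ} (hM : 0 ≤ M) {t : ℝ} (h : ‖riccatiOp T τ ε c t‖ ≤ M)
    {x y : CostSpace T ε c} {B : ℝ} (hx : ‖x‖ ≤ B) (hy : ‖y‖ ≤ B) :
    |inner ℝ x (riccatiOp T τ ε c t y)| ≤ B * (M * B) := by
  have hB : 0 ≤ B := (norm_nonneg _).trans hx
  refine (abs_real_inner_le_norm _ _).trans ?_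
  gcongr
  exact ((riccatiOp T τ ε c t).le_opNorm y).trans (by gcongr)

lemma explicitCoeffs_admissible (hε : 0 ≤ ε) (hc : 0 ≤ c) (hτ : 0 ≤ τ) (hT : 0 ≤ T) :
    (explicitCoeffs T τ σ ε c).Admissible T τ := by
  obtain ⟨M, hM0, hM⟩ := exists_norm_riccatiOp_le (T := T) hε hc hτ
  have hB : ∀ y, 0 ≤ y → ‖stepVec T ε c y‖ ≤ ‖stepVec T ε c 0‖ := fun y hy => by
    simpa [min_eq_left hT] using norm_stepVec_le (T := T) hε hc hy
  have hQ : ∀ {α : Type} [TopologicalSpace α] (f : α → ℝ) (a : α), ContinuousAt f a → f a ≤ T →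
      ContinuousAt (fun b => riccatiOp T τ ε c (f b)) a := fun f a hf ha =>
    ContinuousAt.comp (g := riccatiOp T τ ε c) (continuousAt_riccatiOp (T := T) hε hc hτ ha) hf
  have hv : ∀ {α : Type} [TopologicalSpace α] (f : α → ℝ) (a : α), ContinuousAt f a → f a ≠ T →
      ContinuousAt (fun b => stepVec T ε c (f b)) a := fun f a hf ha =>
    ContinuousAt.comp (continuousAt_stepVec (T := T) hε hc ha) hf
  constructor
  · exact fun t ht => (continuousAt_explicitCoeffs_E₀ hε hc hτ ht.2).continuousWithinAt
  · rintro ⟨t, s⟩ ⟨ht, hs, hts⟩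
    refine ContinuousAt.continuousWithinAt ?_
    refine (continuousAt_const.inner (𝕜 := ℝ) (ContinuousAt.clm_apply
      (hQ (fun p : ℝ × ℝ => p.1) _ (by fun_prop) ht.2)
      (hv (fun p : ℝ × ℝ => p.1 + p.2 + τ) _ (by fun_prop) ?_))).neg
    intro h
    exact hts (by simp only at h ⊢; linarith)
  · rintro ⟨t, s, r⟩ ⟨ht, hs, hr, hts⟩
    refine ContinuousAt.continuousWithinAt ?_
    simp only at ht hs hr hts
    -- Past the excluded surface one of the two step vectors is zero, so the product vanishes nearby
    -- even where the other vector jumps. Before it, both indices are below `T`, where step vectors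
    -- are continuous.
    rcases lt_or_gt_of_ne hts with h | h
    · have : (fun _ => 0) =ᶠ[𝓝 (t, s, r)] (fun p : ℝ × ℝ × ℝ =>
          (explicitCoeffs T τ σ ε c).E₂ p.1 p.2.1 p.2.2) := by
        have ho : IsOpen {p : ℝ × ℝ × ℝ | T - p.1 < max p.2.1 p.2.2 + τ} :=
          isOpen_lt (by fun_prop) (by fun_prop)
        filter_upwards [ho.mem_nhds h] with p hp
        have hp : T - p.1 < max p.2.1 p.2.2 + τ := hp
        simp only [explicitCoeffs]
        rcases le_total p.2.1 p.2.2 with h' | h'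
        · rw [max_eq_right h'] at hp
          rw [stepVec_of_lt (by linarith : T < p.1 + p.2.2 + τ), map_zero, inner_zero_right]
        · rw [max_eq_left h'] at hp
          rw [stepVec_of_lt (by linarith : T < p.1 + p.2.1 + τ), inner_zero_left]
      exact continuousAt_const.congr this
    · have h1 := le_max_left s r
      have h2 := le_max_right s r
      exact (hv (fun p : ℝ × ℝ × ℝ => p.1 + p.2.1 + τ) _ (by fun_prop) (by simp only; linarith)).inner
        (𝕜 := ℝ) (ContinuousAt.clm_apply
        (hQ (fun p : ℝ × ℝ × ℝ => p.1) _ (by fun_prop) ht.2)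
        (hv (fun p : ℝ × ℝ × ℝ => p.1 + p.2.2 + τ) _ (by fun_prop) (by simp only; linarith)))
  · have hcont : ContinuousOn (explicitCoeffs T τ σ ε c).E₀ (uIcc 0 T) := fun u hu =>
      (continuousAt_explicitCoeffs_E₀ hε hc hτ (by
        rw [uIcc_of_le hT] at hu; exact hu.2)).continuousWithinAt
    have h := intervalIntegral.continuousOn_primitive_interval_left
      (hcont.integrableOn_compact isCompact_uIcc (μ := volume))
    rw [uIcc_of_le hT] at h
    exact continuousOn_const.mul h
  · refine ⟨‖stepVec T ε c 0‖ * (M * ‖stepVec T ε c 0‖), fun t s hts => ?_⟩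
    rw [show (explicitCoeffs T τ σ ε c).E₁ t s = -inner ℝ (stepVec T ε c 0)
      (riccatiOp T τ ε c t (stepVec T ε c (t + s + τ))) from rfl, abs_neg]
    exact abs_inner_riccatiOp_le hM0 (hM t hts.1) le_rfl (hB _ (by
      have := hts.1.1; have := hts.2.1.1; simp only at *; linarith))
  · refine ⟨_, fun t s r h => abs_inner_riccatiOp_le hM0 (hM t h.1) (hB _ ?_) (hB _ ?_)⟩
    · have := h.1.1; have := h.2.1.1; simp only at *; linarith
    · have := h.1.1; have := h.2.2.1.1; simp only at *; linarith
  · intro t s r h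
    simp only [explicitCoeffs]
    rw [← inner_riccatiOp_left hε hc hτ h.1.2, real_inner_comm]

/-- On characteristics `t + s` is constant, so the step vectors are frozen and only `Q` is
differentiated. The lateral conditions hold since `s = -τ` turns `v_{t+s+τ}` into `v_t`; the
terminal ones hold since step vectors beyond `T` vanish. -/
lemma explicitCoeffs_solvesRiccati (hε : 0 ≤ ε) (hc : 0 ≤ c) (hτ : 0 ≤ τ) (hT : 0 ≤ T) :
    (explicitCoeffs T τ σ ε c).SolvesRiccati T τ σ ε c := by
  have ha : ∀ t ∈ Ioo 0 T, (explicitCoeffs T τ σ ε c).E₀ t + (explicitCoeffs T τ σ ε c).E₁ t 0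
      = inner ℝ (stepVec T ε c 0) (riccatiOp T τ ε c t (controlVec T τ ε c t)) := fun t ht => by
    rw [explicitCoeffs_E₀_eq hε hc hτ ht.1.le ht.2.le, controlVec, map_sub, inner_sub_right]
    simp only [explicitCoeffs, add_zero]
    ring
  have hb : ∀ t ∈ Ioo 0 T, ∀ s ∈ Ioo (-τ) 0,
      (explicitCoeffs T τ σ ε c).E₁ t s + (explicitCoeffs T τ σ ε c).E₂ t s 0
      = -inner ℝ (stepVec T ε c (t + s + τ)) (riccatiOp T τ ε c t (controlVec T τ ε c t)) :=
    fun t ht s hs => by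
    rw [explicitCoeffs_E₁_eq hε hc hτ ht.1.le ht.2.le hs.1.le, controlVec, map_sub,
      inner_sub_right, ← inner_riccatiOp_left hε hc hτ ht.2.le, real_inner_comm]
    simp only [explicitCoeffs, add_zero]
    ring
  constructor
  · intro t ht ht'
    have h := (hasDerivAt_inner_riccatiOp hε hc hτ ht.2 ht' (stepVec T ε c 0)
      (stepVec T ε c 0)).sub ((hasDerivAt_id t).const_mul (ε / 2))
    rw [ha t ht]
    refine h.congr_deriv ?_
    ring
  · intro t ht s hs ht' hts
    rw [ha t ht, hb t ht s hs]
    have h := (hasDerivAt_inner_riccatiOp hε hc hτ ht.2 ht' (stepVec T ε c 0)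
      (stepVec T ε c (t + s + τ))).neg
    have h2 : (fun h => (explicitCoeffs T τ σ ε c).E₁ (t + h) (s - h)) = fun h =>
        -inner ℝ (stepVec T ε c 0) (riccatiOp T τ ε c (t + h) (stepVec T ε c (t + s + τ))) := by
      ext1 h
      simp only [explicitCoeffs]
      rw [show t + h + (s - h) + τ = t + s + τ by ring]
    rw [h2]
    refine (HasDerivAt.comp_const_add t 0 (by simpa using h)).congr_deriv ?_
    ring
  · intro t ht s hs r hr ht' _ _
    rw [hb t ht s hs, hb t ht r hr]
    have h := hasDerivAt_inner_riccatiOp hε hc hτ ht.2 ht' (stepVec T ε c (t + s + τ))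
      (stepVec T ε c (t + r + τ))
    have h2 : (fun h => (explicitCoeffs T τ σ ε c).E₂ (t + h) (s - h) (r - h)) = fun h =>
        inner ℝ (stepVec T ε c (t + s + τ))
          (riccatiOp T τ ε c (t + h) (stepVec T ε c (t + r + τ))) := by
      ext1 h
      simp only [explicitCoeffs]
      rw [show t + h + (s - h) + τ = t + s + τ by ring,
        show t + h + (r - h) + τ = t + r + τ by ring]
    rw [h2]
    refine (HasDerivAt.comp_const_add t 0 (by simpa using h)).congr_deriv ?_
    ring
  · exact fun t ht => hasDerivAt_explicitCoeffs_E₃ hε hc hτ ht.2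
  · rw [explicitCoeffs_E₀_eq' hε hc hτ hT le_rfl, riccatiOp_self hε hc hτ, inner_stepVec hε hc]
    simp [tailMass]
  · intro s hs
    simp only [explicitCoeffs]
    rw [stepVec_of_lt (by linarith [hs.1] : T < T + s + τ), map_zero, inner_zero_right, neg_zero]
  · intro s hs r hr h
    simp only [explicitCoeffs]
    by_cases h' : s = -τ
    · have : r ≠ -τ := fun h'' => h (by rw [h', h''])
      have : -τ < r := lt_of_le_of_ne hr.1 this.symm
      rw [stepVec_of_lt (by linarith : T < T + r + τ), map_zero, inner_zero_right]
    · have : -τ < s := lt_of_le_of_ne hs.1 (Ne.symm h')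
      rw [stepVec_of_lt (by linarith : T < T + s + τ), inner_zero_left]
  · simp [explicitCoeffs]
  · intro t ht
    rw [explicitCoeffs_E₀_eq hε hc hτ ht.1 ht.2.le]
    simp only [explicitCoeffs, neg_add_cancel_right]
  · intro t s h
    rw [explicitCoeffs_E₁_eq hε hc hτ h.1.1 h.1.2 h.2.1.1, neg_neg]
    simp only [explicitCoeffs, neg_add_cancel_right]
    rw [← inner_riccatiOp_left hε hc hτ h.1.2, real_inner_comm]

end ExplicitCoeffs

end DelayMFG
end

noncomputable section

namespace DelayMFG

/-! ### Uniqueness for the Riccati system -/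

section Uniqueness

variable {T τ σ ε c : ℝ}

lemma le_of_hasDerivAt_nonpos {F F' : ℝ → ℝ} {a b : ℝ} (hab : a ≤ b)
    (hF : ContinuousOn F (Icc a b)) (hd : ∀ u ∈ Ioo a b, HasDerivAt F (F' u) u)
    (hn : ∀ u ∈ Ioo a b, F' u ≤ 0) : F b ≤ F a := by
  refine antitoneOn_of_deriv_nonpos (convex_Icc a b) hF ?_ ?_ (left_mem_Icc.2 hab)
    (right_mem_Icc.2 hab) hab
  · rw [interior_Icc]
    exact fun u hu => (hd u hu).differentiableAt.differentiableWithinAt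
  · rw [interior_Icc]
    exact fun u hu => by rw [(hd u hu).deriv]; exact hn u hu

lemma le_of_hasDerivAt_nonpos_off_point {F F' : ℝ → ℝ} {a b p : ℝ} (hab : a ≤ b)
    (hF : ContinuousOn F (Icc a b)) (hd : ∀ u ∈ Ioo a b, u ≠ p → HasDerivAt F (F' u) u)
    (hn : ∀ u ∈ Ioo a b, u ≠ p → F' u ≤ 0) : F b ≤ F a := by
  by_cases hp : p ∈ Ioo a b
  · refine (le_of_hasDerivAt_nonpos (F' := F') hp.2.le (hF.mono (Icc_subset_Icc_left hp.1.le))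
      (fun u hu => hd u ⟨hp.1.trans hu.1, hu.2⟩ hu.1.ne')
      (fun u hu => hn u ⟨hp.1.trans hu.1, hu.2⟩ hu.1.ne')).trans
      (le_of_hasDerivAt_nonpos (F' := F') hp.1.le (hF.mono (Icc_subset_Icc_right hp.2.le))
      (fun u hu => hd u ⟨hu.1, hu.2.trans hp.2⟩ hu.2.ne)
      (fun u hu => hn u ⟨hu.1, hu.2.trans hp.2⟩ hu.2.ne))
  · have h : ∀ u ∈ Ioo a b, u ≠ p := fun u hu h => hp (h ▸ hu)
    exact le_of_hasDerivAt_nonpos hab hF (fun u hu => hd u hu (h u hu)) fun u hu => hn u hu (h u hu)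

/-- A mean value inequality in which the derivatives may fail to exist at one point. -/
lemma abs_sub_le_of_hasDerivAt_off_point {f f' g g' : ℝ → ℝ} {a b p : ℝ} (hab : a ≤ b)
    (hf : ContinuousOn f (Icc a b)) (hg : ContinuousOn g (Icc a b))
    (hf' : ∀ u ∈ Ioo a b, u ≠ p → HasDerivAt f (f' u) u)
    (hg' : ∀ u ∈ Ioo a b, u ≠ p → HasDerivAt g (-g' u) u)
    (h : ∀ u ∈ Ioo a b, u ≠ p → |f' u| ≤ g' u) : |f a - f b| ≤ g a - g b := by
  have h1 := le_of_hasDerivAt_nonpos_off_point (F := g + f) (F' := fun u => -g' u + f' u) hab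
    (hg.add hf) (fun u hu hp => (hg' u hu hp).add (hf' u hu hp))
    (fun u hu hp => by linarith [(abs_le.1 (h u hu hp)).2])
  have h2 := le_of_hasDerivAt_nonpos_off_point (F := g - f) (F' := fun u => -g' u - f' u) hab
    (hg.sub hf) (fun u hu hp => (hg' u hu hp).sub (hf' u hu hp))
    (fun u hu hp => by linarith [(abs_le.1 (h u hu hp)).1])
  simp only [Pi.add_apply, Pi.sub_apply] at h1 h2
  exact abs_le.2 ⟨by linarith, by linarith⟩

/-- A characteristic is labelled by `x = t + s + τ`, the time at which it reaches `s = -τ`. The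
excluded line is the single label `x = T`, so every other characteristic avoids it entirely. -/
lemma Coeffs.Admissible.continuousOn_char₁ {E : Coeffs} (hE : E.Admissible T τ) {a b x : ℝ}
    (ha : 0 ≤ a) (hb : b ≤ T) (hxa : x ≤ a + τ) (hbx : b ≤ x) (hx : x ≠ T) :
    ContinuousOn (fun u => E.E₁ u (x - u - τ)) (Icc a b) := by
  refine hE.continuousOn₁.comp (f := fun u => (u, x - u - τ)) (by fun_prop) fun u hu => ?_
  exact ⟨⟨ha.trans hu.1, hu.2.trans hb⟩, ⟨by simp only; linarith [hu.2], by
    simp only; linarith [hu.1]⟩, fun h => hx (by simp only at h; linarith)⟩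

lemma Coeffs.Admissible.continuousOn_char₂ {E : Coeffs} (hE : E.Admissible T τ) {a b x y : ℝ}
    (ha : 0 ≤ a) (hb : b ≤ T) (hxa : x ≤ a + τ) (hbx : b ≤ x) (hya : y ≤ a + τ) (hby : b ≤ y)
    (hxy : max x y ≠ T) :
    ContinuousOn (fun u => E.E₂ u (x - u - τ) (y - u - τ)) (Icc a b) := by
  refine hE.continuousOn₂.comp (f := fun u => (u, x - u - τ, y - u - τ)) (by fun_prop)
    fun u hu => ?_
  refine ⟨⟨ha.trans hu.1, hu.2.trans hb⟩, ⟨by simp only; linarith [hu.2], by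
    simp only; linarith [hu.1]⟩, ⟨by simp only; linarith [hu.2], by
    simp only; linarith [hu.1]⟩, fun h => hxy ?_⟩
  simp only at h
  rw [max_sub_sub_right, max_sub_sub_right] at h
  linarith

lemma Coeffs.SolvesRiccati.hasDerivAt_char₁ {E : Coeffs} (hE : E.SolvesRiccati T τ σ ε c) {x u : ℝ}
    (h0 : 0 < u) (hT : u < T) (hux : u < x) (hxu : x < u + τ) (hu : u ≠ T - τ) (hx : x ≠ T) :
    HasDerivAt (fun u => E.E₁ u (x - u - τ))
      (2 * (E.E₀ u + E.E₁ u 0) * (E.E₁ u (x - u - τ) + E.E₂ u (x - u - τ) 0)) u := by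
  have h := hE.pde₁ u ⟨h0, hT⟩ (x - u - τ) ⟨by linarith, by linarith⟩ hu
    (fun h => hx (by linarith))
  have h2 := HasDerivAt.comp_sub_const u u (by rwa [sub_self])
  refine h2.congr_of_eventuallyEq (Eventually.of_forall fun v => ?_)
  simp only
  congr 1 <;> ring

lemma Coeffs.SolvesRiccati.hasDerivAt_char₂ {E : Coeffs} (hE : E.SolvesRiccati T τ σ ε c)
    {x y u : ℝ} (h0 : 0 < u) (hT : u < T) (hux : u < x) (hxu : x < u + τ) (huy : u < y)
    (hyu : y < u + τ) (hu : u ≠ T - τ) (hx : x ≠ T) (hy : y ≠ T) :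
    HasDerivAt (fun u => E.E₂ u (x - u - τ) (y - u - τ))
      (2 * (E.E₁ u (x - u - τ) + E.E₂ u (x - u - τ) 0) *
        (E.E₁ u (y - u - τ) + E.E₂ u (y - u - τ) 0)) u := by
  have h := hE.pde₂ u ⟨h0, hT⟩ (x - u - τ) ⟨by linarith, by linarith⟩ (y - u - τ)
    ⟨by linarith, by linarith⟩ hu (fun h => hx (by linarith)) (fun h => hy (by linarith))
  have h2 := HasDerivAt.comp_sub_const u u (by rwa [sub_self])
  refine h2.congr_of_eventuallyEq (Eventually.of_forall fun v => ?_)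
  simp only
  congr 1 <;> ring

/-- The differences of two families of coefficients are bounded by `f`. -/
structure Coeffs.DiffLE (T τ : ℝ) (E E' : Coeffs) (f : ℝ → ℝ) : Prop where
  le₀ : ∀ t ∈ Icc 0 T, |E.E₀ t - E'.E₀ t| ≤ f t
  le₁ : ∀ t ∈ Icc 0 T, ∀ s ∈ Icc (-τ) 0, T - t ≠ s + τ → |E.E₁ t s - E'.E₁ t s| ≤ f t
  le₂ : ∀ t ∈ Icc 0 T, ∀ s ∈ Icc (-τ) 0, ∀ r ∈ Icc (-τ) 0, T - t ≠ s + τ → T - t ≠ r + τ →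
    |E.E₂ t s r - E'.E₂ t s r| ≤ f t

lemma mem_dom₂_of_ne {t s r : ℝ} (ht : t ∈ Icc 0 T) (hs : s ∈ Icc (-τ) 0) (hr : r ∈ Icc (-τ) 0)
    (h : T - t ≠ s + τ) (h' : T - t ≠ r + τ) : (t, s, r) ∈ dom₂ T τ := by
  refine ⟨ht, hs, hr, ?_⟩
  simp only
  rcases max_choice s r with h1 | h1 <;> rw [h1] <;> assumption

/-- The factor `8` is `2 * (2 + 2)`: each factor of the product is a sum of two coefficients and so
differs by at most `2 * f`. -/
lemma abs_mul_sub_mul_le {a b a' b' C f : ℝ} (ha : |a| ≤ C) (hb' : |b'| ≤ C)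
    (h1 : |a - a'| ≤ 2 * f) (h2 : |b - b'| ≤ 2 * f) :
    |2 * a * b - 2 * a' * b'| ≤ 8 * C * f := by
  have h : 2 * a * b - 2 * a' * b' = 2 * (a * (b - b') + (a - a') * b') := by ring
  have hC : 0 ≤ C := (abs_nonneg _).trans ha
  have h3 : |a * (b - b')| ≤ C * (2 * f) := by
    rw [abs_mul]; exact mul_le_mul ha h2 (abs_nonneg _) hC
  have h4 : |(a - a') * b'| ≤ (2 * f) * C := by
    rw [abs_mul]; exact mul_le_mul h1 hb' (abs_nonneg _) ((abs_nonneg _).trans h1)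
  rw [h, abs_mul, abs_two]
  linarith [abs_add_le (a * (b - b')) ((a - a') * b')]

lemma Coeffs.DiffLE.abs_sub_feedback₀_le {E E' : Coeffs} {f : ℝ → ℝ} (hB : E.DiffLE T τ E' f)
    (hτ : 0 ≤ τ) {t : ℝ} (ht : t ∈ Icc 0 T) (h : t ≠ T - τ) :
    |(E.E₀ t + E.E₁ t 0) - (E'.E₀ t + E'.E₁ t 0)| ≤ 2 * f t := by
  have h1 := hB.le₀ t ht
  have h2 := hB.le₁ t ht 0 ⟨by linarith, le_rfl⟩ (fun h' => h (by linarith))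
  rw [add_sub_add_comm]
  linarith [abs_add_le (E.E₀ t - E'.E₀ t) (E.E₁ t 0 - E'.E₁ t 0)]

lemma Coeffs.DiffLE.abs_sub_feedback₁_le {E E' : Coeffs} {f : ℝ → ℝ} (hB : E.DiffLE T τ E' f)
    (hτ : 0 ≤ τ) {t s : ℝ} (ht : t ∈ Icc 0 T) (hs : s ∈ Icc (-τ) 0) (h : t ≠ T - τ)
    (h' : T - t ≠ s + τ) :
    |(E.E₁ t s + E.E₂ t s 0) - (E'.E₁ t s + E'.E₂ t s 0)| ≤ 2 * f t := by
  have h1 := hB.le₁ t ht s hs h'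
  have h2 := hB.le₂ t ht s hs 0 ⟨by linarith, le_rfl⟩ h' (fun h'' => h (by linarith))
  rw [add_sub_add_comm]
  linarith [abs_add_le (E.E₁ t s - E'.E₁ t s) (E.E₂ t s 0 - E'.E₂ t s 0)]

/-- The feedback coefficients are bounded by `C`. -/
def Coeffs.FeedbackLE (T τ : ℝ) (E : Coeffs) (C : ℝ) : Prop :=
  (∀ t ∈ Icc 0 T, t ≠ T - τ → |E.E₀ t + E.E₁ t 0| ≤ C) ∧
  ∀ t ∈ Icc 0 T, ∀ s ∈ Icc (-τ) 0, t ≠ T - τ → T - t ≠ s + τ → |E.E₁ t s + E.E₂ t s 0| ≤ C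

lemma Coeffs.Admissible.exists_bound {E : Coeffs} (hE : E.Admissible T τ) :
    ∃ C, (∀ t ∈ Icc 0 T, |E.E₀ t| ≤ C) ∧ (∀ t s, (t, s) ∈ dom₁ T τ → |E.E₁ t s| ≤ C) ∧
      ∀ t s r, (t, s, r) ∈ dom₂ T τ → |E.E₂ t s r| ≤ C := by
  obtain ⟨C₀, h₀⟩ := isCompact_Icc.exists_bound_of_continuousOn hE.continuousOn₀
  obtain ⟨C₁, h₁⟩ := hE.bounded₁
  obtain ⟨C₂, h₂⟩ := hE.bounded₂
  refine ⟨max C₀ (max C₁ C₂), fun t ht => (h₀ t ht).trans (le_max_left _ _),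
    fun t s h => (h₁ t s h).trans ((le_max_left _ _).trans (le_max_right _ _)),
    fun t s r h => (h₂ t s r h).trans ((le_max_right _ _).trans (le_max_right _ _))⟩

lemma Coeffs.Admissible.exists_feedbackLE {E : Coeffs} (hE : E.Admissible T τ) (hτ : 0 ≤ τ) :
    ∃ C, E.FeedbackLE T τ C := by
  obtain ⟨C, h₀, h₁, h₂⟩ := hE.exists_bound
  have h0 : (0 : ℝ) ∈ Icc (-τ) 0 := ⟨by linarith, le_rfl⟩
  refine ⟨C + C, fun t ht h => ?_, fun t ht s hs h h' => ?_⟩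
  · exact (abs_add_le _ _).trans (add_le_add (h₀ t ht)
      (h₁ t 0 ⟨ht, h0, fun h' => h (by simp only at h'; linarith)⟩))
  · exact (abs_add_le _ _).trans (add_le_add (h₁ t s ⟨ht, hs, h'⟩)
      (h₂ t s 0 (mem_dom₂_of_ne ht hs h0 h' fun h'' => h (by linarith))))

lemma Coeffs.FeedbackLE.mono {E : Coeffs} {C C' : ℝ} (h : E.FeedbackLE T τ C) (hC : C ≤ C') :
    E.FeedbackLE T τ C' :=
  ⟨fun t ht h' => (h.1 t ht h').trans hC, fun t ht s hs h' h'' => (h.2 t ht s hs h' h'').trans hC⟩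

/-- One Picard step along the characteristics. -/
lemma Coeffs.DiffLE.step {E E' : Coeffs} {f g : ℝ → ℝ} {C : ℝ} (hτ : 0 ≤ τ)
    (hE : E.Admissible T τ) (hE' : E'.Admissible T τ)
    (hR : E.SolvesRiccati T τ σ ε c) (hR' : E'.SolvesRiccati T τ σ ε c)
    (hC : E.FeedbackLE T τ C) (hC' : E'.FeedbackLE T τ C)
    (hB : E.DiffLE T τ E' f) (hg : ContinuousOn g (Icc 0 T)) (hgT : g T = 0)
    (hg' : ∀ u ∈ Ioo 0 T, HasDerivAt g (-(8 * C * f u)) u) :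
    E.DiffLE T τ E' g := by
  have hsub : ∀ {a b u : ℝ}, 0 ≤ a → b ≤ T → u ∈ Ioo a b → u ∈ Ioo 0 T := fun ha hb hu =>
    ⟨ha.trans_lt hu.1, hu.2.trans_le hb⟩
  have hgc : ∀ {a b : ℝ}, 0 ≤ a → b ≤ T → ContinuousOn g (Icc a b) := fun ha hb =>
    hg.mono (Icc_subset_Icc ha hb)
  have key₀ : ∀ t ∈ Icc 0 T, |E.E₀ t - E'.E₀ t| ≤ g t := by
    intro t ht
    have h := abs_sub_le_of_hasDerivAt_off_point (f := fun t => E.E₀ t - E'.E₀ t)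
      (f' := fun t => (2 * (E.E₀ t + E.E₁ t 0) ^ 2 - ε / 2) -
        (2 * (E'.E₀ t + E'.E₁ t 0) ^ 2 - ε / 2)) (g := g) (g' := fun u => 8 * C * f u)
      (p := T - τ) ht.2
      ((hE.continuousOn₀.sub hE'.continuousOn₀).mono (Icc_subset_Icc_left ht.1))
      (hgc ht.1 le_rfl)
      (fun u hu hp => (hR.ode₀ u (hsub ht.1 le_rfl hu) hp).sub (hR'.ode₀ u (hsub ht.1 le_rfl hu) hp))
      (fun u hu _ => hg' u (hsub ht.1 le_rfl hu)) ?_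
    · simpa [hR.terminal₀, hR'.terminal₀, hgT] using h
    · intro u hu hp
      have hu' := Ioo_subset_Icc_self (hsub ht.1 le_rfl hu)
      have h1 := hB.abs_sub_feedback₀_le hτ hu' hp
      have h2 := abs_mul_sub_mul_le (hC.1 u hu' hp) (hC'.1 u hu' hp) h1 h1
      convert h2 using 2
      ring
  have key₁ : ∀ t ∈ Icc 0 T, ∀ s ∈ Icc (-τ) 0, T - t ≠ s + τ →
      |E.E₁ t s - E'.E₁ t s| ≤ g t := by
    intro t ht s hs hts
    obtain ⟨x, rfl⟩ : ∃ x, s = x - t - τ := ⟨t + s + τ, by ring⟩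
    have hx : x ≠ T := fun h => hts (by linarith)
    have h1 := hs.1
    have h2 := hs.2
    -- A bound at any later time `b` on the same characteristic is carried back to `t`.
    have main : ∀ b, t ≤ b → b ≤ T → b ≤ x →
        |E.E₁ b (x - b - τ) - E'.E₁ b (x - b - τ)| ≤ g b →
        |E.E₁ t (x - t - τ) - E'.E₁ t (x - t - τ)| ≤ g t := by
      intro b htb hbT hbx hend
      have h := abs_sub_le_of_hasDerivAt_off_point
        (f := fun u => E.E₁ u (x - u - τ) - E'.E₁ u (x - u - τ))
        (f' := fun u => 2 * (E.E₀ u + E.E₁ u 0) * (E.E₁ u (x - u - τ) + E.E₂ u (x - u - τ) 0) -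
          2 * (E'.E₀ u + E'.E₁ u 0) * (E'.E₁ u (x - u - τ) + E'.E₂ u (x - u - τ) 0))
        (g := g) (g' := fun u => 8 * C * f u) (p := T - τ) htb
        ((hE.continuousOn_char₁ ht.1 hbT (by linarith) hbx hx).sub
          (hE'.continuousOn_char₁ ht.1 hbT (by linarith) hbx hx)) (hgc ht.1 hbT)
        (fun u hu hp => ?_) (fun u hu _ => hg' u (hsub ht.1 hbT hu)) (fun u hu hp => ?_)
      · rw [abs_le] at h hend ⊢
        constructor <;> linarith
      · have hu' := hsub ht.1 hbT hu
        exact (hR.hasDerivAt_char₁ hu'.1 hu'.2 (hu.2.trans_le hbx) (by linarith [hu.1]) hp hx).sub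
          (hR'.hasDerivAt_char₁ hu'.1 hu'.2 (hu.2.trans_le hbx) (by linarith [hu.1]) hp hx)
      · have hu' := Ioo_subset_Icc_self (hsub ht.1 hbT hu)
        have hs' : x - u - τ ∈ Icc (-τ) 0 := ⟨by linarith [hu.2], by linarith [hu.1]⟩
        have hne : T - u ≠ x - u - τ + τ := fun h => hx (by linarith)
        exact abs_mul_sub_mul_le (hC.1 u hu' hp) (hC'.2 u hu' _ hs' hp hne)
          (hB.abs_sub_feedback₀_le hτ hu' hp) (hB.abs_sub_feedback₁_le hτ hu' hs' hp hne)
    -- For `x < T` the characteristic leaves through `s = -τ`, where the lateral condition reduces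
    -- the bound to `key₀`; for `x > T` it ends at time `T` on zero data.
    rcases lt_or_gt_of_ne hx with hlt | hgt
    · refine main x (by linarith) hlt.le le_rfl ?_
      rw [sub_self, zero_sub, hR.lateral₁ x ⟨by linarith [ht.1], hlt⟩,
        hR'.lateral₁ x ⟨by linarith [ht.1], hlt⟩, neg_sub_neg, abs_sub_comm]
      exact key₀ x ⟨by linarith [ht.1], hlt.le⟩
    · refine main T ht.2 le_rfl hgt.le ?_
      rw [hR.terminal₁ _ ⟨by linarith, by linarith [ht.2]⟩,
        hR'.terminal₁ _ ⟨by linarith, by linarith [ht.2]⟩, hgT]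
      simp
  have key₂ : ∀ t ∈ Icc 0 T, ∀ s ∈ Icc (-τ) 0, ∀ r ∈ Icc (-τ) 0, s ≤ r → T - t ≠ s + τ →
      T - t ≠ r + τ → |E.E₂ t s r - E'.E₂ t s r| ≤ g t := by
    intro t ht s hs r hr hsr hts htr
    obtain ⟨x, rfl⟩ : ∃ x, s = x - t - τ := ⟨t + s + τ, by ring⟩
    obtain ⟨y, rfl⟩ : ∃ y, r = y - t - τ := ⟨t + r + τ, by ring⟩
    have hx : x ≠ T := fun h => hts (by linarith)
    have hy : y ≠ T := fun h => htr (by linarith)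
    have hxy : x ≤ y := by linarith
    have hm : max x y ≠ T := by rwa [max_eq_right hxy]
    have h1 := hs.1
    have h2 := hs.2
    have h3 := hr.2
    have main : ∀ b, t ≤ b → b ≤ T → b ≤ x →
        |E.E₂ b (x - b - τ) (y - b - τ) - E'.E₂ b (x - b - τ) (y - b - τ)| ≤ g b →
        |E.E₂ t (x - t - τ) (y - t - τ) - E'.E₂ t (x - t - τ) (y - t - τ)| ≤ g t := by
      intro b htb hbT hbx hend
      have h := abs_sub_le_of_hasDerivAt_off_point
        (f := fun u => E.E₂ u (x - u - τ) (y - u - τ) - E'.E₂ u (x - u - τ) (y - u - τ))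
        (f' := fun u => 2 * (E.E₁ u (x - u - τ) + E.E₂ u (x - u - τ) 0) *
            (E.E₁ u (y - u - τ) + E.E₂ u (y - u - τ) 0) -
          2 * (E'.E₁ u (x - u - τ) + E'.E₂ u (x - u - τ) 0) *
            (E'.E₁ u (y - u - τ) + E'.E₂ u (y - u - τ) 0))
        (g := g) (g' := fun u => 8 * C * f u) (p := T - τ) htb
        ((hE.continuousOn_char₂ ht.1 hbT (by linarith) hbx (by linarith) (by linarith) hm).sub
          (hE'.continuousOn_char₂ ht.1 hbT (by linarith) hbx (by linarith) (by linarith) hm))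
        (hgc ht.1 hbT)
        (fun u hu hp => ?_) (fun u hu _ => hg' u (hsub ht.1 hbT hu)) (fun u hu hp => ?_)
      · rw [abs_le] at h hend ⊢
        constructor <;> linarith
      · have hu' := hsub ht.1 hbT hu
        have hux : u < x := hu.2.trans_le hbx
        exact (hR.hasDerivAt_char₂ hu'.1 hu'.2 hux (by linarith [hu.1])
          (by linarith) (by linarith [hu.1]) hp hx hy).sub
          (hR'.hasDerivAt_char₂ hu'.1 hu'.2 hux (by linarith [hu.1])
          (by linarith) (by linarith [hu.1]) hp hx hy)
      · have hu' := Ioo_subset_Icc_self (hsub ht.1 hbT hu)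
        have hs' : x - u - τ ∈ Icc (-τ) 0 := ⟨by linarith [hu.2], by linarith [hu.1]⟩
        have hr' : y - u - τ ∈ Icc (-τ) 0 := ⟨by linarith [hu.2], by linarith [hu.1]⟩
        have hne : T - u ≠ x - u - τ + τ := fun h => hx (by linarith)
        have hne' : T - u ≠ y - u - τ + τ := fun h => hy (by linarith)
        exact abs_mul_sub_mul_le (hC.2 u hu' _ hs' hp hne) (hC'.2 u hu' _ hr' hp hne')
          (hB.abs_sub_feedback₁_le hτ hu' hs' hp hne) (hB.abs_sub_feedback₁_le hτ hu' hr' hp hne')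
    -- Because `x ≤ y`, the first argument is the first to reach `-τ`. Symmetry moves it to the
    -- second slot, where the lateral condition reduces the bound to `key₁`.
    rcases lt_or_gt_of_ne hx with hlt | hgt
    · refine main x (by linarith) hlt.le le_rfl ?_
      have hx' : x ∈ Icc 0 T := ⟨by linarith [ht.1], hlt.le⟩
      have hr' : y - x - τ ∈ Icc (-τ) 0 := ⟨by linarith, by linarith⟩
      have hd1 : (x, y - x - τ) ∈ dom₁ T τ :=
        ⟨hx', hr', fun h => hy (by simp only at h; linarith)⟩
      have hd2 : (x, -τ, y - x - τ) ∈ dom₂ T τ :=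
        mem_dom₂_of_ne hx' ⟨le_rfl, by linarith⟩ hr' (fun h => hx (by linarith))
          (fun h => hy (by linarith))
      rw [sub_self, zero_sub, hE.symm _ _ _ hd2, hE'.symm _ _ _ hd2, hR.lateral₂ _ _ hd1,
        hR'.lateral₂ _ _ hd1, neg_sub_neg, abs_sub_comm]
      exact key₁ x hx' _ hr' hd1.2.2
    · refine main T ht.2 le_rfl hgt.le ?_
      have hne : (x - T - τ, y - T - τ) ≠ (-τ, -τ) := fun h => by
        have := (Prod.mk.inj h).1
        linarith
      have hs' : x - T - τ ∈ Icc (-τ) 0 := ⟨by linarith, by linarith [ht.2]⟩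
      have hr' : y - T - τ ∈ Icc (-τ) 0 := ⟨by linarith, by linarith [ht.2]⟩
      rw [hR.terminal₂ _ hs' _ hr' hne, hR'.terminal₂ _ hs' _ hr' hne, hgT]
      simp
  refine ⟨key₀, key₁, fun t ht s hs r hr hts htr => ?_⟩
  rcases le_total s r with h | h
  · exact key₂ t ht s hs r hr h hts htr
  · rw [hE.symm _ _ _ (mem_dom₂_of_ne ht hs hr hts htr),
      hE'.symm _ _ _ (mem_dom₂_of_ne ht hs hr hts htr)]
    exact key₂ t ht r hr s hs h htr hts

/-- Picard iteration: if bounds on the differences improve by integration, they vanish. -/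
lemma Coeffs.Admissible.diffLE_zero_of_step {E E' : Coeffs} {M : ℝ} (hE : E.Admissible T τ)
    (hE' : E'.Admissible T τ)
    (hstep : ∀ f g : ℝ → ℝ, E.DiffLE T τ E' f → ContinuousOn g (Icc 0 T) → g T = 0 →
      (∀ u ∈ Ioo 0 T, HasDerivAt g (-(M * f u)) u) → E.DiffLE T τ E' g) :
    E.DiffLE T τ E' fun _ => 0 := by
  obtain ⟨K₁, h10, h11, h12⟩ := hE.exists_bound
  obtain ⟨K₂, h20, h21, h22⟩ := hE'.exists_bound
  set K := K₁ + K₂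
  -- Each bound vanishes at `T` and has `-M` times the previous one as derivative, so integration
  -- produces the terms of an exponential series, which tend to zero.
  have hbd : ∀ n : ℕ, E.DiffLE T τ E' fun t => K * ((M * (T - t)) ^ n / n.factorial) := by
    intro n
    induction n with
    | zero =>
      have hab : ∀ a b : ℝ, |a| ≤ K₁ → |b| ≤ K₂ → |a - b| ≤ K := fun a b ha hb =>
        (abs_sub _ _).trans (add_le_add ha hb)
      simp only [pow_zero, Nat.factorial_zero, Nat.cast_one, div_one, mul_one]
      exact ⟨fun t ht => hab _ _ (h10 t ht) (h20 t ht),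
        fun t ht s hs h => hab _ _ (h11 t s ⟨ht, hs, h⟩) (h21 t s ⟨ht, hs, h⟩),
        fun t ht s hs r hr h h' => hab _ _ (h12 t s r (mem_dom₂_of_ne ht hs hr h h'))
          (h22 t s r (mem_dom₂_of_ne ht hs hr h h'))⟩
    | succ n ih =>
      refine hstep _ _ ih (by fun_prop) (by simp) fun u _ => ?_
      have h1 : HasDerivAt (fun u => M * (T - u)) (M * (-1)) u :=
        ((hasDerivAt_id u).const_sub T).const_mul _
      have h2 := ((h1.pow (n + 1)).div_const ((n + 1).factorial : ℝ)).const_mul K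
      refine h2.congr_deriv ?_
      have : ((n.factorial : ℝ)) ≠ 0 := by exact_mod_cast n.factorial_ne_zero
      rw [Nat.factorial_succ]
      push_cast
      field_simp
  have hlim : ∀ t, Tendsto (fun n : ℕ => K * ((M * (T - t)) ^ n / n.factorial)) atTop (𝓝 0) :=
    fun t => by
      simpa using (FloorSemiring.tendsto_pow_div_factorial_atTop (M * (T - t))).const_mul K
  exact ⟨fun t ht => ge_of_tendsto' (hlim t) fun n => (hbd n).le₀ t ht,
    fun t ht s hs h => ge_of_tendsto' (hlim t) fun n => (hbd n).le₁ t ht s hs h,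
    fun t ht s hs r hr h h' => ge_of_tendsto' (hlim t) fun n => (hbd n).le₂ t ht s hs r hr h h'⟩

lemma Coeffs.Admissible.exists_common_feedbackLE {E E' : Coeffs} (hE : E.Admissible T τ)
    (hE' : E'.Admissible T τ) (hτ : 0 ≤ τ) : ∃ C, E.FeedbackLE T τ C ∧ E'.FeedbackLE T τ C := by
  obtain ⟨C₁, hC₁⟩ := hE.exists_feedbackLE hτ
  obtain ⟨C₂, hC₂⟩ := hE'.exists_feedbackLE hτ
  exact ⟨max C₁ C₂, hC₁.mono (le_max_left _ _), hC₂.mono (le_max_right _ _)⟩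

/-- If the differences of `E₀`, `E₁`, `E₂` vanish, and `E₃` solves its equation off one point, then
the coefficients agree. -/
lemma Coeffs.DiffLE.agree {E E' : Coeffs} {p : ℝ} (hD : E.DiffLE T τ E' fun _ => 0)
    (hE : E.Admissible T τ) (hE' : E'.Admissible T τ) (h3 : E.E₃ T = E'.E₃ T)
    (hd : ∀ t ∈ Ioo 0 T, t ≠ p → HasDerivAt E.E₃ (-(σ ^ 2 * E.E₀ t)) t)
    (hd' : ∀ t ∈ Ioo 0 T, t ≠ p → HasDerivAt E'.E₃ (-(σ ^ 2 * E'.E₀ t)) t) :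
    E.Agree T τ E' := by
  have heq : ∀ {a b : ℝ}, |a - b| ≤ 0 → a = b := fun h => by
    have := abs_nonpos_iff.1 h; linarith
  have h0 : ∀ t ∈ Icc 0 T, E.E₀ t = E'.E₀ t := fun t ht => heq (hD.le₀ t ht)
  -- `Coeffs.DiffLE` omits the characteristic of the smaller argument as well, where `E₂` is still
  -- continuous. Equality there follows by letting that argument decrease to its value.
  have hlt : ∀ t s r, (t, s, r) ∈ dom₂ T τ → T - t = s + τ → E.E₂ t s r = E'.E₂ t s r := by
    intro t s r h hs
    obtain ⟨ht, hs', hr', hne⟩ := h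
    simp only at ht hs' hr' hne
    have hsr : s < r := by
      by_contra h'
      rw [max_eq_left (not_lt.1 h')] at hne
      exact hne hs
    have hmem : ∀ s' ∈ Ico s r, (t, s', r) ∈ dom₂ T τ := fun s' hs'' =>
      ⟨ht, ⟨hs'.1.trans hs''.1, hs''.2.le.trans hr'.2⟩, hr', by
        simp only [max_eq_right hs''.2.le]; linarith⟩
    have hlim : ∀ {F : Coeffs}, F.Admissible T τ →
        Tendsto (fun s' => F.E₂ t s' r) (𝓝[>] s) (𝓝 (F.E₂ t s r)) := fun {F} hF => by
      have h1 : ContinuousOn (fun s' => F.E₂ t s' r) (Ico s r) :=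
        hF.continuousOn₂.comp (f := fun s' => (t, s', r)) (by fun_prop) hmem
      have h2 := (h1 s (left_mem_Ico.2 hsr)).mono Ioo_subset_Ico_self
      rwa [ContinuousWithinAt, nhdsWithin_Ioo_eq_nhdsGT hsr] at h2
    refine tendsto_nhds_unique_of_eventuallyEq (hlim hE) (hlim hE') ?_
    filter_upwards [Ioo_mem_nhdsGT hsr] with s' hs''
    have hm := hmem s' (Ioo_subset_Ico_self hs'')
    exact heq (hD.le₂ t ht s' hm.2.1 r hr' (by linarith [hs''.1]) (by linarith))
  refine ⟨fun t ht => ⟨h0 t ht, ?_⟩, fun t s h => heq (hD.le₁ t h.1 s h.2.1 h.2.2), ?_⟩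
  · have h := abs_sub_le_of_hasDerivAt_off_point (f := fun t => E.E₃ t - E'.E₃ t)
      (f' := fun t => -(σ ^ 2 * E.E₀ t) - -(σ ^ 2 * E'.E₀ t)) (g := fun _ => 0) (g' := fun _ => 0)
      (p := p) ht.2
      ((hE.continuousOn₃.sub hE'.continuousOn₃).mono (Icc_subset_Icc_left ht.1))
      continuousOn_const
      (fun u hu hp => (hd u ⟨ht.1.trans_lt hu.1, hu.2⟩ hp).sub
        (hd' u ⟨ht.1.trans_lt hu.1, hu.2⟩ hp))
      (fun u _ _ => by simpa using hasDerivAt_const u (0 : ℝ))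
      (fun u hu _ => by rw [h0 u ⟨ht.1.trans hu.1.le, hu.2.le⟩]; simp)
    simp only [h3, sub_self, sub_zero] at h
    exact heq h
  · intro t s r h
    by_cases hs : T - t = s + τ
    · exact hlt t s r h hs
    by_cases hr : T - t = r + τ
    · rw [hE.symm _ _ _ h, hE'.symm _ _ _ h]
      exact hlt t r s ⟨h.1, h.2.2.1, h.2.1, by rw [max_comm]; exact h.2.2.2⟩ hr
    · exact heq (hD.le₂ t h.1 s h.2.1 r h.2.2.1 hs hr)

/-- Two solutions of the Riccati system agree. -/
theorem Coeffs.SolvesRiccati.agree {E E' : Coeffs} (hτ : 0 ≤ τ)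
    (hE : E.Admissible T τ) (hE' : E'.Admissible T τ)
    (hR : E.SolvesRiccati T τ σ ε c) (hR' : E'.SolvesRiccati T τ σ ε c) :
    E.Agree T τ E' := by
  obtain ⟨C, hC, hC'⟩ := hE.exists_common_feedbackLE hE' hτ
  have hD := hE.diffLE_zero_of_step (M := 8 * C) hE' fun f g hB hg hgT hg' =>
    hB.step hτ hE hE' hR hR' hC hC' hg hgT hg'
  -- The equation for `E₃` has no exceptional time here, so the omitted point may be any point
  -- outside the open interval.
  exact hD.agree (p := T) hE hE' (by rw [hR.terminal₃, hR'.terminal₃])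
    (fun t ht _ => hR.ode₃ t ht) fun t ht _ => hR'.ode₃ t ht

end Uniqueness

end DelayMFG
end

noncomputable section

namespace DelayMFG

/-! ### Integral operators on `H` and the graph of `A` -/

section Kernel

variable {τ : ℝ}

/-- The constant function `1` in `H`. -/
def oneVec (τ : ℝ) : PastControl τ :=
  indicatorConstLp 2 MeasurableSet.univ (measure_ne_top (delayMeasure τ) univ) 1

lemma integrable_coe (x : PastControl τ) : Integrable x (delayMeasure τ) :=
  (Lp.memLp x).integrable one_le_two

lemma inner_oneVec (x : PastControl τ) : inner ℝ (oneVec τ) x = ∫ s, x s ∂delayMeasure τ := by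
  rw [oneVec, L2.inner_indicatorConstLp_one, Measure.restrict_univ]

lemma inner_eq_integral (x y : PastControl τ) :
    inner ℝ x y = ∫ s, x s * y s ∂delayMeasure τ := by
  rw [L2.inner_def]
  refine integral_congr_ae (ae_of_all _ fun s => ?_)
  simp [mul_comm]

lemma integral_abs_le (x : PastControl τ) :
    ∫ s, |x s| ∂delayMeasure τ ≤ ‖oneVec τ‖ * ‖x‖ := by
  have h := real_inner_le_norm (oneVec τ) |x|
  rw [inner_oneVec, norm_abs_eq_norm] at h
  rwa [integral_congr_ae (Lp.coeFn_abs x)] at h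

/-- `K` is the integral operator on `H` with kernel `k`. -/
def IsKernelOp (k : ℝ → ℝ → ℝ) (K : PastControl τ →L[ℝ] PastControl τ) : Prop :=
  ∀ x : PastControl τ,
    K x =ᵐ[delayMeasure τ] fun s => ∫ r, k s r * x r ∂delayMeasure τ

lemma integrable_kernel_mul {k : ℝ → ℝ → ℝ} {C : ℝ} {s : ℝ}
    (hm : AEStronglyMeasurable (k s) (delayMeasure τ))
    (hC : ∀ᵐ r ∂delayMeasure τ, |k s r| ≤ C) (x : PastControl τ) :
    Integrable (fun r => k s r * x r) (delayMeasure τ) :=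
  (integrable_coe x).bdd_mul hm hC

lemma abs_integral_kernel_le {k : ℝ → ℝ → ℝ} {C : ℝ} {s : ℝ}
    (hC : ∀ᵐ r ∂delayMeasure τ, |k s r| ≤ C) (hC0 : 0 ≤ C) (x : PastControl τ) :
    |∫ r, k s r * x r ∂delayMeasure τ| ≤ C * (‖oneVec τ‖ * ‖x‖) := by
  have hg : Integrable (fun r => C * |x r|) (delayMeasure τ) := (integrable_coe x).abs.const_mul C
  refine (norm_integral_le_of_norm_le (f := fun r => k s r * x r) hg ?_).trans ?_
  · filter_upwards [hC] with r hr
    rw [norm_mul]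
    exact mul_le_mul_of_nonneg_right hr (abs_nonneg _)
  · rw [integral_const_mul]
    exact mul_le_mul_of_nonneg_left (integral_abs_le x) hC0

/-- A bounded kernel maps `H` into bounded functions, and the measure is finite. The operator bound
depends on the kernel only through `C`, which later makes it uniform in time. -/
lemma exists_isKernelOp {k : ℝ → ℝ → ℝ} {C : ℝ} (hC0 : 0 ≤ C)
    (hm : AEStronglyMeasurable (fun p : ℝ × ℝ => k p.1 p.2)
      ((delayMeasure τ).prod (delayMeasure τ)))
    (hC : ∀ᵐ s ∂delayMeasure τ, ∀ᵐ r ∂delayMeasure τ, |k s r| ≤ C) :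
    ∃ K : PastControl τ →L[ℝ] PastControl τ, IsKernelOp k K ∧
      ‖K‖ ≤ C * ‖oneVec τ‖ * ((measureUnivNNReal (delayMeasure τ) : ℝ) ^ (2 : ℝ)⁻¹) := by
  have hm' : ∀ᵐ s ∂delayMeasure τ, AEStronglyMeasurable (k s) (delayMeasure τ) :=
    hm.prodMk_left
  have hmx : ∀ x : PastControl τ, AEStronglyMeasurable
      (fun s => ∫ r, k s r * x r ∂delayMeasure τ) (delayMeasure τ) := fun x =>
    (hm.mul (Lp.aestronglyMeasurable x).comp_snd).integral_prod_right'
  have hb : ∀ x : PastControl τ, ∀ᵐ s ∂delayMeasure τ,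
      ‖∫ r, k s r * x r ∂delayMeasure τ‖ ≤ C * (‖oneVec τ‖ * ‖x‖) := fun x => by
    filter_upwards [hC] with s hs
    exact abs_integral_kernel_le hs hC0 x
  have hL : ∀ x : PastControl τ,
      MemLp (fun s => ∫ r, k s r * x r ∂delayMeasure τ) 2 (delayMeasure τ) := fun x =>
    MemLp.of_bound (hmx x) _ (hb x)
  let L : PastControl τ →ₗ[ℝ] PastControl τ :=
    { toFun := fun x => (hL x).toLp _
      map_add' := fun x y => by
        rw [← MemLp.toLp_add]
        refine MemLp.toLp_congr _ _ ?_
        filter_upwards [hC, hm'] with s hs hms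
        simp only [Pi.add_apply]
        rw [← integral_add (integrable_kernel_mul hms hs x) (integrable_kernel_mul hms hs y)]
        refine integral_congr_ae ?_
        filter_upwards [Lp.coeFn_add x y] with r hr
        rw [hr, Pi.add_apply, mul_add]
      map_smul' := fun a x => by
        rw [RingHom.id_apply, ← MemLp.toLp_const_smul]
        refine MemLp.toLp_congr _ _ (ae_of_all _ fun s => ?_)
        simp only [Pi.smul_apply, smul_eq_mul]
        rw [← integral_const_mul]
        refine integral_congr_ae ?_
        filter_upwards [Lp.coeFn_smul a x] with r hr
        rw [hr, Pi.smul_apply, smul_eq_mul]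
        ring }
  have hLn : ∀ x, ‖L x‖ ≤
      C * ‖oneVec τ‖ * ((measureUnivNNReal (delayMeasure τ) : ℝ) ^ (2 : ℝ)⁻¹) * ‖x‖ := fun x => by
    have h := Lp.norm_le_of_ae_bound (f := L x) (C := C * (‖oneVec τ‖ * ‖x‖)) (by positivity) (by
      filter_upwards [hb x, (hL x).coeFn_toLp] with s hs hs'
      change ‖((hL x).toLp _ : ℝ → ℝ) s‖ ≤ _
      rwa [hs'])
    refine h.trans_eq ?_
    simp only [ENNReal.toReal_ofNat]
    ring
  refine ⟨L.mkContinuous _ hLn, fun x => (hL x).coeFn_toLp, ?_⟩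
  exact LinearMap.mkContinuous_norm_le _ (by positivity) _

lemma exists_volterraOp (τ : ℝ) : ∃ J : PastControl τ →L[ℝ] PastControl τ,
    IsKernelOp (fun s r => if r ≤ s then 1 else 0) J := by
  have h1 : Measurable fun p : ℝ × ℝ => if p.2 ≤ p.1 then (1 : ℝ) else 0 :=
    Measurable.ite (measurableSet_le measurable_snd measurable_fst) measurable_const
      measurable_const
  obtain ⟨J, hJ, -⟩ := exists_isKernelOp (τ := τ) (k := fun s r => if r ≤ s then 1 else 0)
    zero_le_one h1.aestronglyMeasurable (ae_of_all _ fun s => ae_of_all _ fun r => by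
      split_ifs <;> simp)
  exact ⟨J, hJ⟩

/-- The operator `g ↦ ∫_{-τ}^· g` on `H`. -/
def volterraOp (τ : ℝ) : PastControl τ →L[ℝ] PastControl τ := (exists_volterraOp τ).choose

lemma integral_Icc_eq_intervalIntegral {s : ℝ} (hs : s ∈ Icc (-τ) 0) (g : ℝ → ℝ) :
    ∫ r, (if r ≤ s then 1 else 0) * g r ∂delayMeasure τ = ∫ r in (-τ)..s, g r := by
  rw [intervalIntegral.integral_of_le hs.1, ← integral_Icc_eq_integral_Ioc]
  have h1 : (fun r => (if r ≤ s then 1 else 0) * g r) = (Iic s).indicator g := by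
    ext r
    simp [indicator_apply]
  rw [h1, setIntegral_indicator measurableSet_Iic, show Icc (-τ) 0 ∩ Iic s = Icc (-τ) s from
    Set.ext fun r => ⟨fun h => ⟨h.1.1, h.2⟩, fun h => ⟨⟨h.1, h.2.trans hs.2⟩, h.2⟩⟩]

lemma volterraOp_ae (g : PastControl τ) :
    volterraOp τ g =ᵐ[delayMeasure τ] fun s => ∫ r in (-τ)..s, g r := by
  filter_upwards [(exists_volterraOp τ).choose_spec g,
    ae_restrict_mem (measurableSet_Icc (a := -τ) (b := 0))] with s hs hs'
  rw [← integral_Icc_eq_intervalIntegral hs']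
  exact hs

lemma intervalIntegral_congr_coe {f g : ℝ → ℝ} (h : f =ᵐ[delayMeasure τ] g) {s : ℝ}
    (hs : s ∈ Icc (-τ) 0) : ∫ r in (-τ)..s, f r = ∫ r in (-τ)..s, g r := by
  rw [intervalIntegral.integral_of_le hs.1, intervalIntegral.integral_of_le hs.1]
  refine integral_congr_ae (ae_restrict_of_ae_restrict_of_subset ?_ h)
  exact fun r hr => ⟨hr.1.le, hr.2.trans hs.2⟩

lemma intervalIntegral_eq_inner_oneVec (hτ : 0 ≤ τ) (g : PastControl τ) :
    ∫ r in (-τ)..0, g r = inner ℝ (oneVec τ) g := by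
  rw [inner_oneVec, intervalIntegral.integral_of_le (by linarith), ← integral_Icc_eq_integral_Ioc]

/-- With `-w.2` as weak derivative, membership in the domain becomes a pair of bounded linear
relations. They are free of representatives, so they pass through sums and Bochner integrals. -/
lemma graphA_iff (hτ : 0 ≤ τ) (z w : State τ) :
    GraphA z w ↔ z.2 = -volterraOp τ w.2 ∧ w.1 = -inner ℝ (oneVec τ) w.2 := by
  constructor
  · rintro ⟨f, g, ⟨hf, hfg⟩, h0, rfl⟩
    simp only [map_neg, neg_neg, inner_neg_right]
    constructor
    · refine Lp.ext ?_
      filter_upwards [hf, volterraOp_ae g,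
        ae_restrict_mem (measurableSet_Icc (a := -τ) (b := 0))] with s h1 h2 hs
      rw [h1, h2, hfg s hs, h0, zero_add]
    · rw [hfg 0 ⟨by linarith, le_rfl⟩, h0, zero_add, intervalIntegral_eq_inner_oneVec hτ]
  · rintro ⟨h1, h2⟩
    refine ⟨fun s => ∫ r in (-τ)..s, (-w.2 : PastControl τ) r, -w.2, ⟨?_, ?_⟩, ?_, ?_⟩
    · rw [h1, ← map_neg]
      exact volterraOp_ae (-w.2)
    · intro s _
      simp
    · simp
    · refine Prod.ext ?_ (neg_neg _).symm
      simp only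
      rw [intervalIntegral_eq_inner_oneVec hτ, inner_neg_right, h2]

/-- Every right neighbourhood of `-τ` meets the interval in positive measure, so two representatives
agree at points arbitrarily close to `-τ`, which forces equal limits. -/
lemma HasTrace.unique (hτ : 0 < τ) {x : PastControl τ} {a b : ℝ} (ha : HasTrace x a)
    (hb : HasTrace x b) : a = b := by
  obtain ⟨f, hf, hfa⟩ := ha
  obtain ⟨g, hg, hgb⟩ := hb
  have h : f =ᵐ[delayMeasure τ] g := hf.symm.trans hg
  have h1 : ∃ᶠ s in 𝓝[>] (-τ), f s = g s := by
    intro hne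
    obtain ⟨u, hu, hsub⟩ := (mem_nhdsGT_iff_exists_Ioo_subset).1 hne
    have hpos : 0 < volume (Ioo (-τ) (min u 0)) := by
      rw [Real.volume_Ioo, ENNReal.ofReal_pos]
      linarith [lt_min (mem_Ioi.1 hu) (by linarith : -τ < 0)]
    have hz : volume (Ioo (-τ) (min u 0)) = 0 := by
      have h2 : ∀ᵐ s ∂(volume.restrict (Ioo (-τ) (min u 0))), False := by
        have h3 : ∀ᵐ s ∂(volume.restrict (Ioo (-τ) (min u 0))), f s = g s :=
          ae_restrict_of_ae_restrict_of_subset (t := Icc (-τ) 0) (fun s hs =>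
            ⟨hs.1.le, hs.2.le.trans (min_le_right _ _)⟩) h
        filter_upwards [h3, ae_restrict_mem measurableSet_Ioo] with s hs hs'
        exact hsub ⟨hs'.1, hs'.2.trans_le (min_le_left _ _)⟩ hs
      have h4 := ae_iff.1 h2
      simpa using h4
    exact hpos.ne' hz
  by_contra hne
  obtain ⟨U, V, hU, hV, haU, hbV, hd⟩ := t2_separation hne
  have h2 := h1.and_eventually ((hfa.eventually (hU.mem_nhds haU)).and
    (hgb.eventually (hV.mem_nhds hbV)))
  obtain ⟨s, hs, hsU, hsV⟩ := h2.exists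
  exact Set.disjoint_left.1 hd hsU (by have : g s ∈ V := hsV; rwa [← hs] at this)

end Kernel

end DelayMFG
end

noncomputable section

namespace DelayMFG

/-! ### The quadratic form of the ansatz -/

section Quad

variable {T τ : ℝ} {E : Coeffs}

lemma ae_ne_delayMeasure (a : ℝ) : ∀ᵐ s ∂delayMeasure τ, s ≠ a :=
  ae_restrict_of_ae (by simp [ae_iff])

lemma ae_mem_dom₁ {t : ℝ} (ht : t ∈ Icc 0 T) :
    ∀ᵐ s ∂delayMeasure τ, (t, -τ - s) ∈ dom₁ T τ := by
  filter_upwards [ae_ne_delayMeasure (τ := τ) (t - T),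
    ae_restrict_mem (measurableSet_Icc (a := -τ) (b := 0))] with s hs hs'
  exact ⟨ht, ⟨by simp only; linarith [hs'.2], by simp only; linarith [hs'.1]⟩, fun h => hs (by
    simp only at h; linarith)⟩

lemma ae_mem_dom₂ {t : ℝ} (ht : t ∈ Icc 0 T) :
    ∀ᵐ p ∂(delayMeasure τ).prod (delayMeasure τ), (t, -τ - p.1, -τ - p.2) ∈ dom₂ T τ := by
  filter_upwards [Measure.quasiMeasurePreserving_fst.ae (ae_mem_dom₁ (τ := τ) ht),
    Measure.quasiMeasurePreserving_snd.ae (ae_mem_dom₁ (τ := τ) ht)] with p h1 h2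
  exact mem_dom₂_of_ne ht h1.2.1 h2.2.1 h1.2.2 h2.2.2

lemma ae_mem_dom₂_section {t s : ℝ} (ht : t ∈ Icc 0 T) (hs : s ∈ Icc (-τ) 0) (h : T - t ≠ s + τ) :
    ∀ᵐ r ∂delayMeasure τ, (t, s, -τ - r) ∈ dom₂ T τ := by
  filter_upwards [ae_mem_dom₁ (τ := τ) ht] with r hr
  exact mem_dom₂_of_ne ht hs hr.2.1 h hr.2.2

lemma measurableSet_dom₁ : MeasurableSet (dom₁ T τ) := by
  have h : dom₁ T τ = (Prod.fst ⁻¹' Icc 0 T) ∩ (Prod.snd ⁻¹' Icc (-τ) 0) ∩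
      {p : ℝ × ℝ | T - p.1 = p.2 + τ}ᶜ := by
    ext p
    exact ⟨fun h => ⟨⟨h.1, h.2.1⟩, h.2.2⟩, fun h => ⟨h.1.1, h.1.2, h.2⟩⟩
  rw [h]
  exact ((measurable_fst measurableSet_Icc).inter (measurable_snd measurableSet_Icc)).inter
    (isClosed_eq (by fun_prop) (by fun_prop)).measurableSet.compl

lemma measurableSet_dom₂ : MeasurableSet (dom₂ T τ) := by
  have h : dom₂ T τ = ((Prod.fst ⁻¹' Icc 0 T) ∩ ((fun p => p.2.1) ⁻¹' Icc (-τ) 0)) ∩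
      (((fun p => p.2.2) ⁻¹' Icc (-τ) 0) ∩ {p : ℝ × ℝ × ℝ | T - p.1 = max p.2.1 p.2.2 + τ}ᶜ) := by
    ext p
    exact ⟨fun h => ⟨⟨h.1, h.2.1⟩, h.2.2⟩, fun h => ⟨h.1.1, h.1.2, h.2⟩⟩
  rw [h]
  exact ((measurable_fst measurableSet_Icc).inter
    (measurable_snd.fst measurableSet_Icc)).inter ((measurable_snd.snd measurableSet_Icc).inter
    (isClosed_eq (by fun_prop) (by fun_prop)).measurableSet.compl)

lemma Coeffs.Admissible.aestronglyMeasurable₁ (hE : E.Admissible T τ) {t : ℝ} (ht : t ∈ Icc 0 T) :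
    AEStronglyMeasurable (fun s => E.E₁ t (-τ - s)) (delayMeasure τ) := by
  have hm : MeasurableSet ((fun s : ℝ => (t, -τ - s)) ⁻¹' dom₁ T τ) :=
    (by fun_prop : Measurable fun s : ℝ => (t, -τ - s)) measurableSet_dom₁
  rw [← Measure.restrict_eq_self_of_ae_mem (s := (fun s : ℝ => (t, -τ - s)) ⁻¹' dom₁ T τ)
    (ae_mem_dom₁ (τ := τ) ht)]
  exact ContinuousOn.aestronglyMeasurable (hE.continuousOn₁.comp (f := fun s => (t, -τ - s))
    (by fun_prop) (mapsTo_preimage _ _)) hm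

lemma Coeffs.Admissible.aestronglyMeasurable₂ (hE : E.Admissible T τ) {t : ℝ} (ht : t ∈ Icc 0 T) :
    AEStronglyMeasurable (fun p : ℝ × ℝ => E.E₂ t (-τ - p.1) (-τ - p.2))
      ((delayMeasure τ).prod (delayMeasure τ)) := by
  have hm : MeasurableSet ((fun p : ℝ × ℝ => (t, -τ - p.1, -τ - p.2)) ⁻¹' dom₂ T τ) :=
    (by fun_prop : Measurable fun p : ℝ × ℝ => (t, -τ - p.1, -τ - p.2)) measurableSet_dom₂
  rw [← Measure.restrict_eq_self_of_ae_mem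
    (s := (fun p : ℝ × ℝ => (t, -τ - p.1, -τ - p.2)) ⁻¹' dom₂ T τ) (ae_mem_dom₂ (τ := τ) ht)]
  exact ContinuousOn.aestronglyMeasurable (hE.continuousOn₂.comp
    (f := fun p : ℝ × ℝ => (t, -τ - p.1, -τ - p.2)) (by fun_prop) (mapsTo_preimage _ _)) hm

lemma Coeffs.Admissible.aestronglyMeasurable₂_section (hE : E.Admissible T τ) {t s : ℝ}
    (ht : t ∈ Icc 0 T) (hs : s ∈ Icc (-τ) 0) (h : T - t ≠ s + τ) :
    AEStronglyMeasurable (fun r => E.E₂ t s (-τ - r)) (delayMeasure τ) := by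
  have hm : MeasurableSet ((fun r : ℝ => (t, s, -τ - r)) ⁻¹' dom₂ T τ) :=
    (by fun_prop : Measurable fun r : ℝ => (t, s, -τ - r)) measurableSet_dom₂
  rw [← Measure.restrict_eq_self_of_ae_mem (s := (fun r : ℝ => (t, s, -τ - r)) ⁻¹' dom₂ T τ)
    (ae_mem_dom₂_section ht hs h)]
  exact ContinuousOn.aestronglyMeasurable (hE.continuousOn₂.comp
    (f := fun r : ℝ => (t, s, -τ - r)) (by fun_prop) (mapsTo_preimage _ _)) hm

/-- The class of a function in `H` (zero if it is not square integrable). -/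
def toH (τ : ℝ) (f : ℝ → ℝ) : PastControl τ :=
  open Classical in if h : MemLp f 2 (delayMeasure τ) then h.toLp f else 0

lemma toH_ae {f : ℝ → ℝ} (h : MemLp f 2 (delayMeasure τ)) : toH τ f =ᵐ[delayMeasure τ] f := by
  rw [toH, dif_pos h]
  exact h.coeFn_toLp

lemma inner_toH {f : ℝ → ℝ} (h : MemLp f 2 (delayMeasure τ)) (x : PastControl τ) :
    inner ℝ (toH τ f) x = ∫ s, f s * x s ∂delayMeasure τ := by
  rw [inner_eq_integral]
  refine integral_congr_ae ?_
  filter_upwards [toH_ae h] with s hs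
  rw [hs]

/-- The class of `s ↦ E₁(t, -τ - s)`. -/
def Coeffs.vec₁ (τ : ℝ) (E : Coeffs) (t : ℝ) : PastControl τ := toH τ fun s => E.E₁ t (-τ - s)

/-- The class of `r ↦ E₂(t, 0, -τ - r)`. -/
def Coeffs.vec₂ (τ : ℝ) (E : Coeffs) (t : ℝ) : PastControl τ := toH τ fun r => E.E₂ t 0 (-τ - r)

/-- The integral operator with kernel `E₂(t, -τ - s, -τ - r)`. -/
def Coeffs.op₂ (τ : ℝ) (E : Coeffs) (t : ℝ) : PastControl τ →L[ℝ] PastControl τ :=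
  open Classical in
  if h : ∃ K : PastControl τ →L[ℝ] PastControl τ,
      IsKernelOp (fun s r => E.E₂ t (-τ - s) (-τ - r)) K then h.choose else 0

lemma Coeffs.Admissible.memLp₁ (hE : E.Admissible T τ) {t : ℝ} (ht : t ∈ Icc 0 T) :
    MemLp (fun s => E.E₁ t (-τ - s)) 2 (delayMeasure τ) := by
  obtain ⟨C, hC⟩ := hE.bounded₁
  refine MemLp.of_bound (hE.aestronglyMeasurable₁ ht) C ?_
  filter_upwards [ae_mem_dom₁ ht] with s hs
  exact hC _ _ hs

lemma Coeffs.Admissible.memLp₂ (hE : E.Admissible T τ) (hτ : 0 ≤ τ) {t : ℝ} (ht : t ∈ Icc 0 T)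
    (h : t ≠ T - τ) : MemLp (fun r => E.E₂ t 0 (-τ - r)) 2 (delayMeasure τ) := by
  obtain ⟨C, hC⟩ := hE.bounded₂
  have h0 : (0 : ℝ) ∈ Icc (-τ) 0 := ⟨by linarith, le_rfl⟩
  have h' : T - t ≠ 0 + τ := fun h' => h (by linarith)
  refine MemLp.of_bound (hE.aestronglyMeasurable₂_section ht h0 h') C ?_
  filter_upwards [ae_mem_dom₂_section ht h0 h'] with s hs
  exact hC _ _ _ hs

lemma IsKernelOp.unique {k : ℝ → ℝ → ℝ} {K L : PastControl τ →L[ℝ] PastControl τ}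
    (hK : IsKernelOp k K) (hL : IsKernelOp k L) : K = L :=
  ContinuousLinearMap.ext fun x => Lp.ext ((hK x).trans (hL x).symm)

/-- The chosen operator equals the one constructed from the kernel because a kernel determines its
operator; it thereby inherits a norm bound independent of `t`. -/
lemma Coeffs.Admissible.op₂_spec (hE : E.Admissible T τ) :
    ∃ C, 0 ≤ C ∧ ∀ t ∈ Icc 0 T, ‖E.op₂ τ t‖ ≤ C ∧
      IsKernelOp (fun s r => E.E₂ t (-τ - s) (-τ - r)) (E.op₂ τ t) := by
  obtain ⟨C, hC⟩ := hE.bounded₂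
  refine ⟨max C 0 * ‖oneVec τ‖ * ((measureUnivNNReal (delayMeasure τ) : ℝ) ^ (2 : ℝ)⁻¹),
    by positivity, fun t ht => ?_⟩
  obtain ⟨K, hK, hKn⟩ := exists_isKernelOp (le_max_right C 0) (hE.aestronglyMeasurable₂ ht)
    (Measure.ae_ae_of_ae_prod (p := fun p : ℝ × ℝ => |E.E₂ t (-τ - p.1) (-τ - p.2)| ≤ max C 0) (by
      filter_upwards [ae_mem_dom₂ (τ := τ) ht] with p hp
      exact (hC _ _ _ hp).trans (le_max_left _ _)))
  have hex : ∃ K : PastControl τ →L[ℝ] PastControl τ,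
      IsKernelOp (fun s r => E.E₂ t (-τ - s) (-τ - r)) K := ⟨K, hK⟩
  have h : E.op₂ τ t = K := by
    rw [Coeffs.op₂, dif_pos hex]
    exact hex.choose_spec.unique hK
  rw [h]
  exact ⟨hKn, hK⟩

lemma Coeffs.Admissible.exists_norm_op₂_le (hE : E.Admissible T τ) :
    ∃ C, 0 ≤ C ∧ ∀ t ∈ Icc 0 T, ‖E.op₂ τ t‖ ≤ C := by
  obtain ⟨C, h0, h⟩ := hE.op₂_spec
  exact ⟨C, h0, fun t ht => (h t ht).1⟩

lemma Coeffs.Admissible.isKernelOp₂ (hE : E.Admissible T τ) {t : ℝ} (ht : t ∈ Icc 0 T) :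
    IsKernelOp (fun s r => E.E₂ t (-τ - s) (-τ - r)) (E.op₂ τ t) := by
  obtain ⟨C, h0, h⟩ := hE.op₂_spec
  exact (h t ht).2

lemma Coeffs.Admissible.exists_norm_vec₁_le (hE : E.Admissible T τ) :
    ∃ C, 0 ≤ C ∧ ∀ t ∈ Icc 0 T, ‖E.vec₁ τ t‖ ≤ C := by
  obtain ⟨C, hC⟩ := hE.bounded₁
  refine ⟨(measureUnivNNReal (delayMeasure τ) : ℝ) ^ (ENNReal.toReal 2)⁻¹ * max C 0, by positivity,
    fun t ht => Lp.norm_le_of_ae_bound (le_max_right _ _) ?_⟩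
  filter_upwards [toH_ae (hE.memLp₁ ht), ae_mem_dom₁ ht] with s hs hs'
  rw [Coeffs.vec₁, hs]
  exact (hC _ _ hs').trans (le_max_left _ _)

lemma Coeffs.Admissible.inner_vec₁ (hE : E.Admissible T τ) {t : ℝ} (ht : t ∈ Icc 0 T)
    (x : PastControl τ) :
    inner ℝ (E.vec₁ τ t) x = ∫ s, E.E₁ t (-τ - s) * x s ∂delayMeasure τ :=
  inner_toH (hE.memLp₁ ht) x

lemma integrable_mul_prod (y x : PastControl τ) :
    Integrable (fun p : ℝ × ℝ => y p.1 * x p.2) ((delayMeasure τ).prod (delayMeasure τ)) :=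
  (integrable_coe y).mul_prod (integrable_coe x)

lemma Coeffs.Admissible.integrable₂ (hE : E.Admissible T τ) {t : ℝ} (ht : t ∈ Icc 0 T)
    (y x : PastControl τ) :
    Integrable (fun p : ℝ × ℝ => E.E₂ t (-τ - p.1) (-τ - p.2) * (y p.1 * x p.2))
      ((delayMeasure τ).prod (delayMeasure τ)) := by
  obtain ⟨C, hC⟩ := hE.bounded₂
  refine (integrable_mul_prod y x).bdd_mul (c := C) (hE.aestronglyMeasurable₂ ht) ?_
  filter_upwards [ae_mem_dom₂ ht] with p hp
  exact hC _ _ _ hp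

lemma Coeffs.Admissible.inner_op₂ (hE : E.Admissible T τ) {t : ℝ} (ht : t ∈ Icc 0 T)
    (y x : PastControl τ) :
    inner ℝ y (E.op₂ τ t x) = ∫ p : ℝ × ℝ, E.E₂ t (-τ - p.1) (-τ - p.2) * (y p.1 * x p.2)
      ∂(delayMeasure τ).prod (delayMeasure τ) := by
  rw [inner_eq_integral, integral_prod _ (hE.integrable₂ ht y x)]
  refine integral_congr_ae ?_
  filter_upwards [hE.isKernelOp₂ ht x] with s hs
  rw [hs, ← integral_const_mul]
  refine integral_congr_ae (ae_of_all _ fun r => ?_)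
  simp only
  ring

lemma Coeffs.Admissible.inner_op₂_comm (hE : E.Admissible T τ) {t : ℝ} (ht : t ∈ Icc 0 T)
    (y x : PastControl τ) :
    inner ℝ y (E.op₂ τ t x) = inner ℝ x (E.op₂ τ t y) := by
  rw [hE.inner_op₂ ht, hE.inner_op₂ ht, ← integral_prod_swap]
  refine integral_congr_ae ?_
  filter_upwards [ae_mem_dom₂ ht] with p hp
  simp only [Prod.fst_swap, Prod.snd_swap]
  rw [hE.symm _ _ _ hp, mul_comm (y _)]

/-- The quadratic form of the ansatz, as a function of `x = (m₀ - z₀, m₁ - z₁)`. -/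
def Coeffs.quad (E : Coeffs) (t : ℝ) (x : State τ) : ℝ :=
  E.E₀ t * x.1 ^ 2 - 2 * x.1 * inner ℝ (E.vec₁ τ t) x.2 + inner ℝ x.2 (E.op₂ τ t x.2) + E.E₃ t

/-- The difference between the mean of `ν` and `z`. -/
def deviation (z : State τ) (ν : Measure (State τ)) : State τ := (mean₀ ν - z.1, mean₁ ν - z.2)

lemma Coeffs.Admissible.ansatz_eq (hE : E.Admissible T τ) {t : ℝ} (ht : t ∈ Icc 0 T)
    (z : State τ) (ν : Measure (State τ)) :
    ansatz τ E t z ν = E.quad t (deviation z ν) := by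
  rw [ansatz, Coeffs.quad, deviation, hE.inner_vec₁ ht]
  congr 2
  rw [inner_eq_integral]
  refine integral_congr_ae ?_
  filter_upwards [hE.isKernelOp₂ ht (mean₁ ν - z.2)] with s hs
  rw [hs, ← integral_const_mul]
  refine integral_congr_ae (ae_of_all _ fun r => ?_)
  simp only
  ring

/-- The `z₀`-component of the gradient of the quadratic form. -/
def Coeffs.grad₀ (E : Coeffs) (t : ℝ) (x : State τ) : ℝ :=
  2 * E.E₀ t * x.1 - 2 * inner ℝ (E.vec₁ τ t) x.2

/-- The `H`-component of the gradient of the quadratic form. -/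
def Coeffs.grad₁ (E : Coeffs) (t : ℝ) (x : State τ) : PastControl τ :=
  (2 : ℝ) • (E.op₂ τ t x.2 - x.1 • E.vec₁ τ t)

/-- The gradient of the quadratic form. -/
def Coeffs.grad (E : Coeffs) (t : ℝ) (x : State τ) : State τ := (E.grad₀ t x, E.grad₁ t x)

/-- The trace at `-τ` of the `H`-component of the gradient. -/
def Coeffs.bdry (E : Coeffs) (t : ℝ) (x : State τ) : ℝ :=
  2 * inner ℝ (E.vec₂ τ t) x.2 - 2 * x.1 * E.E₁ t 0

/-- The optimal feedback, as a function of `x = (m₀ - z₀, m₁ - z₁)`. -/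
def Coeffs.feedback (E : Coeffs) (t : ℝ) (x : State τ) : ℝ :=
  (E.E₀ t + E.E₁ t 0) * x.1 - inner ℝ (E.vec₁ τ t + E.vec₂ τ t) x.2

lemma Coeffs.grad₀_sub_bdry (t : ℝ) (x : State τ) :
    E.grad₀ t x - E.bdry t x = 2 * E.feedback t x := by
  simp only [Coeffs.grad₀, Coeffs.bdry, Coeffs.feedback, inner_add_left]
  ring

/-- The expansion is exact because the form is quadratic; symmetry of `op₂` merges the two cross
terms. It supplies the flat derivative and later the chain rule along curves. -/
lemma Coeffs.Admissible.quad_add (hE : E.Admissible T τ) {t : ℝ} (ht : t ∈ Icc 0 T)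
    (x y : State τ) (h : ℝ) :
    E.quad t (x + h • y) = E.quad t x + h * pairing (E.grad t x) y
      + h ^ 2 * (E.quad t y - E.E₃ t) := by
  simp only [Coeffs.quad, Coeffs.grad, Coeffs.grad₀, Coeffs.grad₁, pairing, Prod.fst_add,
    Prod.snd_add, Prod.smul_fst, Prod.smul_snd, smul_eq_mul, map_add, map_smul, inner_add_left,
    inner_add_right, real_inner_smul_left, real_inner_smul_right, inner_sub_left]
  rw [hE.inner_op₂_comm ht x.2 y.2, real_inner_comm y.2 (E.op₂ τ t x.2)]
  ring

lemma Coeffs.Admissible.tendsto₁ (hE : E.Admissible T τ) {t s : ℝ} (h : (t, s) ∈ dom₁ T τ) :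
    Tendsto (fun u => E.E₁ u s) (𝓝[Icc 0 T] t) (𝓝 (E.E₁ t s)) := by
  have hc : ContinuousWithinAt (fun u : ℝ => (u, s)) (Icc 0 T) t := by fun_prop
  refine (hE.continuousOn₁ (t, s) h).tendsto.comp (tendsto_nhdsWithin_iff.2 ⟨hc, ?_⟩)
  have ho : {u : ℝ | T - u ≠ s + τ} ∈ 𝓝 t :=
    (isOpen_ne_fun (by fun_prop) (by fun_prop)).mem_nhds h.2.2
  filter_upwards [mem_nhdsWithin_of_mem_nhds ho, self_mem_nhdsWithin] with u hu hu'
  exact ⟨hu', h.2.1, hu⟩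

lemma Coeffs.Admissible.tendsto₂ (hE : E.Admissible T τ) {t s r : ℝ}
    (h : (t, s, r) ∈ dom₂ T τ) :
    Tendsto (fun u => E.E₂ u s r) (𝓝[Icc 0 T] t) (𝓝 (E.E₂ t s r)) := by
  have hc : ContinuousWithinAt (fun u : ℝ => (u, s, r)) (Icc 0 T) t := by fun_prop
  refine (hE.continuousOn₂ (t, s, r) h).tendsto.comp (tendsto_nhdsWithin_iff.2 ⟨hc, ?_⟩)
  have ho : {u : ℝ | T - u ≠ max s r + τ} ∈ 𝓝 t :=
    (isOpen_ne_fun (by fun_prop) (by fun_prop)).mem_nhds h.2.2.2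
  filter_upwards [mem_nhdsWithin_of_mem_nhds ho, self_mem_nhdsWithin] with u hu hu'
  exact ⟨hu', h.2.1, h.2.2.1, hu⟩

/-- At each time the excluded line meets the delay interval in a null set, so pointwise convergence
holds almost everywhere and the uniform bound gives dominated convergence. -/
lemma Coeffs.Admissible.continuousOn_inner_vec₁ (hE : E.Admissible T τ) (x : PastControl τ) :
    ContinuousOn (fun t => inner ℝ (E.vec₁ τ t) x) (Icc 0 T) := by
  obtain ⟨C, hC⟩ := hE.bounded₁
  refine ContinuousOn.congr (f := fun t => ∫ s, E.E₁ t (-τ - s) * x s ∂delayMeasure τ) ?_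
    fun t ht => hE.inner_vec₁ ht x
  intro t ht
  refine tendsto_integral_filter_of_dominated_convergence (fun s => C * |x s|) ?_ ?_
    ((integrable_coe x).abs.const_mul C) ?_
  · filter_upwards [self_mem_nhdsWithin] with u hu
    exact (hE.aestronglyMeasurable₁ hu).mul (Lp.aestronglyMeasurable x)
  · filter_upwards [self_mem_nhdsWithin] with u hu
    filter_upwards [ae_mem_dom₁ hu] with s hs
    rw [norm_mul]
    exact mul_le_mul_of_nonneg_right (hC _ _ hs) (abs_nonneg _)
  · filter_upwards [ae_mem_dom₁ ht] with s hs
    exact (hE.tendsto₁ hs).mul_const _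

lemma Coeffs.Admissible.continuousOn_inner_op₂ (hE : E.Admissible T τ) (y x : PastControl τ) :
    ContinuousOn (fun t => inner ℝ y (E.op₂ τ t x)) (Icc 0 T) := by
  obtain ⟨C, hC⟩ := hE.bounded₂
  refine ContinuousOn.congr (f := fun t => ∫ p : ℝ × ℝ, E.E₂ t (-τ - p.1) (-τ - p.2) *
    (y p.1 * x p.2) ∂(delayMeasure τ).prod (delayMeasure τ)) ?_ fun t ht => hE.inner_op₂ ht y x
  intro t ht
  refine tendsto_integral_filter_of_dominated_convergence (fun p => C * |y p.1 * x p.2|) ?_ ?_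
    ((integrable_mul_prod y x).abs.const_mul C) ?_
  · filter_upwards [self_mem_nhdsWithin] with u hu
    exact (hE.aestronglyMeasurable₂ hu).mul (integrable_mul_prod y x).aestronglyMeasurable
  · filter_upwards [self_mem_nhdsWithin] with u hu
    filter_upwards [ae_mem_dom₂ hu] with p hp
    rw [norm_mul]
    exact mul_le_mul_of_nonneg_right (hC _ _ _ hp) (abs_nonneg _)
  · filter_upwards [ae_mem_dom₂ ht] with p hp
    exact (hE.tendsto₂ hp).mul_const _

lemma Coeffs.Admissible.continuousOn_quad (hE : E.Admissible T τ) (x : State τ) :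
    ContinuousOn (fun t => E.quad t x) (Icc 0 T) :=
  (((hE.continuousOn₀.mul continuousOn_const).sub
    (continuousOn_const.mul (hE.continuousOn_inner_vec₁ x.2))).add
    (hE.continuousOn_inner_op₂ x.2 x.2)).add hE.continuousOn₃

/-- Under `s ↦ -τ - s` the trace point `-τ` corresponds to the argument `0`. It lies on the excluded
characteristic only at time `T - τ`; otherwise the kernels extend continuously to it. -/
lemma Coeffs.Admissible.hasTrace_grad₁ (hE : E.Admissible T τ) (hτ : 0 < τ) {t : ℝ}
    (ht : t ∈ Icc 0 T) (h : t ≠ T - τ) (x : State τ) :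
    HasTrace (E.grad₁ t x) (E.bdry t x) := by
  obtain ⟨C, hC⟩ := hE.bounded₂
  have h0 : (0 : ℝ) ∈ Icc (-τ) 0 := ⟨by linarith, le_rfl⟩
  have hne : T - t ≠ 0 + τ := fun h' => h (by linarith)
  have hev : ∀ᶠ s in 𝓝[>] (-τ), -τ - s ∈ Icc (-τ) 0 ∧ T - t ≠ (-τ - s) + τ := by
    have ho : {s : ℝ | T - t ≠ (-τ - s) + τ} ∈ 𝓝 (-τ) :=
      (isOpen_ne_fun (by fun_prop) (by fun_prop)).mem_nhds (by simpa using hne)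
    filter_upwards [mem_nhdsWithin_of_mem_nhds ho, Ioo_mem_nhdsGT (by linarith : -τ < 0)] with s hs hs'
    exact ⟨⟨by linarith [hs'.2], by linarith [hs'.1]⟩, hs⟩
  have hlim : Tendsto (fun s : ℝ => -τ - s) (𝓝[>] (-τ)) (𝓝 0) := by
    have : Tendsto (fun s : ℝ => -τ - s) (𝓝 (-τ)) (𝓝 (-τ - -τ)) :=
      (by fun_prop : Continuous fun s : ℝ => -τ - s).tendsto _
    rw [sub_self] at this
    exact this.mono_left nhdsWithin_le_nhds
  refine ⟨fun s => 2 * ((∫ r, E.E₂ t (-τ - s) (-τ - r) * x.2 r ∂delayMeasure τ) -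
    x.1 * E.E₁ t (-τ - s)), ?_, ?_⟩
  · rw [Coeffs.grad₁]
    filter_upwards [Lp.coeFn_smul (2 : ℝ) (E.op₂ τ t x.2 - x.1 • E.vec₁ τ t),
      Lp.coeFn_sub (E.op₂ τ t x.2) (x.1 • E.vec₁ τ t), Lp.coeFn_smul x.1 (E.vec₁ τ t),
      toH_ae (hE.memLp₁ ht), hE.isKernelOp₂ ht x.2] with s h1 h2 h3 h4 h5
    rw [h1, Pi.smul_apply, h2, Pi.sub_apply, h3, Pi.smul_apply, h5, smul_eq_mul, smul_eq_mul,
      Coeffs.vec₁, h4]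
  · have h1 : Tendsto (fun s => E.E₁ t (-τ - s)) (𝓝[>] (-τ)) (𝓝 (E.E₁ t 0)) := by
      refine (hE.continuousOn₁ (t, 0) ⟨ht, h0, hne⟩).tendsto.comp
        (tendsto_nhdsWithin_iff.2 ⟨tendsto_const_nhds.prodMk_nhds hlim, ?_⟩)
      filter_upwards [hev] with s hs
      exact ⟨ht, hs.1, hs.2⟩
    have h2 : Tendsto (fun s => ∫ r, E.E₂ t (-τ - s) (-τ - r) * x.2 r ∂delayMeasure τ)
        (𝓝[>] (-τ)) (𝓝 (inner ℝ (E.vec₂ τ t) x.2)) := by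
      rw [Coeffs.vec₂, inner_toH (hE.memLp₂ hτ.le ht h)]
      refine tendsto_integral_filter_of_dominated_convergence (fun r => C * |x.2 r|) ?_ ?_
        ((integrable_coe x.2).abs.const_mul C) ?_
      · filter_upwards [hev] with s hs
        exact (hE.aestronglyMeasurable₂_section ht hs.1 hs.2).mul (Lp.aestronglyMeasurable x.2)
      · filter_upwards [hev] with s hs
        filter_upwards [ae_mem_dom₂_section ht hs.1 hs.2] with r hr
        rw [norm_mul]
        exact mul_le_mul_of_nonneg_right (hC _ _ _ hr) (abs_nonneg _)
      · filter_upwards [ae_mem_dom₁ ht] with r hr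
        refine Tendsto.mul_const _ ?_
        refine (hE.continuousOn₂ (t, 0, -τ - r)
          (mem_dom₂_of_ne ht h0 hr.2.1 hne hr.2.2)).tendsto.comp
          (tendsto_nhdsWithin_iff.2 ⟨tendsto_const_nhds.prodMk_nhds
            (hlim.prodMk_nhds tendsto_const_nhds), ?_⟩)
        filter_upwards [hev] with s hs
        exact mem_dom₂_of_ne ht hs.1 hr.2.1 hs.2 hr.2.2
    have h3 := ((h2.sub (h1.const_mul x.1)).const_mul 2)
    convert h3 using 2
    rw [Coeffs.bdry]
    ring

end Quad

end DelayMFG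
end

noncomputable section

namespace DelayMFG

/-! ### The master equation in terms of the quadratic form -/

section Master

variable {T τ σ ε : ℝ} {E : Coeffs}

instance instSecondCountablePastControl (τ : ℝ) : SecondCountableTopology (PastControl τ) :=
  haveI : Fact ((2 : ENNReal) ≠ ⊤) := ⟨ENNReal.ofNat_ne_top⟩
  inferInstance

lemma mean₀_eq (ν : Measure (State τ)) : mean₀ ν = ∫ y, y.1 ∂ν := by
  rw [mean₀, Measure.fst]
  exact integral_map measurable_fst.aemeasurable aestronglyMeasurable_id

lemma mean₁_eq (ν : Measure (State τ)) : mean₁ ν = ∫ y, y.2 ∂ν := by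
  rw [mean₁, Measure.snd]
  exact integral_map measurable_snd.aemeasurable
    (continuous_id.stronglyMeasurable.aestronglyMeasurable)

lemma IsP1.integrable_fst {ν : Measure (State τ)} (hν : IsP1 ν) :
    Integrable (fun y : State τ => y.1) ν := hν.2.fst

lemma IsP1.integrable_snd {ν : Measure (State τ)} (hν : IsP1 ν) :
    Integrable (fun y : State τ => y.2) ν := hν.2.snd

lemma integral_mix {F : Type*} [NormedAddCommGroup F] [NormedSpace ℝ F] {ν ν' : Measure (State τ)}
    {f : State τ → F} (hf : Integrable f ν) (hf' : Integrable f ν') {h : ℝ} (h0 : 0 ≤ h)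
    (h1 : h ≤ 1) :
    ∫ y, f y ∂mix h ν ν' = (∫ y, f y ∂ν) + h • ((∫ y, f y ∂ν') - ∫ y, f y ∂ν) := by
  rw [mix, integral_add_measure (hf.smul_measure ENNReal.ofReal_ne_top)
    (hf'.smul_measure ENNReal.ofReal_ne_top), integral_smul_measure, integral_smul_measure,
    ENNReal.toReal_ofReal (by linarith), ENNReal.toReal_ofReal h0, sub_smul, one_smul, smul_sub]
  abel

/-- The ansatz sees `ν` only through its means, which are affine along mixtures; differentiating in
the measure is therefore differentiating along a line in the state space. -/
lemma deviation_mix {ν ν' : Measure (State τ)} (hν : IsP1 ν) (hν' : IsP1 ν') (z : State τ) {h : ℝ}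
    (h0 : 0 ≤ h) (h1 : h ≤ 1) :
    deviation z (mix h ν ν') = deviation z ν + h • (mean₀ ν' - mean₀ ν, mean₁ ν' - mean₁ ν) := by
  simp only [deviation, mean₀_eq, mean₁_eq,
    integral_mix hν.integrable_fst hν'.integrable_fst h0 h1,
    integral_mix hν.integrable_snd hν'.integrable_snd h0 h1, Prod.smul_mk, Prod.mk_add_mk]
  congr 1 <;> abel

lemma integrable_pairing {ν : Measure (State τ)} {w : State τ → State τ} (hw : Integrable w ν)
    (p : State τ) : Integrable (fun y => pairing (w y) p) ν := by
  have h1 : Integrable (fun y => (w y).1) ν := hw.fst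
  have h2 : Integrable (fun y => (w y).2) ν := hw.snd
  exact (h1.mul_const _).add (h2.inner_const p.2)

lemma integral_pairing {ν : Measure (State τ)} {w : State τ → State τ} (hw : Integrable w ν)
    (p : State τ) : ∫ y, pairing (w y) p ∂ν = pairing (∫ y, (w y).1 ∂ν, ∫ y, (w y).2 ∂ν) p := by
  have h1 : Integrable (fun y => (w y).1) ν := hw.fst
  have h2 : Integrable (fun y => (w y).2) ν := hw.snd
  simp only [pairing]
  rw [integral_add (h1.mul_const _) (h2.inner_const p.2), integral_mul_const]
  congr 1
  rw [real_inner_comm, ← integral_inner h2]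
  simp only [real_inner_comm]

lemma pairing_comm (x y : State τ) : pairing x y = pairing y x := by
  rw [pairing, pairing, mul_comm, real_inner_comm]

lemma hasGradientAt_pairing (p y : State τ) :
    HasGradientAt (fun x => pairing (y.1, x) p) p.2 y.2 := by
  rw [hasGradientAt_iff_hasFDerivAt]
  have h := ((innerSL ℝ p.2).hasFDerivAt (x := y.2)).const_add (y.1 * p.1)
  refine h.congr_of_eventuallyEq (Eventually.of_forall fun x => ?_)
  simp [pairing, real_inner_comm]

lemma contDiff_pairing (p : State τ) : ContDiff ℝ 1 fun y => pairing y p := by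
  exact (contDiff_fst.mul contDiff_const).add (contDiff_snd.inner ℝ contDiff_const)

lemma hasDerivAt_quad_fst (t m : ℝ) (y : State τ) (m₁ : PastControl τ) :
    HasDerivAt (fun x => E.quad t ((m - x, m₁ - y.2) : State τ))
      (-E.grad₀ t ((m - y.1, m₁ - y.2) : State τ)) y.1 := by
  have h1 : HasDerivAt (fun x : ℝ => m - x) (-1) y.1 := (hasDerivAt_id _).const_sub m
  have h2 := ((((h1.pow 2).const_mul (E.E₀ t)).sub (((h1.const_mul 2).mul_const
    (inner ℝ (E.vec₁ τ t) (m₁ - y.2))))).add_const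
    (inner ℝ (m₁ - y.2) (E.op₂ τ t (m₁ - y.2)))).add_const (E.E₃ t)
  refine h2.congr_deriv ?_
  simp only [Coeffs.grad₀]
  push_cast
  ring

lemma Coeffs.Admissible.hasGradientAt_quad (hE : E.Admissible T τ) {t : ℝ} (ht : t ∈ Icc 0 T)
    (m : ℝ) (y : State τ) (m₁ : PastControl τ) :
    HasGradientAt (fun x => E.quad t ((m - y.1, m₁ - x) : State τ))
      (-E.grad₁ t ((m - y.1, m₁ - y.2) : State τ)) y.2 := by
  rw [hasGradientAt_iff_hasFDerivAt]
  have h1 : HasFDerivAt (fun x : PastControl τ => m₁ - x) (-ContinuousLinearMap.id ℝ _) y.2 :=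
    (hasFDerivAt_id _).const_sub m₁
  have h2 := ((innerSL ℝ (E.vec₁ τ t)).hasFDerivAt.comp y.2 h1).const_mul (2 * (m - y.1))
  have h3 := h1.inner ℝ ((E.op₂ τ t).hasFDerivAt.comp y.2 h1)
  have h4 := ((h2.const_sub (E.E₀ t * (m - y.1) ^ 2)).add h3).add_const (E.E₃ t)
  refine (h4.congr_fderiv ?_).congr_of_eventuallyEq (Eventually.of_forall fun x => ?_)
  · ext k
    have hs := hE.inner_op₂_comm ht (m₁ - y.2) k
    simp only [Coeffs.grad₁, ContinuousLinearMap.comp_apply, fderivInnerCLM_apply, add_apply,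
      neg_apply, smul_apply, ContinuousLinearMap.prod_apply, InnerProductSpace.toDual_apply_apply,
      ContinuousLinearMap.id_apply, map_neg, innerSL_apply_apply, inner_neg_left, inner_neg_right,
      real_inner_smul_left, inner_sub_left (E.op₂ τ t _), smul_eq_mul, Function.comp_apply]
    rw [real_inner_comm k (E.op₂ τ t _)]
    linarith
  · simp [Coeffs.quad]

lemma HasTrace.neg {x : PastControl τ} {a : ℝ} (h : HasTrace x a) : HasTrace (-x) (-a) := by
  obtain ⟨f, hf, hfa⟩ := h
  refine ⟨fun s => -f s, ?_, hfa.neg⟩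
  filter_upwards [hf, Lp.coeFn_neg x] with s h1 h2
  rw [h2, Pi.neg_apply, h1]

lemma Coeffs.feedback_eq_pairing (t : ℝ) (x : State τ) :
    E.feedback t x = pairing x (E.E₀ t + E.E₁ t 0, -(E.vec₁ τ t + E.vec₂ τ t)) := by
  simp only [Coeffs.feedback, pairing, inner_neg_right, real_inner_comm x.2]
  ring

lemma IsP1.integrable_deviation {ν : Measure (State τ)} (hν : IsP1 ν) :
    Integrable (fun y => deviation y ν) ν := by
  have := hν.1
  exact (integrable_const ((mean₀ ν, mean₁ ν) : State τ)).sub hν.2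

/-- The feedback is linear and the deviations average to zero. This cancels both nonlocal drift
terms of the master equation. -/
lemma IsP1.integral_feedback {ν : Measure (State τ)} (hν : IsP1 ν) (t : ℝ) :
    ∫ y, E.feedback t (deviation y ν) ∂ν = 0 := by
  have := hν.1
  simp only [Coeffs.feedback_eq_pairing]
  rw [integral_pairing hν.integrable_deviation]
  simp only [deviation]
  rw [integral_sub (integrable_const _) hν.integrable_fst,
    integral_sub (integrable_const _) hν.integrable_snd, ← mean₀_eq, ← mean₁_eq]
  simp [pairing]

lemma Coeffs.Admissible.hasFlatDerivAt_ansatz (hE : E.Admissible T τ) {t : ℝ} (ht : t ∈ Icc 0 T)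
    (z : State τ) {ν : Measure (State τ)} (hν : IsP1 ν) :
    HasFlatDerivAt (ansatz τ E t z) ν fun y => pairing y (E.grad t (deviation z ν)) := by
  intro ν' hν'
  refine ⟨integrable_pairing hν.2 _, integrable_pairing hν'.2 _, ?_⟩
  set p := E.grad t (deviation z ν) with hp
  set δ : State τ := (mean₀ ν' - mean₀ ν, mean₁ ν' - mean₁ ν) with hδ
  have h1 : (∫ y, pairing y p ∂ν') - ∫ y, pairing y p ∂ν = pairing p δ := by
    rw [integral_pairing hν.2, integral_pairing hν'.2]
    simp only [pairing, hδ, mean₀_eq, mean₁_eq, inner_sub_right, real_inner_comm p.2]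
    ring
  rw [h1]
  have h2 : Tendsto (fun h : ℝ => pairing p δ + h * (E.quad t δ - E.E₃ t)) (𝓝[>] 0)
      (𝓝 (pairing p δ)) := by
    have : Continuous fun h : ℝ => pairing p δ + h * (E.quad t δ - E.E₃ t) := by fun_prop
    have h3 := this.tendsto 0
    simp only [zero_mul, add_zero] at h3
    exact h3.mono_left nhdsWithin_le_nhds
  refine h2.congr' ?_
  filter_upwards [Ioo_mem_nhdsGT (zero_lt_one' ℝ)] with h hh
  rw [hE.ansatz_eq ht, hE.ansatz_eq ht, deviation_mix hν hν' z hh.1.le hh.2.le, hE.quad_add ht,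
    eq_div_iff hh.1.ne']
  ring

/-- The master equation at a point follows from the equation for the quadratic form. -/
lemma Coeffs.Admissible.masterEquationAt_of_quad (hE : E.Admissible T τ) (hτ : 0 < τ) {t : ℝ}
    (ht : t ∈ Ioo 0 T) (htτ : t ≠ T - τ) {P : State τ → State τ → ℝ → Prop} {z : State τ}
    {ν : Measure (State τ)} (hν : IsP1 ν) {Ut ℓ : ℝ} {L : State τ → ℝ}
    (hd : HasDerivAt (fun r => E.quad r (deviation z ν)) Ut t)
    (hℓ : P z (-E.grad t (deviation z ν)) ℓ)
    (hL : ∀ᵐ y ∂ν, P y (E.grad t (deviation z ν)) (L y)) (hLi : Integrable L ν)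
    (heq : Ut + σ ^ 2 * E.E₀ t + ℓ + (∫ y, L y ∂ν) - 2 * E.feedback t (deviation z ν) ^ 2
      + ε / 2 * (mean₀ ν - z.1) ^ 2 = 0) :
    MasterEquationAt P σ ε (ansatz τ E) t z ν := by
  have := hν.1
  have ht' := Ioo_subset_Icc_self ht
  have hU : ansatz τ E t = fun z ν => E.quad t (deviation z ν) := by
    ext z ν
    exact hE.ansatz_eq ht' z ν
  have hfb : ∀ y, -E.grad₀ t (deviation y ν) - -E.bdry t (deviation y ν)
      = -(2 * E.feedback t (deviation y ν)) := fun y => by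
    rw [← Coeffs.grad₀_sub_bdry]
    ring
  have hfi : Integrable (fun y => -(2 * E.feedback t (deviation y ν))) ν := by
    simp only [Coeffs.feedback_eq_pairing]
    exact ((integrable_pairing hν.integrable_deviation _).const_mul 2).neg
  have hf0 : ∫ y, -(2 * E.feedback t (deviation y ν)) ∂ν = 0 := by
    rw [integral_neg, integral_const_mul, hν.integral_feedback, mul_zero, neg_zero]
  -- Derivatives in `z` carry a minus sign because `z` enters through `m - z`. The flat derivative
  -- is linear in `y`, so its derivatives and trace are constant in `y` and its second derivative is
  -- zero.
  refine ⟨Ut, 2 * E.E₀ t, ℓ, fun y => -E.grad₀ t (deviation y ν), fun y => -E.bdry t (deviation y ν),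
    fun y => -E.grad₁ t (deviation y ν), fun y => pairing y (E.grad t (deviation z ν)),
    fun _ => E.grad₀ t (deviation z ν), fun _ => 0, fun _ => E.bdry t (deviation z ν), L,
    fun _ => E.grad₁ t (deviation z ν), ?_, ?_, ?_, ?_, ?_, ?_, ?_, ?_, ?_, ?_, ?_, hℓ, hL, ?_, hLi,
    ?_, ?_, ?_⟩
  · refine hd.congr_of_eventuallyEq ?_
    filter_upwards [Ioo_mem_nhds ht.1 ht.2] with r hr
    exact hE.ansatz_eq (Ioo_subset_Icc_self hr) z ν
  · intro y
    simp only [hU]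
    exact hasDerivAt_quad_fst t (mean₀ ν) y (mean₁ ν)
  · intro y
    simp only [hU]
    exact hE.hasGradientAt_quad ht' (mean₀ ν) y (mean₁ ν)
  · exact fun y => (hE.hasTrace_grad₁ hτ ht' htτ _).neg
  · have h1 : HasDerivAt (fun x : ℝ => mean₀ ν - x) (-1) z.1 := (hasDerivAt_id _).const_sub _
    have h2 := ((h1.const_mul (2 * E.E₀ t)).sub_const
      (2 * inner ℝ (E.vec₁ τ t) (mean₁ ν - z.2))).neg
    refine h2.congr_deriv ?_
    ring
  · exact hE.hasFlatDerivAt_ansatz ht' z hν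
  · exact contDiff_pairing _
  · intro y
    have h := ((hasDerivAt_id y.1).mul_const (E.grad t (deviation z ν)).1).add_const
      (inner ℝ y.2 (E.grad t (deviation z ν)).2)
    rw [one_mul] at h
    exact h
  · exact fun y => hasGradientAt_pairing _ y
  · exact fun y => hasDerivAt_const _ _
  · exact fun y => hE.hasTrace_grad₁ hτ ht' htτ _
  · exact integrable_const _
  · simp only [hfb]
    exact hfi.mul_const _
  · simp only [hfb]
    exact hfi.mul_const _
  · simp only [hfb]
    -- The measure derivatives come out of the integrals, leaving the mean feedback, which is zero.
    rw [integral_mul_const, integral_mul_const, hf0, integral_zero]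
    linear_combination heq

lemma isP1_dirac (y : State τ) : IsP1 (Measure.dirac y) :=
  ⟨inferInstance, integrable_dirac (by simp)⟩

lemma deviation_dirac (z y : State τ) : deviation z (Measure.dirac y) = y - z := by
  rw [deviation, mean₀_eq, mean₁_eq, integral_dirac, integral_dirac]
  rfl

lemma graphA_zero (hτ : 0 ≤ τ) : GraphA (0 : State τ) 0 := by
  rw [graphA_iff hτ]
  simp

/-- A continuous primitive that is almost everywhere constant is constant in the interior, and
differentiating it recovers `g` almost everywhere. The constant need not be zero, as the density
argument for the range requires. -/
lemma eq_zero_of_volterraOp_ae_const (hτ : 0 ≤ τ) {g : PastControl τ} {k : ℝ}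
    (h : volterraOp τ g =ᵐ[delayMeasure τ] fun _ => k) : g = 0 := by
  have hi : IntervalIntegrable g volume (-τ) 0 := by
    rw [intervalIntegrable_iff_integrableOn_Icc_of_le (by linarith)]
    exact integrable_coe g
  have hcont : ContinuousOn (fun s => ∫ r in (-τ)..s, g r) (Icc (-τ) 0) := by
    have := intervalIntegral.continuousOn_primitive_interval (a := -τ) (b := 0) (f := g)
      (μ := volume) (by rw [uIcc_of_le (by linarith)]; exact integrable_coe g)
    rwa [uIcc_of_le (by linarith)] at this
  have hz : ∀ s ∈ Ioo (-τ) 0, ∫ r in (-τ)..s, g r = k := by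
    have h1 : (fun s => ∫ r in (-τ)..s, g r) =ᵐ[volume.restrict (Ioo (-τ) 0)] fun _ => k := by
      refine ae_restrict_of_ae_restrict_of_subset Ioo_subset_Icc_self ?_
      filter_upwards [volterraOp_ae g, h] with s h1 h2
      rw [← h1, h2]
    exact fun s hs => Measure.eqOn_of_ae_eq h1 (hcont.mono Ioo_subset_Icc_self)
      continuousOn_const (by rw [interior_Ioo]; exact subset_closure) hs
  refine Lp.ext ?_
  have h2 := hi.ae_hasDerivAt_integral
  have h3 : ∀ᵐ s ∂delayMeasure τ, s ≠ -τ ∧ s ≠ 0 :=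
    (ae_ne_delayMeasure _).and (ae_ne_delayMeasure _)
  filter_upwards [ae_restrict_of_ae h2, Lp.coeFn_zero ℝ 2 (delayMeasure τ), h3,
    ae_restrict_mem (measurableSet_Icc (a := -τ) (b := 0))] with s hs hs0 hne hmem
  have hs1 := hs (by rwa [uIcc_of_le (by linarith)]) (-τ) left_mem_uIcc
  have hs2 : HasDerivAt (fun s => ∫ r in (-τ)..s, g r) 0 s := by
    refine (hasDerivAt_const s k).congr_of_eventuallyEq ?_
    filter_upwards [Ioo_mem_nhds (lt_of_le_of_ne hmem.1 hne.1.symm)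
      (lt_of_le_of_ne hmem.2 hne.2)] with r hr
    exact hz r hr
  rw [hs0, Pi.zero_apply, hs1.unique hs2]

lemma volterraOp_injective (hτ : 0 ≤ τ) {g : PastControl τ} (h : volterraOp τ g = 0) : g = 0 := by
  refine eq_zero_of_volterraOp_ae_const hτ (k := 0) ?_
  rw [h]
  exact Lp.coeFn_zero ℝ 2 (delayMeasure τ)

/-- Integration by parts on `[-τ, 0]`. -/
lemma inner_volterraOp_add (g h : PastControl τ) :
    inner ℝ (volterraOp τ g) h + inner ℝ g (volterraOp τ h)
      = inner ℝ (oneVec τ) g * inner ℝ (oneVec τ) h := by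
  set k : ℝ → ℝ → ℝ := fun s r => if r ≤ s then 1 else 0 with hk
  have hkm : Measurable fun p : ℝ × ℝ => k p.1 p.2 :=
    Measurable.ite (measurableSet_le measurable_snd measurable_fst) measurable_const
      measurable_const
  have hkb : ∀ s r, ‖k s r‖ ≤ 1 := fun s r => by simp only [hk]; split_ifs <;> simp
  have hspec : ∀ g : PastControl τ, volterraOp τ g =ᵐ[delayMeasure τ]
    fun s => ∫ r, k s r * g r ∂delayMeasure τ := (exists_volterraOp τ).choose_spec
  have hi : ∀ f g : PastControl τ, Integrable (fun p : ℝ × ℝ => k p.1 p.2 * (f p.1 * g p.2))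
      ((delayMeasure τ).prod (delayMeasure τ)) := fun f g =>
    (integrable_mul_prod f g).bdd_mul hkm.aestronglyMeasurable
      (ae_of_all _ fun p => hkb p.1 p.2)
  have hprod : ∀ f g : PastControl τ, inner ℝ f (volterraOp τ g)
      = ∫ p : ℝ × ℝ, k p.1 p.2 * (f p.1 * g p.2) ∂(delayMeasure τ).prod (delayMeasure τ) := by
    intro f g
    rw [inner_eq_integral, integral_prod _ (hi f g)]
    refine integral_congr_ae ?_
    filter_upwards [hspec g] with s hs
    rw [hs, ← integral_const_mul]
    refine integral_congr_ae (ae_of_all _ fun r => ?_)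
    simp only
    ring
  have hi' : Integrable (fun p : ℝ × ℝ => k p.2 p.1 * (g p.2 * h p.1))
      ((delayMeasure τ).prod (delayMeasure τ)) := (hi g h).swap
  have hs : Integrable (fun p : ℝ × ℝ => k p.1 p.2 * (h p.1 * g p.2) + k p.2 p.1 * (g p.2 * h p.1))
      ((delayMeasure τ).prod (delayMeasure τ)) := (hi h g).add hi'
  have hsw : inner ℝ g (volterraOp τ h)
      = ∫ p : ℝ × ℝ, k p.2 p.1 * (g p.2 * h p.1) ∂(delayMeasure τ).prod (delayMeasure τ) := by
    rw [hprod, ← integral_prod_swap]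
    rfl
  rw [real_inner_comm, hprod, hsw, ← integral_add (hi h g) hi', inner_oneVec, inner_oneVec,
    mul_comm (∫ s, g s ∂_), ← integral_prod_mul (fun s => h s) (fun s => g s),
    integral_prod _ hs, integral_prod _ (integrable_mul_prod h g)]
  refine integral_congr_ae (ae_of_all _ fun s => ?_)
  refine integral_congr_ae ?_
  -- Off the null diagonal exactly one of `k s r` and `k r s` equals one.
  filter_upwards [ae_ne_delayMeasure (τ := τ) s] with r hr
  simp only [hk]
  rcases lt_or_gt_of_ne hr with h1 | h1
  · simp [h1.le, h1.not_ge]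
  · simp [h1.le, h1.not_ge, mul_comm]

/-- If `h` is orthogonal to the range, integration by parts shows that the primitive of `h` is the
constant `⟨1, h⟩`, hence `h = 0`. -/
lemma denseRange_volterraOp (hτ : 0 ≤ τ) : DenseRange (volterraOp τ) := by
  have h : (LinearMap.range (volterraOp τ).toLinearMap).topologicalClosure = ⊤ := by
    rw [Submodule.topologicalClosure_eq_top_iff, Submodule.eq_bot_iff]
    intro h hh
    have h1 : ∀ g, inner ℝ (volterraOp τ g) h = 0 := fun g =>
      (Submodule.mem_orthogonal _ _).1 hh _ ⟨g, rfl⟩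
    have h2 : inner ℝ (oneVec τ) h • oneVec τ - volterraOp τ h = 0 := by
      refine ext_inner_left ℝ fun g => ?_
      have h3 := inner_volterraOp_add g h
      rw [h1] at h3
      rw [inner_sub_right, real_inner_smul_right, inner_zero_right, real_inner_comm (oneVec τ) g]
      linarith
    refine eq_zero_of_volterraOp_ae_const hτ (k := inner ℝ (oneVec τ) h) ?_
    rw [← sub_eq_zero.1 h2]
    filter_upwards [Lp.coeFn_smul (inner ℝ (oneVec τ) h) (oneVec τ),
      indicatorConstLp_coeFn (p := 2) (hs := MeasurableSet.univ)
        (hμs := measure_ne_top (delayMeasure τ) univ) (c := (1 : ℝ))] with s h3 h4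
    rw [h3, Pi.smul_apply, oneVec, h4]
    simp
  rw [DenseRange, dense_iff_closure_eq]
  have h5 := congrArg (fun S : Submodule ℝ (PastControl τ) => (S : Set (PastControl τ))) h
  rw [Submodule.topologicalClosure_coe, LinearMap.coe_range] at h5
  exact h5

end Master

end DelayMFG
end

noncomputable section

namespace DelayMFG

/-! ### Equivalence of the master equation with the equation for the quadratic form -/

section MasterEquiv

variable {T τ σ ε : ℝ} {E : Coeffs}

/-- The equation that the quadratic form of a solution satisfies at `(t, x)`; `ℓ` is the transport
term `⟨A x, ∇ quad⟩` or `⟨x, A* ∇ quad⟩`. -/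
def Coeffs.QuadEquationAt (σ ε : ℝ) (E : Coeffs) (t : ℝ) (x : State τ) (ℓ : ℝ) : Prop :=
  HasDerivAt (fun r => E.quad r x)
    (-ℓ - σ ^ 2 * E.E₀ t + 2 * E.feedback t x ^ 2 - ε / 2 * x.1 ^ 2) t

lemma GraphA.unique (hτ : 0 ≤ τ) {z w w' : State τ} (h : GraphA z w) (h' : GraphA z w') :
    w = w' := by
  rw [graphA_iff hτ] at h h'
  have h1 : w.2 = w'.2 := by
    refine sub_eq_zero.1 (volterraOp_injective hτ ?_)
    rw [map_sub, sub_eq_zero]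
    exact neg_injective (h.1.symm.trans h'.1)
  exact Prod.ext (by rw [h.2, h'.2, h1]) h1

/-- The graph conditions are bounded linear relations, so they survive averaging in `ν`. Thus the
transport terms in `z` and in `ν` will merge into one term at the deviation. -/
lemma graphA_deviation (hτ : 0 ≤ τ) {ν : Measure (State τ)} {w : State τ → State τ}
    (hw : Integrable w ν) (hg : ∀ᵐ y ∂ν, GraphA y (w y)) {z wz : State τ} (hz : GraphA z wz) :
    GraphA (deviation z ν) ((∫ y, (w y).1 ∂ν, ∫ y, (w y).2 ∂ν) - wz) := by
  have h2 : Integrable (fun y => (w y).2) ν := hw.snd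
  rw [graphA_iff hτ] at hz ⊢
  constructor
  · simp only [deviation, Prod.snd_sub, map_sub]
    rw [hz.1, mean₁_eq, ← (volterraOp τ).integral_comp_comm h2, integral_congr_ae
      (g := fun y => -volterraOp τ (w y).2) (by
        filter_upwards [hg] with y hy
        exact ((graphA_iff hτ _ _).1 hy).1), integral_neg]
    abel
  · simp only [Prod.fst_sub, Prod.snd_sub, inner_sub_right]
    rw [hz.2, ← integral_inner h2, integral_congr_ae
      (g := fun y => -inner ℝ (oneVec τ) (w y).2) (by
        filter_upwards [hg] with y hy
        exact ((graphA_iff hτ _ _).1 hy).2), integral_neg]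
    ring

lemma pairing_neg_right (x p : State τ) : pairing x (-p) = -pairing x p := by
  simp [pairing]; ring

lemma pairing_neg_left (x p : State τ) : pairing (-x) p = -pairing x p := by
  simp [pairing]; ring

lemma pairing_sub_left (x y p : State τ) : pairing (x - y) p = pairing x p - pairing y p := by
  simp [pairing, inner_sub_left]; ring

lemma Coeffs.Admissible.masterEquationAt_operatorPairing (hE : E.Admissible T τ) (hτ : 0 < τ)
    {t : ℝ} (ht : t ∈ Ioo 0 T) (htτ : t ≠ T - τ)
    (hq : ∀ x w : State τ, GraphA x w → E.QuadEquationAt σ ε t x (pairing w (E.grad t x)))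
    {z wz : State τ} (hz : GraphA z wz) {ν : Measure (State τ)} (hν : IsP1 ν)
    (hA : CarriedByDomain ν) :
    MasterEquationAt OperatorPairing σ ε (ansatz τ E) t z ν := by
  obtain ⟨w, hw, hg⟩ := hA
  set p := E.grad t (deviation z ν) with hp
  refine hE.masterEquationAt_of_quad hτ ht htτ hν (hq _ _ (graphA_deviation hτ.le hw hg hz))
    ⟨wz, hz, rfl⟩ (L := fun y => pairing (w y) p) ?_ (integrable_pairing hw p) ?_
  · filter_upwards [hg] with y hy
    exact ⟨w y, hy, rfl⟩
  · rw [integral_pairing hw, pairing_sub_left, pairing_neg_right, ← hp]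
    simp only [deviation]
    ring

/-- The master equation at `ν = δ₀` yields the equation for the quadratic form. -/
lemma Coeffs.Admissible.quadEquationAt_of_master (hE : E.Admissible T τ) (hτ : 0 < τ)
    {t : ℝ} (ht : t ∈ Ioo 0 T) (htτ : t ≠ T - τ) {x w : State τ} (hx : GraphA x w)
    (h : MasterEquationAt OperatorPairing σ ε (ansatz τ E) t (-x) (Measure.dirac 0)) :
    E.QuadEquationAt σ ε t x (pairing w (E.grad t x)) := by
  have ht' := Ioo_subset_Icc_self ht
  obtain ⟨Ut, U₀₀, ℓ, U₀, B₁, U₁, d, D₀, D₀₀, C₁, L, D₁, hUt, hU₀, hU₁, hB₁, hU₀₀, hd, -, hD₀, -,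
    hD₀₀, -, hℓ, hL, -, -, -, -, heq⟩ := h
  set ν : Measure (State τ) := Measure.dirac 0 with hν
  have hm₀ : mean₀ ν = 0 := by rw [mean₀_eq, hν, integral_dirac]; rfl
  have hm₁ : mean₁ ν = 0 := by rw [mean₁_eq, hν, integral_dirac]; rfl
  have hU : ansatz τ E t = fun z ν => E.quad t (deviation z ν) := by
    ext z ν
    exact hE.ansatz_eq ht' z ν
  have hdev : ∀ y : State τ, deviation y ν = -y := fun y => by
    rw [hν, deviation_dirac, zero_sub]
  -- The derivatives and traces provided by the master equation are forced by uniqueness. With `ν =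
  -- δ₀` the deviation of `y` is `-y`, so the choice `z = -x` evaluates the form at `x`.
  have e₀ : ∀ y, U₀ y = -E.grad₀ t (-y) := fun y => by
    have h1 := hU₀ y
    simp only [hU] at h1
    rw [h1.unique (hasDerivAt_quad_fst t (mean₀ ν) y (mean₁ ν)), ← hdev]
    rfl
  have e₁ : ∀ y, U₁ y = -E.grad₁ t (-y) := fun y => by
    have h1 := hU₁ y
    simp only [hU] at h1
    rw [h1.unique (hE.hasGradientAt_quad ht' (mean₀ ν) y (mean₁ ν)), ← hdev]
    rfl
  have e₂ : ∀ y, B₁ y = -E.bdry t (-y) := fun y => by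
    have h1 := hB₁ y
    rw [e₁] at h1
    exact h1.unique hτ (hE.hasTrace_grad₁ hτ ht' htτ _).neg
  have hfb : ∀ y, U₀ y - B₁ y = -(2 * E.feedback t (-y)) := fun y => by
    rw [e₀, e₂, ← Coeffs.grad₀_sub_bdry]
    ring
  have e₃ : U₀₀ = 2 * E.E₀ t := by
    have h1 : HasDerivAt (fun x : ℝ => -x) (-1) (-x).1 := (hasDerivAt_id _).neg
    have h2 := ((h1.const_mul (2 * E.E₀ t)).sub_const
      (2 * inner ℝ (E.vec₁ τ t) (-(-x).2))).neg
    have h3 : HasDerivAt (fun x' : ℝ => U₀ (x', (-x).2)) (-(2 * E.E₀ t * -1)) (-x).1 :=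
      h2.congr_of_eventuallyEq (Eventually.of_forall fun x' => by
        simp only [e₀, Coeffs.grad₀]
        rfl)
    rw [hU₀₀.unique h3]
    ring
  -- A flat derivative is determined only up to a constant. Testing against Dirac masses at `(r, 0)`
  -- fixes the increments of `d`, which are affine in `r`.
  have e₄ : D₀₀ 0 = 0 := by
    have hp := hE.hasFlatDerivAt_ansatz ht' (-x) (isP1_dirac (0 : State τ))
    set p := E.grad t (deviation (-x) (Measure.dirac 0)) with hp'
    have h1 : ∀ r : ℝ, d (r, 0) = d 0 + r * p.1 := fun r => by
      have h2 := (hd _ (isP1_dirac ((r, 0) : State τ))).2.2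
      have h3 := (hp _ (isP1_dirac ((r, 0) : State τ))).2.2
      have h4 := tendsto_nhds_unique h2 h3
      simp only [hν, integral_dirac] at h4
      simp [pairing] at h4
      linarith
    have h5 : ∀ r : ℝ, D₀ (r, 0) = p.1 := fun r => by
      have h6 := hD₀ (r, 0)
      simp only [h1] at h6
      have h7 := ((hasDerivAt_id r).mul_const p.1).const_add (d 0)
      rw [one_mul] at h7
      exact h6.unique h7
    have h8 := hD₀₀ 0
    simp only [Prod.snd_zero, h5] at h8
    exact h8.unique (hasDerivAt_const _ _)
  have e₅ : L 0 = 0 := by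
    have h1 : OperatorPairing (0 : State τ) (D₀ 0, D₁ 0) (L 0) := by
      rw [hν, ae_dirac_eq] at hL
      exact hL
    obtain ⟨w', hw', hL0⟩ := h1
    rw [hL0, hw'.unique hτ.le (graphA_zero hτ.le)]
    simp [pairing]
  have hx' : GraphA (-x) (-w) := by
    rw [graphA_iff hτ.le] at hx ⊢
    simp only [Prod.snd_neg, Prod.fst_neg, map_neg, inner_neg_right, hx.1, hx.2, and_self]
  have e₆ : ℓ = pairing w (E.grad t x) := by
    obtain ⟨w', hw', hl⟩ := hℓ
    rw [hl, hw'.unique hτ.le hx', e₀, e₁, neg_neg,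
      show ((-E.grad₀ t x, -E.grad₁ t x) : State τ) = -E.grad t x from rfl, pairing_neg_right,
      pairing_neg_left, neg_neg]
  -- The two nonlocal integrals are evaluations at `0`, where the linear feedback vanishes.
  have hz : U₀ 0 - B₁ 0 = 0 := by
    rw [hfb, neg_zero]
    simp [Coeffs.feedback]
  have hUt' : HasDerivAt (fun r => E.quad r x) Ut t := by
    refine hUt.congr_of_eventuallyEq ?_
    filter_upwards [Ioo_mem_nhds ht.1 ht.2] with r hr
    rw [hE.ansatz_eq (Ioo_subset_Icc_self hr), hdev, neg_neg]
  refine hUt'.congr_deriv ?_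
  simp only [hν, integral_dirac] at heq
  rw [← hν, hz, e₃, e₄, e₅, e₆, hfb, neg_neg, hm₀] at heq
  simp only [Prod.fst_neg] at heq
  linear_combination heq

end MasterEquiv

end DelayMFG
end

noncomputable section

namespace DelayMFG

/-! ### The explicit solution solves the master equation -/

section ExplicitMaster

variable {T τ σ ε c : ℝ}

/-- The response of the state to the past controls `x`, which re-enter after time `t`. -/
def pastResponse (T ε c t : ℝ) (x : PastControl τ) : CostSpace T ε c :=
  ∫ s, x s • stepVec T ε c (t - s) ∂delayMeasure τ

lemma norm_stepVec_le_zero (hε : 0 ≤ ε) (hc : 0 ≤ c) (hT : 0 ≤ T) {y : ℝ} (hy : 0 ≤ y) :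
    ‖stepVec T ε c y‖ ≤ ‖stepVec T ε c 0‖ := by
  simpa [min_eq_left hT] using norm_stepVec_le (T := T) hε hc hy

lemma ae_norm_stepVec_sub_le (hε : 0 ≤ ε) (hc : 0 ≤ c) (hT : 0 ≤ T) {t : ℝ} (ht : 0 ≤ t) :
    ∀ᵐ s ∂delayMeasure τ, ‖stepVec T ε c (t - s)‖ ≤ ‖stepVec T ε c 0‖ := by
  filter_upwards [ae_restrict_mem (measurableSet_Icc (a := -τ) (b := 0))] with s hs
  exact norm_stepVec_le_zero hε hc hT (by linarith [hs.2])

lemma integrable_smul_stepVec (hε : 0 ≤ ε) (hc : 0 ≤ c) (hT : 0 ≤ T) {t : ℝ} (ht : 0 ≤ t)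
    (x : PastControl τ) :
    Integrable (fun s => x s • stepVec T ε c (t - s)) (delayMeasure τ) := by
  refine ((integrable_coe x).abs.mul_const ‖stepVec T ε c 0‖).mono'
    ((Lp.aestronglyMeasurable x).smul ((stronglyMeasurable_stepVec hε hc).comp_measurable
      (measurable_const.sub measurable_id)).aestronglyMeasurable) ?_
  filter_upwards [ae_norm_stepVec_sub_le hε hc hT ht] with s hs
  rw [norm_smul]
  exact mul_le_mul_of_nonneg_left hs (norm_nonneg _)

lemma norm_pastResponse_le (hε : 0 ≤ ε) (hc : 0 ≤ c) (hT : 0 ≤ T) {t : ℝ} (ht : 0 ≤ t)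
    (x : PastControl τ) :
    ‖pastResponse T ε c t x‖ ≤ ‖oneVec τ‖ * ‖stepVec T ε c 0‖ * ‖x‖ := by
  have hg := (integrable_coe x).abs.mul_const ‖stepVec T ε c 0‖
  refine (norm_integral_le_of_norm_le hg ?_).trans ?_
  · filter_upwards [ae_norm_stepVec_sub_le hε hc hT ht] with s hs
    rw [norm_smul]
    exact mul_le_mul_of_nonneg_left hs (norm_nonneg _)
  · rw [integral_mul_const]
    calc _ ≤ ‖oneVec τ‖ * ‖x‖ * ‖stepVec T ε c 0‖ :=
          mul_le_mul_of_nonneg_right (integral_abs_le x) (norm_nonneg _)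
      _ = _ := by ring

lemma pastResponse_sub (hε : 0 ≤ ε) (hc : 0 ≤ c) (hT : 0 ≤ T) {t : ℝ} (ht : 0 ≤ t)
    (x y : PastControl τ) :
    pastResponse T ε c t (x - y) = pastResponse T ε c t x - pastResponse T ε c t y := by
  rw [pastResponse, pastResponse, pastResponse, ← integral_sub
    (integrable_smul_stepVec hε hc hT ht x) (integrable_smul_stepVec hε hc hT ht y)]
  refine integral_congr_ae ?_
  filter_upwards [Lp.coeFn_sub x y] with s hs
  rw [hs, Pi.sub_apply, sub_smul]

lemma inner_pastResponse (hε : 0 ≤ ε) (hc : 0 ≤ c) (hT : 0 ≤ T) {t : ℝ} (ht : 0 ≤ t)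
    (x : PastControl τ) (ψ : CostSpace T ε c) :
    inner ℝ (pastResponse T ε c t x) ψ
      = ∫ s, x s * inner ℝ (stepVec T ε c (t - s)) ψ ∂delayMeasure τ := by
  rw [real_inner_comm, pastResponse, ← integral_inner (integrable_smul_stepVec hε hc hT ht x)]
  simp only [real_inner_smul_right, real_inner_comm ψ]

lemma inner_stepVec_sub_pastResponse (hε : 0 ≤ ε) (hc : 0 ≤ c) (hT : 0 ≤ T) {q t r : ℝ}
    (hr : 0 ≤ r) (hq : q ≤ t) (htr : t ≤ r) (x : PastControl τ) :
    inner ℝ (stepVec T ε c q - stepVec T ε c t) (pastResponse T ε c r x) = 0 := by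
  rw [real_inner_comm, inner_pastResponse hε hc hT hr]
  rw [integral_congr_ae (g := fun _ => (0 : ℝ)) ?_, integral_zero]
  filter_upwards [ae_restrict_mem (measurableSet_Icc (a := -τ) (b := 0))] with s hs
  rw [real_inner_comm, inner_stepVec_sub_stepVec_of_le hε hc hq (by linarith [hs.2]), mul_zero]

lemma explicit_inner_vec₁ (hε : 0 ≤ ε) (hc : 0 ≤ c) (hτ : 0 ≤ τ) (hT : 0 ≤ T) {t : ℝ}
    (ht : t ∈ Icc 0 T) (x : PastControl τ) :
    inner ℝ ((explicitCoeffs T τ σ ε c).vec₁ τ t) x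
      = -inner ℝ (stepVec T ε c t) (riccatiOp T τ ε c t (pastResponse T ε c t x)) := by
  have h0 := inner_stepVec_riccatiOp_of_le hε hc hτ ht.1 ht.2 (pastResponse T ε c t x)
  rw [inner_stepVec_sub_pastResponse hε hc hT ht.1 ht.1 le_rfl, add_zero] at h0
  rw [(explicitCoeffs_admissible hε hc hτ hT).inner_vec₁ ht, ← h0,
    ← inner_riccatiOp_left hε hc hτ ht.2, real_inner_comm, inner_pastResponse hε hc hT ht.1,
    ← integral_neg]
  refine integral_congr_ae (ae_of_all _ fun s => ?_)
  simp only [explicitCoeffs]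
  rw [← inner_riccatiOp_left hε hc hτ ht.2, real_inner_comm,
    show t + (-τ - s) + τ = t - s by ring]
  ring

lemma explicit_inner_op₂ (hε : 0 ≤ ε) (hc : 0 ≤ c) (hτ : 0 ≤ τ) (hT : 0 ≤ T) {t : ℝ}
    (ht : t ∈ Icc 0 T) (y x : PastControl τ) :
    inner ℝ y ((explicitCoeffs T τ σ ε c).op₂ τ t x)
      = inner ℝ (pastResponse T ε c t y) (riccatiOp T τ ε c t (pastResponse T ε c t x)) := by
  rw [inner_eq_integral, inner_pastResponse hε hc hT ht.1]
  refine integral_congr_ae ?_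
  filter_upwards [(explicitCoeffs_admissible (σ := σ) hε hc hτ hT).isKernelOp₂ ht x] with s hs
  rw [hs, ← inner_riccatiOp_left hε hc hτ ht.2, real_inner_comm, inner_pastResponse hε hc hT ht.1]
  congr 1
  refine integral_congr_ae (ae_of_all _ fun r => ?_)
  simp only [explicitCoeffs]
  rw [show t + (-τ - s) + τ = t - s by ring, show t + (-τ - r) + τ = t - r by ring,
    ← inner_riccatiOp_left hε hc hτ ht.2, real_inner_comm, mul_comm]

lemma explicit_inner_vec₂ (hε : 0 ≤ ε) (hc : 0 ≤ c) (hτ : 0 ≤ τ) (hT : 0 ≤ T) {t : ℝ}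
    (ht : t ∈ Icc 0 T) (htτ : t ≠ T - τ) (x : PastControl τ) :
    inner ℝ ((explicitCoeffs T τ σ ε c).vec₂ τ t) x
      = inner ℝ (stepVec T ε c (t + τ)) (riccatiOp T τ ε c t (pastResponse T ε c t x)) := by
  rw [Coeffs.vec₂, inner_toH ((explicitCoeffs_admissible hε hc hτ hT).memLp₂ hτ ht htτ),
    ← inner_riccatiOp_left hε hc hτ ht.2, real_inner_comm, inner_pastResponse hε hc hT ht.1]
  refine integral_congr_ae (ae_of_all _ fun r => ?_)
  simp only [explicitCoeffs]
  rw [show t + (-τ - r) + τ = t - r by ring, add_zero,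
    ← inner_riccatiOp_left hε hc hτ ht.2, real_inner_comm, mul_comm]

/-- `Q(t) (x₀ v_t + ∫ x₁(s) v_{t-s} ds)`. -/
def costate (T τ ε c t : ℝ) (x : State τ) : CostSpace T ε c :=
  riccatiOp T τ ε c t (x.1 • stepVec T ε c t + pastResponse T ε c t x.2)

lemma inner_costate (ξ : CostSpace T ε c) (t : ℝ) (x : State τ) :
    inner ℝ ξ (costate T τ ε c t x) = x.1 * inner ℝ ξ (riccatiOp T τ ε c t (stepVec T ε c t))
      + inner ℝ ξ (riccatiOp T τ ε c t (pastResponse T ε c t x.2)) := by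
  rw [costate, map_add, map_smul, inner_add_right, real_inner_smul_right]

lemma explicit_grad₀ (hε : 0 ≤ ε) (hc : 0 ≤ c) (hτ : 0 ≤ τ) (hT : 0 ≤ T) {t : ℝ}
    (ht : t ∈ Icc 0 T) (x : State τ) :
    (explicitCoeffs T τ σ ε c).grad₀ t x
      = 2 * inner ℝ (stepVec T ε c t) (costate T τ ε c t x) := by
  rw [Coeffs.grad₀, explicit_inner_vec₁ hε hc hτ hT ht, explicitCoeffs_E₀_eq' hε hc hτ ht.1 ht.2,
    inner_costate]
  ring

lemma explicit_inner_grad₁ (hε : 0 ≤ ε) (hc : 0 ≤ c) (hτ : 0 ≤ τ) (hT : 0 ≤ T) {t : ℝ}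
    (ht : t ∈ Icc 0 T) (x : State τ) (y : PastControl τ) :
    inner ℝ y ((explicitCoeffs T τ σ ε c).grad₁ t x)
      = 2 * inner ℝ (pastResponse T ε c t y) (costate T τ ε c t x) := by
  rw [Coeffs.grad₁, real_inner_smul_right, inner_sub_right, real_inner_smul_right,
    explicit_inner_op₂ hε hc hτ hT ht, real_inner_comm ((explicitCoeffs T τ σ ε c).vec₁ τ t),
    explicit_inner_vec₁ hε hc hτ hT ht, inner_costate,
    ← inner_riccatiOp_left hε hc hτ ht.2 (stepVec T ε c t),
    real_inner_comm (pastResponse T ε c t y) (riccatiOp T τ ε c t (stepVec T ε c t))]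
  ring

lemma explicit_feedback (hε : 0 ≤ ε) (hc : 0 ≤ c) (hτ : 0 ≤ τ) (hT : 0 ≤ T) {t : ℝ}
    (ht : t ∈ Icc 0 T) (htτ : t ≠ T - τ) (x : State τ) :
    (explicitCoeffs T τ σ ε c).feedback t x
      = inner ℝ (controlVec T τ ε c t) (costate T τ ε c t x) := by
  rw [Coeffs.feedback, inner_add_left, explicit_inner_vec₁ hε hc hτ hT ht,
    explicit_inner_vec₂ hε hc hτ hT ht htτ, explicitCoeffs_E₀_eq' hε hc hτ ht.1 ht.2,
    explicitCoeffs_E₁_eq hε hc hτ ht.1 ht.2 (by linarith), inner_costate, controlVec,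
    inner_sub_left, inner_sub_left, ← inner_riccatiOp_left hε hc hτ ht.2 (stepVec T ε c t)
      (stepVec T ε c (t + 0 + τ)), real_inner_comm (stepVec T ε c (t + 0 + τ)), add_zero]
  ring

/-- The cross term is written with `v_0`, so that time enters it only through `Q` and the past
response, both of which can be differentiated. -/
lemma explicit_quad (hε : 0 ≤ ε) (hc : 0 ≤ c) (hτ : 0 ≤ τ) (hT : 0 ≤ T) {t : ℝ}
    (ht : t ∈ Icc 0 T) (x : State τ) :
    (explicitCoeffs T τ σ ε c).quad t x = (explicitCoeffs T τ σ ε c).E₀ t * x.1 ^ 2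
      + 2 * x.1 * inner ℝ (stepVec T ε c 0) (riccatiOp T τ ε c t (pastResponse T ε c t x.2))
      + inner ℝ (pastResponse T ε c t x.2) (riccatiOp T τ ε c t (pastResponse T ε c t x.2))
      + (explicitCoeffs T τ σ ε c).E₃ t := by
  rw [Coeffs.quad, explicit_inner_vec₁ hε hc hτ hT ht, explicit_inner_op₂ hε hc hτ hT ht,
    inner_stepVec_riccatiOp_of_le hε hc hτ ht.1 ht.2,
    inner_stepVec_sub_pastResponse hε hc hT ht.1 ht.1 le_rfl]
  ring

/-- The equation for the quadratic form, where the past response is differentiable in time. -/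
lemma explicit_quadEquationAt (hε : 0 ≤ ε) (hc : 0 ≤ c) (hτ : 0 ≤ τ) (hT : 0 ≤ T) {t : ℝ}
    (ht : t ∈ Ioo 0 T) (htτ : t ≠ T - τ) (x : State τ) {W' : CostSpace T ε c}
    (hW : HasDerivAt (fun r => pastResponse T ε c r x.2) W' t) :
    (explicitCoeffs T τ σ ε c).QuadEquationAt σ ε t x
      (-(2 * inner ℝ W' (costate T τ ε c t x))) := by
  have ht' := Ioo_subset_Icc_self ht
  -- From time `t` on, the past response is supported after `t` and is orthogonal to the indicator
  -- of `[0, t)`; so is its derivative, and a one-sided derivative suffices to see it.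
  have hort : inner ℝ (stepVec T ε c 0 - stepVec T ε c t) W' = 0 := by
    have h1 := ((innerSL ℝ (stepVec T ε c 0 - stepVec T ε c t)).hasFDerivAt.comp_hasDerivAt t
      hW).hasDerivWithinAt (s := Ici t)
    have h2 : HasDerivWithinAt (⇑(innerSL ℝ (stepVec T ε c 0 - stepVec T ε c t)) ∘
        fun r => pastResponse T ε c r x.2) 0 (Ici t) t := by
      refine (hasDerivWithinAt_const t (Ici t) (0 : ℝ)).congr_of_mem (fun r hr => ?_) self_mem_Ici
      exact inner_stepVec_sub_pastResponse hε hc hT (ht.1.le.trans hr) ht.1.le hr _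
    exact (uniqueDiffWithinAt_Ici t).eq_deriv _ h1 h2
  have hR := explicitCoeffs_solvesRiccati (σ := σ) hε hc hτ hT
  set E := explicitCoeffs T τ σ ε c with hE
  set Q := riccatiOp T τ ε c t with hQ
  set n := controlVec T τ ε c t with hn
  set W := pastResponse T ε c t x.2 with hWd
  have hQW : HasDerivAt (fun r => riccatiOp T τ ε c r (pastResponse T ε c r x.2))
      ((2 * inner ℝ W (Q n)) • Q n + Q W') t := by
    have h1 := (hasDerivAt_riccatiOp hε hc hτ ht.2 htτ).clm_apply hW
    refine h1.congr_deriv ?_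
    rw [smul_apply, mul_assoc, mul_apply_eq_comp, mul_apply_eq_comp, controlOp_apply, map_smul,
      smul_smul, ← inner_riccatiOp_left hε hc hτ ht.2.le, real_inner_comm]
  have h1 := (innerSL ℝ (stepVec T ε c 0)).hasFDerivAt.comp_hasDerivAt t hQW
  have h2 := hW.inner ℝ hQW
  have h3 := ((((hR.ode₀ t ht htτ).mul_const (x.1 ^ 2)).add (h1.const_mul (2 * x.1))).add h2).add
    (hR.ode₃ t ht)
  have hev : (fun r => E.quad r x) =ᶠ[𝓝 t] fun r => E.E₀ r * x.1 ^ 2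
      + 2 * x.1 * inner ℝ (stepVec T ε c 0) (riccatiOp T τ ε c r (pastResponse T ε c r x.2))
      + inner ℝ (pastResponse T ε c r x.2) (riccatiOp T τ ε c r (pastResponse T ε c r x.2))
      + E.E₃ r := by
    filter_upwards [Ioo_mem_nhds ht.1 ht.2] with r hr
    exact explicit_quad hε hc hτ hT (Ioo_subset_Icc_self hr) x
  have h4 := h3.congr_of_eventuallyEq hev
  refine h4.congr_deriv ?_
  -- After differentiation `v_t` replaces `v_0` again, with no correction since the vectors involved
  -- live after `t`. The terms from `Q'` then form twice the squared feedback.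
  have e1 : inner ℝ (stepVec T ε c 0) (Q n) = inner ℝ (stepVec T ε c t) (Q n) := by
    rw [inner_stepVec_riccatiOp_of_le hε hc hτ ht.1.le ht.2.le, hn, controlVec, inner_sub_right,
      inner_stepVec_sub_stepVec_of_le hε hc ht.1.le le_rfl,
      inner_stepVec_sub_stepVec_of_le hε hc ht.1.le (by linarith)]
    ring
  have e2 : inner ℝ (stepVec T ε c 0) (Q W') = inner ℝ (stepVec T ε c t) (Q W') := by
    rw [inner_stepVec_riccatiOp_of_le hε hc hτ ht.1.le ht.2.le, hort, add_zero]
  have e3 : E.E₀ t + E.E₁ t 0 = inner ℝ (stepVec T ε c t) (Q n) := by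
    rw [hE, explicitCoeffs_E₀_eq' hε hc hτ ht.1.le ht.2.le,
      explicitCoeffs_E₁_eq hε hc hτ ht.1.le ht.2.le (by linarith), hn, controlVec, map_sub,
      inner_sub_right, add_zero]
    ring
  have e4 : inner ℝ n (Q (stepVec T ε c t)) = inner ℝ (stepVec T ε c t) (Q n) := by
    rw [← inner_riccatiOp_left hε hc hτ ht.2.le, real_inner_comm]
  have e5 : inner ℝ n (Q W) = inner ℝ W (Q n) := by
    rw [← inner_riccatiOp_left hε hc hτ ht.2.le, real_inner_comm]
  have e6 : inner ℝ W' (Q (stepVec T ε c t)) = inner ℝ (stepVec T ε c t) (Q W') := by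
    rw [← inner_riccatiOp_left hε hc hτ ht.2.le, real_inner_comm]
  have e7 : inner ℝ W (Q W') = inner ℝ W' (Q W) := by
    rw [← inner_riccatiOp_left hε hc hτ ht.2.le, real_inner_comm]
  rw [explicit_feedback hε hc hτ hT ht' htτ, inner_costate, inner_costate, ← hQ, ← hWd, e4, e5, e6,
    e3]
  simp only [map_add, map_smul, innerSL_apply_apply, inner_add_right, real_inner_smul_right,
    smul_eq_mul, e1, e2, e7]
  ring

end ExplicitMaster

end DelayMFG
end

noncomputable section

namespace DelayMFG

/-! ### Differentiating the past response on the domain of `A` -/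

section OperatorForm

variable {T τ σ ε c : ℝ}

lemma intervalIntegrable_stepVec (hε : 0 ≤ ε) (hc : 0 ≤ c) (a b : ℝ) :
    IntervalIntegrable (stepVec T ε c) volume a b := by
  refine (intervalIntegrable_const (c := ‖stepVec T ε c (min (min a b) T)‖)).mono_fun'
    (stronglyMeasurable_stepVec hε hc).aestronglyMeasurable ?_
  refine (ae_restrict_iff' measurableSet_uIoc).2 (ae_of_all _ fun u hu => ?_)
  exact norm_stepVec_le hε hc (mem_Ioc.1 hu).1.le

lemma intervalIntegral_stepVec_sub (t r : ℝ) :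
    ∫ s in r..0, stepVec T ε c (t - s) = ∫ y in t..(t - r), stepVec T ε c y := by
  rw [intervalIntegral.integral_comp_sub_left (fun y => stepVec T ε c y) t, sub_zero]

/-- Fubini moves the integration from `g` to the step vectors. Primitives of step vectors are
differentiable in time although the step vectors themselves are not. -/
lemma pastResponse_volterraOp (hε : 0 ≤ ε) (hc : 0 ≤ c) (hT : 0 ≤ T) {t : ℝ} (ht : 0 ≤ t)
    (g : PastControl τ) :
    pastResponse T ε c t (volterraOp τ g)
      = ∫ r, g r • (∫ y in t..(t - r), stepVec T ε c y) ∂delayMeasure τ := by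
  have h1 : pastResponse T ε c t (volterraOp τ g) = ∫ s, ∫ r,
      ((if r ≤ s then 1 else 0) * g r) • stepVec T ε c (t - s) ∂delayMeasure τ
        ∂delayMeasure τ := by
    refine integral_congr_ae ?_
    filter_upwards [(exists_volterraOp τ).choose_spec g] with s hs
    rw [integral_smul_const]
    congr 1
  have hint : Integrable (fun p : ℝ × ℝ => ((if p.2 ≤ p.1 then 1 else 0) * g p.2) •
      stepVec T ε c (t - p.1)) ((delayMeasure τ).prod (delayMeasure τ)) := by
    have hm : Measurable fun p : ℝ × ℝ => if p.2 ≤ p.1 then (1 : ℝ) else 0 :=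
      Measurable.ite (measurableSet_le measurable_snd measurable_fst) measurable_const
        measurable_const
    have hv : StronglyMeasurable fun p : ℝ × ℝ => stepVec T ε c (t - p.1) :=
      (stronglyMeasurable_stepVec hε hc).comp_measurable (measurable_const.sub measurable_fst)
    have hb : Integrable (fun p : ℝ × ℝ => ‖stepVec T ε c 0‖ * |g p.2|)
        ((delayMeasure τ).prod (delayMeasure τ)) :=
      (integrable_const (μ := delayMeasure τ) ‖stepVec T ε c 0‖).mul_prod (integrable_coe g).abs
    refine hb.mono' ((hm.aestronglyMeasurable.mul (Lp.aestronglyMeasurable g).comp_snd).smul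
      hv.aestronglyMeasurable) ?_
    filter_upwards [Measure.quasiMeasurePreserving_fst.ae
      (ae_norm_stepVec_sub_le (τ := τ) (T := T) hε hc hT ht)] with p hp
    rw [norm_smul, norm_mul, mul_comm]
    refine mul_le_mul hp ?_ (by positivity) (norm_nonneg _)
    split_ifs <;> simp
  rw [h1, integral_integral_swap hint]
  refine integral_congr_ae ?_
  filter_upwards [ae_restrict_mem (measurableSet_Icc (a := -τ) (b := 0))] with r hr
  have h2 : (fun s => ((if r ≤ s then (1 : ℝ) else 0) * g r) • stepVec T ε c (t - s))
      = fun s => g r • (Ici r).indicator (fun s => stepVec T ε c (t - s)) s := by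
    ext1 s
    by_cases h : r ≤ s <;> simp [h]
  rw [h2, integral_smul, setIntegral_indicator measurableSet_Ici,
    show Icc (-τ) 0 ∩ Ici r = Icc r 0 from
      Set.ext fun s => ⟨fun h => ⟨h.2, h.1.2⟩, fun h => ⟨⟨hr.1.trans h.1, h.2⟩, h.1⟩⟩,
    integral_Icc_eq_integral_Ioc, ← intervalIntegral.integral_of_le hr.2,
    intervalIntegral_stepVec_sub]

lemma hasDerivAt_intervalIntegral_stepVec (hε : 0 ≤ ε) (hc : 0 ≤ c) {x : ℝ} (hx : x ≠ T) :
    HasDerivAt (fun x => ∫ y in (0 : ℝ)..x, stepVec T ε c y) (stepVec T ε c x) x :=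
  intervalIntegral.integral_hasDerivAt_right (intervalIntegrable_stepVec hε hc 0 x)
    (stronglyMeasurable_stepVec hε hc).stronglyMeasurableAtFilter (continuousAt_stepVec hε hc hx)

lemma norm_intervalIntegral_stepVec_le (hε : 0 ≤ ε) (hc : 0 ≤ c) (hT : 0 ≤ T) {a b : ℝ}
    (ha : 0 ≤ a) (hb : 0 ≤ b) :
    ‖∫ y in a..b, stepVec T ε c y‖ ≤ ‖stepVec T ε c 0‖ * |b - a| := by
  refine intervalIntegral.norm_integral_le_of_norm_le_const fun y hy => ?_
  exact norm_stepVec_le_zero hε hc hT ((le_min ha hb).trans (mem_Ioc.1 hy).1.le)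

lemma hasDerivAt_pastResponse_volterraOp (hε : 0 ≤ ε) (hc : 0 ≤ c) (hT : 0 ≤ T) {t : ℝ}
    (ht : t ∈ Ioo 0 T) (g : PastControl τ) :
    HasDerivAt (fun u => pastResponse T ε c u (volterraOp τ g))
      (pastResponse T ε c t g - inner ℝ (oneVec τ) g • stepVec T ε c t) t := by
  set N : ℝ → CostSpace T ε c := fun x => ∫ y in (0 : ℝ)..x, stepVec T ε c y with hN
  have hNsub : ∀ a b, ∫ y in a..b, stepVec T ε c y = N b - N a := fun a b => by
    rw [hN]
    exact (intervalIntegral.integral_interval_sub_left (intervalIntegrable_stepVec hε hc _ _)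
      (intervalIntegrable_stepVec hε hc _ _)).symm
  have hNc : Continuous N := intervalIntegral.continuous_primitive
    (fun a b => intervalIntegrable_stepVec hε hc a b) 0
  have hmeas : ∀ u, AEStronglyMeasurable (fun r => g r • (N (u - r) - N u)) (delayMeasure τ) :=
    fun u => (Lp.aestronglyMeasurable g).smul
      (by fun_prop : Continuous fun r => N (u - r) - N u).aestronglyMeasurable
  have hint : Integrable (fun r => g r • stepVec T ε c (t - r)) (delayMeasure τ) :=
    integrable_smul_stepVec hε hc hT ht.1.le g
  have hint2 : Integrable (fun r => g r • stepVec T ε c t) (delayMeasure τ) :=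
    (integrable_coe g).smul_const _
  have hb : Integrable (fun r => 2 * ‖stepVec T ε c 0‖ * |g r|) (delayMeasure τ) :=
    (integrable_coe g).abs.const_mul _
  have hmem := ae_restrict_mem (μ := volume) (measurableSet_Icc (a := -τ) (b := 0))
  have hlip : ∀ u ∈ Ioi (0 : ℝ), ∀ u' ∈ Ioi (0 : ℝ), ∀ r ∈ Icc (-τ) 0,
      ‖(N (u - r) - N u) - (N (u' - r) - N u')‖ ≤ 2 * ‖stepVec T ε c 0‖ * |u - u'| := by
    intro u hu u' hu' r hr
    have h1 := norm_intervalIntegral_stepVec_le (T := T) hε hc hT (a := u' - r) (b := u - r)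
      (by linarith [mem_Ioi.1 hu', hr.2]) (by linarith [mem_Ioi.1 hu, hr.2])
    have h2 := norm_intervalIntegral_stepVec_le (T := T) hε hc hT (a := u') (b := u)
      (mem_Ioi.1 hu').le (mem_Ioi.1 hu).le
    rw [hNsub, show u - r - (u' - r) = u - u' by ring] at h1
    rw [hNsub] at h2
    rw [show (N (u - r) - N u) - (N (u' - r) - N u') = (N (u - r) - N (u' - r)) - (N u - N u') by
      abel]
    exact (norm_sub_le _ _).trans (by linarith)
  have hbd : ∀ᵐ r ∂delayMeasure τ, ‖N (t - r) - N t‖ ≤ ‖stepVec T ε c 0‖ * τ := by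
    filter_upwards [hmem] with r hr
    rw [← hNsub]
    refine (norm_intervalIntegral_stepVec_le hε hc hT ht.1.le (by linarith [ht.1, hr.2])).trans ?_
    refine mul_le_mul_of_nonneg_left ?_ (norm_nonneg _)
    rw [abs_of_nonneg (by linarith [hr.2])]
    linarith [hr.1]
  -- The primitive `N` is Lipschitz on nonnegative times, so one differentiates under the integral;
  -- it can fail to be differentiable only at `T`, that is at the single point `r = t - T`.
  have main := (hasDerivAt_integral_of_dominated_loc_of_lip (μ := delayMeasure τ)
    (F := fun u r => g r • (N (u - r) - N u))
    (F' := fun r => g r • stepVec T ε c (t - r) - g r • stepVec T ε c t)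
    (bound := fun r => 2 * ‖stepVec T ε c 0‖ * |g r|) (s := Ioi 0) (Ioi_mem_nhds ht.1)
    (Eventually.of_forall hmeas) ?_ (hint.sub hint2).aestronglyMeasurable ?_ hb ?_).2
  · rw [integral_sub hint hint2, integral_smul_const, ← inner_oneVec] at main
    refine main.congr_of_eventuallyEq ?_
    filter_upwards [Ioi_mem_nhds ht.1] with u hu
    rw [pastResponse_volterraOp hε hc hT (mem_Ioi.1 hu).le]
    simp only [hNsub]
  · refine ((integrable_coe g).abs.mul_const (‖stepVec T ε c 0‖ * τ)).mono' (hmeas t) ?_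
    filter_upwards [hbd] with r hr
    rw [norm_smul]
    exact mul_le_mul_of_nonneg_left hr (norm_nonneg _)
  · filter_upwards [hmem] with r hr
    refine LipschitzOnWith.of_dist_le_mul fun u hu u' hu' => ?_
    rw [dist_eq_norm, ← smul_sub, norm_smul, Real.coe_nnabs, Real.dist_eq,
      abs_of_nonneg (by positivity : 0 ≤ 2 * ‖stepVec T ε c 0‖ * |g r|), Real.norm_eq_abs]
    calc _ ≤ |g r| * (2 * ‖stepVec T ε c 0‖ * |u - u'|) :=
          mul_le_mul_of_nonneg_left (hlip u hu u' hu' r hr) (abs_nonneg _)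
      _ = _ := by ring
  · filter_upwards [ae_ne_delayMeasure (τ := τ) (t - T)] with r hr
    have h1 : HasDerivAt N (stepVec T ε c (t - r)) (t - r) :=
      hasDerivAt_intervalIntegral_stepVec hε hc fun h => hr (by linarith)
    have h2 : HasDerivAt N (stepVec T ε c t) t :=
      hasDerivAt_intervalIntegral_stepVec hε hc ht.2.ne
    refine (((h1.comp_sub_const t r).sub h2).const_smul (g r)).congr_deriv ?_
    rw [smul_sub]

lemma explicit_quadEquationAt_graphA (hε : 0 ≤ ε) (hc : 0 ≤ c) (hτ : 0 ≤ τ) (hT : 0 ≤ T) {t : ℝ}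
    (ht : t ∈ Ioo 0 T) (htτ : t ≠ T - τ) {x w : State τ} (hxw : GraphA x w) :
    (explicitCoeffs T τ σ ε c).QuadEquationAt σ ε t x
      (pairing w ((explicitCoeffs T τ σ ε c).grad t x)) := by
  have ht' := Ioo_subset_Icc_self ht
  rw [graphA_iff hτ, ← map_neg] at hxw
  have hW := hasDerivAt_pastResponse_volterraOp (T := T) hε hc hT ht (-w.2)
  rw [← hxw.1] at hW
  have h := explicit_quadEquationAt (σ := σ) hε hc hτ hT ht htτ x hW
  convert h using 1
  have h1 := pastResponse_sub (T := T) hε hc hT ht.1.le 0 w.2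
  have h2 : pastResponse T ε c t (0 : PastControl τ) = 0 := by
    have := pastResponse_sub (T := T) hε hc hT ht.1.le (0 : PastControl τ) 0
    simpa using this
  rw [zero_sub, h2, zero_sub] at h1
  simp only [pairing, Coeffs.grad]
  rw [hxw.2, explicit_grad₀ hε hc hτ hT ht', explicit_inner_grad₁ hε hc hτ hT ht', h1,
    inner_sub_left, inner_neg_left, inner_neg_right, real_inner_smul_left]
  ring

lemma Coeffs.Agree.ansatz_eq {E E' : Coeffs} (h : E.Agree T τ E') {t : ℝ} (ht : t ∈ Icc 0 T) :
    ansatz τ E t = ansatz τ E' t := by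
  obtain ⟨h0, h1, h2⟩ := h
  ext z ν
  simp only [ansatz]
  rw [(h0 t ht).1, (h0 t ht).2]
  congr 2
  · congr 2
    refine integral_congr_ae ?_
    filter_upwards [ae_mem_dom₁ ht] with s hs
    rw [h1 _ _ hs]
  · refine integral_congr_ae ?_
    filter_upwards [ae_mem_dom₁ ht] with s hs
    refine integral_congr_ae ?_
    filter_upwards [ae_mem_dom₂_section ht hs.2.1 hs.2.2] with r hr
    rw [h2 _ _ _ hr]

lemma MasterEquationAt.congr {P : State τ → State τ → ℝ → Prop}
    {U U' : ℝ → State τ → Measure (State τ) → ℝ} (h : ∀ t ∈ Icc 0 T, U t = U' t) {t : ℝ}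
    (ht : t ∈ Ioo 0 T) {z : State τ} {ν : Measure (State τ)} (hU : MasterEquationAt P σ ε U t z ν) :
    MasterEquationAt P σ ε U' t z ν := by
  have ht' := h t (Ioo_subset_Icc_self ht)
  obtain ⟨Ut, U₀₀, ℓ, U₀, B₁, U₁, d, D₀, D₀₀, C₁, L, D₁, hUt, hU₀, hU₁, hB₁, hU₀₀, hd, hrest⟩ := hU
  refine ⟨Ut, U₀₀, ℓ, U₀, B₁, U₁, d, D₀, D₀₀, C₁, L, D₁, ?_, ?_, ?_, hB₁, hU₀₀, ?_, hrest⟩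
  · refine hUt.congr_of_eventuallyEq ?_
    filter_upwards [Ioo_mem_nhds ht.1 ht.2] with r hr
    rw [h r (Ioo_subset_Icc_self hr)]
  · rwa [← ht']
  · rwa [← ht']
  · rwa [← ht']

/-- The ansatz formed with a solution of the Riccati system solves the master equation. -/
theorem Coeffs.SolvesRiccati.isMasterSolution {E : Coeffs} (hε : 0 ≤ ε) (hc : 0 ≤ c) (hτ : 0 < τ)
    (hT : 0 ≤ T) (hE : E.Admissible T τ) (hR : E.SolvesRiccati T τ σ ε c) :
    IsMasterSolution T σ ε c (ansatz τ E) := by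
  have hA := explicitCoeffs_admissible (σ := σ) hε hc hτ.le hT
  have hag := (explicitCoeffs_solvesRiccati (σ := σ) hε hc hτ.le hT).agree hτ.le hA hE hR
  constructor
  · intro z ν _
    exact (hE.continuousOn_quad (deviation z ν)).congr fun t ht => hE.ansatz_eq ht z ν
  · intro z ν _
    have hTm : T ∈ Icc 0 T := right_mem_Icc.2 hT
    have h1 : ∫ s in Icc (-τ) 0, E.E₁ T (-τ - s) * (mean₁ ν - z.2) s = 0 := by
      refine integral_eq_zero_of_ae ?_
      filter_upwards [ae_mem_dom₁ hTm] with s hs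
      rw [hR.terminal₁ _ ⟨lt_of_le_of_ne hs.2.1.1 fun h => hs.2.2 (by
        simp only at h ⊢; linarith), hs.2.1.2⟩]
      simp
    have h2 : ∫ s in Icc (-τ) 0, ∫ r in Icc (-τ) 0,
        E.E₂ T (-τ - s) (-τ - r) * (mean₁ ν - z.2) s * (mean₁ ν - z.2) r = 0 := by
      refine integral_eq_zero_of_ae ?_
      filter_upwards [ae_mem_dom₁ hTm] with s hs
      refine integral_eq_zero_of_ae ?_
      filter_upwards [ae_mem_dom₂_section hTm hs.2.1 hs.2.2] with r hr
      rw [hR.terminal₂ _ hs.2.1 _ hr.2.2.1 fun h => hs.2.2 (by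
        have := (Prod.mk.inj h).1; simp only; linarith)]
      simp
    rw [ansatz, h1, h2, hR.terminal₀, hR.terminal₃]
    ring
  · intro t ht htτ z w hz ν hν hA'
    -- By uniqueness the coefficients may be replaced by the explicit ones, for which the past
    -- response gives the time derivative.
    refine MasterEquationAt.congr (fun t ht => hag.ansatz_eq ht) ht
      (hA.masterEquationAt_operatorPairing hτ ht htτ (fun x w hx => ?_) hz hν hA')
    exact explicit_quadEquationAt_graphA hε hc hτ.le hT ht htτ hx

end OperatorForm

end DelayMFG
end

noncomputable section

namespace DelayMFG

/-! ### The master equation with the adjoint transport terms -/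

section AdjointForm

variable {T τ σ ε c : ℝ}

/-- Positivity of `ε` makes elements of the cost space genuine `L²` functions on the line, so that
they can be pulled back to the delay interval. -/
lemma volume_le_smul_costMeasure (hε : 0 < ε) :
    (volume : Measure ℝ) ≤ (ENNReal.ofReal (ε / 2))⁻¹ • costMeasure T ε c := by
  have h0 : ENNReal.ofReal (ε / 2) ≠ 0 := by
    rw [Ne, ENNReal.ofReal_eq_zero, not_le]; positivity
  have h1 : (volume : Measure ℝ)
      = (ENNReal.ofReal (ε / 2))⁻¹ • (ENNReal.ofReal (ε / 2) • (volume : Measure ℝ)) := by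
    rw [smul_smul, ENNReal.inv_mul_cancel h0 ENNReal.ofReal_ne_top, one_smul]
  rw [costMeasure, smul_add, ← h1]
  exact Measure.le_add_right le_rfl

lemma inv_ofReal_ne_top (hε : 0 < ε) : (ENNReal.ofReal (ε / 2))⁻¹ ≠ ⊤ := by
  rw [Ne, ENNReal.inv_eq_top, ENNReal.ofReal_eq_zero, not_le]; positivity

lemma memLp_volume (hε : 0 < ε) (ψ : CostSpace T ε c) : MemLp ψ 2 (volume : Measure ℝ) :=
  (Lp.memLp ψ).of_measure_le_smul (inv_ofReal_ne_top hε) (volume_le_smul_costMeasure hε)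

lemma ae_volume_of_ae_costMeasure (hε : 0 < ε) {p : ℝ → Prop}
    (h : ∀ᵐ y ∂costMeasure T ε c, p y) : ∀ᵐ y, p y :=
  (Measure.absolutelyContinuous_of_le_smul (volume_le_smul_costMeasure hε)).ae_le h

/-- The pull-backs `ψ ↦ (ε / 2) ψ(t - ·) 1_{t - · ≤ T}` are bounded uniformly in `t`. -/
lemma exists_pullbackOp (hε : 0 < ε) : ∃ C, 0 ≤ C ∧ ∀ t : ℝ,
    ∃ G : CostSpace T ε c →L[ℝ] PastControl τ, ‖G‖ ≤ C ∧ ∀ ψ,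
      G ψ =ᵐ[delayMeasure τ] fun s => ε / 2 * (Iic T).indicator ψ (t - s) := by
  set K := (ENNReal.ofReal (ε / 2))⁻¹ ^ (1 / (2 : ENNReal)).toReal with hK
  have hKt : K ≠ ⊤ := ENNReal.rpow_ne_top_of_nonneg (by positivity) (inv_ofReal_ne_top hε)
  refine ⟨ε / 2 * K.toReal, by positivity, fun t => ?_⟩
  have hmp := Measure.measurePreserving_sub_left (volume : Measure ℝ) t
  have hmem : ∀ ψ : CostSpace T ε c, MemLp (fun s => ε / 2 * (Iic T).indicator ψ (t - s)) 2
      (delayMeasure τ) := fun ψ =>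
    (((((memLp_volume hε ψ).indicator measurableSet_Iic).comp_measurePreserving hmp).restrict
      _).const_mul _)
  have hae : ∀ {p : ℝ → Prop}, (∀ᵐ y ∂costMeasure T ε c, p y) →
      ∀ᵐ s ∂delayMeasure τ, p (t - s) := fun h =>
    ae_restrict_of_ae (hmp.quasiMeasurePreserving.ae (ae_volume_of_ae_costMeasure hε h))
  let L : CostSpace T ε c →ₗ[ℝ] PastControl τ :=
    { toFun := fun ψ => (hmem ψ).toLp _
      map_add' := fun ψ φ => by
        rw [← MemLp.toLp_add]
        refine MemLp.toLp_congr _ _ ?_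
        filter_upwards [hae (Lp.coeFn_add ψ φ)] with s hs
        by_cases h : t - s ≤ T
        · simp only [indicator_of_mem (mem_Iic.2 h), Pi.add_apply, hs]
          ring
        · simp [indicator_of_notMem (by simpa using h : t - s ∉ Iic T)]
      map_smul' := fun a ψ => by
        rw [RingHom.id_apply, ← MemLp.toLp_const_smul]
        refine MemLp.toLp_congr _ _ ?_
        filter_upwards [hae (Lp.coeFn_smul a ψ)] with s hs
        by_cases h : t - s ≤ T
        · simp only [indicator_of_mem (mem_Iic.2 h), Pi.smul_apply, hs, smul_eq_mul]
          ring
        · simp [indicator_of_notMem (by simpa using h : t - s ∉ Iic T)] }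
  have hLn : ∀ ψ, ‖L ψ‖ ≤ ε / 2 * K.toReal * ‖ψ‖ := fun ψ => by
    change ‖(hmem ψ).toLp _‖ ≤ _
    rw [Lp.norm_toLp, Lp.norm_def]
    have h1 : eLpNorm (fun s => ε / 2 * (Iic T).indicator ψ (t - s)) 2 (delayMeasure τ)
        ≤ ENNReal.ofReal (ε / 2) * (K * eLpNorm ψ 2 (costMeasure T ε c)) := by
      have h2 := eLpNorm_const_smul (ε / 2) (fun s => (Iic T).indicator ψ (t - s)) 2
        (delayMeasure τ)
      refine (le_of_eq h2).trans ?_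
      rw [Real.enorm_of_nonneg (by positivity)]
      refine mul_le_mul_right ?_ _
      refine (eLpNorm_mono_measure _ Measure.restrict_le_self).trans ?_
      have h3 := eLpNorm_comp_measurePreserving (p := 2) (f := fun s => t - s)
        ((memLp_volume hε ψ).indicator (measurableSet_Iic (a := T))).aestronglyMeasurable hmp
      refine (le_of_eq h3).trans ((eLpNorm_indicator_le _).trans ?_)
      exact eLpNorm_le_of_measure_le_smul (volume_le_smul_costMeasure hε)
    have h4 := ENNReal.toReal_mono (ENNReal.mul_ne_top ENNReal.ofReal_ne_top
      (ENNReal.mul_ne_top hKt (Lp.eLpNorm_ne_top ψ))) h1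
    rw [ENNReal.toReal_mul, ENNReal.toReal_mul, ENNReal.toReal_ofReal (by positivity)] at h4
    rw [mul_assoc]
    exact h4
  exact ⟨L.mkContinuous _ hLn, LinearMap.mkContinuous_norm_le _ (by positivity) _,
    fun ψ => (hmem ψ).coeFn_toLp⟩

lemma integrableOn_Icc_volume (hε : 0 < ε) (ψ : CostSpace T ε c) (a b : ℝ) :
    IntegrableOn ψ (Icc a b) volume :=
  ((memLp_volume hε ψ).restrict (Icc a b)).integrable one_le_two

lemma intervalIntegrable_indicator (hε : 0 < ε) (ψ : CostSpace T ε c) (a b : ℝ) :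
    IntervalIntegrable ((Iic T).indicator ψ) volume a b := by
  rw [intervalIntegrable_iff]
  have h : IntegrableOn ((Iic T).indicator ψ) (uIcc a b) volume :=
    (((memLp_volume hε ψ).indicator measurableSet_Iic).restrict
      (Icc (a ⊓ b) (a ⊔ b))).integrable one_le_two
  exact h.mono_set uIoc_subset_uIcc

lemma setIntegral_Icc_eq (ψ : CostSpace T ε c) (y : ℝ) :
    ∫ q in Icc y T, ψ q = ∫ q in y..T, (Iic T).indicator ψ q := by
  rcases le_or_gt y T with h | h
  · rw [intervalIntegral.integral_of_le h, integral_Icc_eq_integral_Ioc]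
    refine setIntegral_congr_fun measurableSet_Ioc fun q hq => ?_
    rw [indicator_of_mem (mem_Iic.2 hq.2)]
  · rw [Icc_eq_empty (not_le.2 h), setIntegral_empty, intervalIntegral.integral_of_ge h.le,
      setIntegral_congr_fun (g := fun _ => 0) measurableSet_Ioc fun q hq =>
        indicator_of_notMem (by simpa using hq.1) _]
    simp

lemma setIntegral_costMeasure (hε : 0 < ε) (hc : 0 ≤ c) {f : ℝ → ℝ} {y : ℝ}
    (hf : IntegrableOn f (Icc y T) volume) (h : y ≤ T ∨ c = 0) :
    ∫ q in Icc y T, f q ∂costMeasure T ε c = ε / 2 * (∫ q in Icc y T, f q) + c / 2 * f T := by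
  rw [costMeasure, Measure.restrict_add, Measure.restrict_smul, Measure.restrict_smul,
    integral_add_measure, integral_smul_measure, integral_smul_measure,
    ENNReal.toReal_ofReal (by positivity), ENNReal.toReal_ofReal (by positivity)]
  · congr 1
    rcases h with h | h
    · classical
      rw [restrict_dirac' measurableSet_Icc, if_pos (right_mem_Icc.2 h), integral_dirac]
      rfl
    · simp [h]
  · exact hf.smul_measure ENNReal.ofReal_ne_top
  · refine Integrable.smul_measure ?_ ENNReal.ofReal_ne_top
    exact (integrable_dirac (by simp)).restrict

/-- The right side is absolutely continuous in `y`. Past `T` the atom term `c / 2 * ψ T` would be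
spurious, which is why either `y ≤ T` or `c = 0` is required. -/
lemma inner_stepVec_eq (hε : 0 < ε) (hc : 0 ≤ c) (ψ : CostSpace T ε c) {y : ℝ}
    (h : y ≤ T ∨ c = 0) :
    inner ℝ (stepVec T ε c y) ψ
      = ε / 2 * (∫ q in y..T, (Iic T).indicator ψ q) + c / 2 * ψ T := by
  rw [stepVec, L2.inner_indicatorConstLp_one, ← setIntegral_Icc_eq,
    setIntegral_costMeasure hε hc (integrableOn_Icc_volume hε ψ y T) h]

/-- The scalar `⟨v_{t-s}, ψ⟩` has weak derivative `G ψ` in `s`. The alternative on `t` keeps every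
time `t - s` below the jump at `T`, or removes the jump. -/
lemma intervalIntegral_pullbackOp (hε : 0 < ε) (hc : 0 ≤ c) {t : ℝ}
    (h : t < T - τ ∨ c = 0) {G : CostSpace T ε c →L[ℝ] PastControl τ}
    (hG : ∀ ψ, G ψ =ᵐ[delayMeasure τ] fun s => ε / 2 * (Iic T).indicator ψ (t - s))
    (ψ : CostSpace T ε c) {s : ℝ} (hs : s ∈ Icc (-τ) 0) :
    ∫ r in (-τ)..s, G ψ r
      = inner ℝ (stepVec T ε c (t - s)) ψ - inner ℝ (stepVec T ε c (t + τ)) ψ := by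
  have h1 : t - s ≤ T ∨ c = 0 := h.imp_left fun h => by linarith [hs.1]
  have h2 : t + τ ≤ T ∨ c = 0 := h.imp_left fun h => by linarith
  rw [intervalIntegral_congr_coe (hG ψ) hs, intervalIntegral.integral_const_mul,
    intervalIntegral.integral_comp_sub_left (fun q => (Iic T).indicator ψ q) t, sub_neg_eq_add,
    inner_stepVec_eq hε hc ψ h1, inner_stepVec_eq hε hc ψ h2,
    ← intervalIntegral.integral_add_adjacent_intervals (a := t - s) (b := t + τ) (c := T)
      (intervalIntegrable_indicator hε ψ _ _) (intervalIntegrable_indicator hε ψ _ _)]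
  ring

/-- Pair with `ψ` and integrate by parts: the boundary terms at time `t + τ` cancel. The derivative
known on the range of `volterraOp` thus has a form that is bounded on all of `H`. -/
lemma adjoint_pullbackOp_volterraOp (hε : 0 < ε) (hc : 0 ≤ c) (hτ : 0 ≤ τ) (hT : 0 ≤ T) {t : ℝ}
    (ht : 0 ≤ t) (h : t < T - τ ∨ c = 0) {G : CostSpace T ε c →L[ℝ] PastControl τ}
    (hG : ∀ ψ, G ψ =ᵐ[delayMeasure τ] fun s => ε / 2 * (Iic T).indicator ψ (t - s))
    (g : PastControl τ) :
    -ContinuousLinearMap.adjoint G (volterraOp τ g)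
      = pastResponse T ε c t g - inner ℝ (oneVec τ) g • stepVec T ε c t := by
  refine ext_inner_right ℝ fun ψ => ?_
  have h1 : inner ℝ g (volterraOp τ (G ψ)) = inner ℝ (pastResponse T ε c t g) ψ
      - inner ℝ (oneVec τ) g * inner ℝ (stepVec T ε c (t + τ)) ψ := by
    have hi : Integrable (fun s => g s * inner ℝ (stepVec T ε c (t - s)) ψ) (delayMeasure τ) := by
      have := (integrable_smul_stepVec (τ := τ) (T := T) hε.le hc hT ht g).inner_const (𝕜 := ℝ) ψ
      simpa only [real_inner_smul_left] using this
    rw [inner_pastResponse hε.le hc hT ht, inner_oneVec, ← integral_mul_const,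
      ← integral_sub hi ((integrable_coe g).mul_const _), inner_eq_integral]
    refine integral_congr_ae ?_
    filter_upwards [volterraOp_ae (G ψ),
      ae_restrict_mem (measurableSet_Icc (a := -τ) (b := 0))] with s hs hs'
    rw [hs, intervalIntegral_pullbackOp hε hc h hG ψ hs']
    ring
  have h2 : inner ℝ (oneVec τ) (G ψ)
      = inner ℝ (stepVec T ε c t) ψ - inner ℝ (stepVec T ε c (t + τ)) ψ := by
    rw [← intervalIntegral_eq_inner_oneVec hτ,
      intervalIntegral_pullbackOp hε hc h hG ψ ⟨by linarith, le_rfl⟩, sub_zero]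
  have h3 := inner_volterraOp_add g (G ψ)
  rw [h1, h2] at h3
  rw [inner_neg_left, ContinuousLinearMap.adjoint_inner_left, inner_sub_left, real_inner_smul_left]
  linarith

/-- Approximate `x` from the dense range of `volterraOp`. The derivatives converge uniformly in time
because the pull-backs have a common norm bound. -/
lemma hasDerivAt_pastResponse (hε : 0 < ε) (hc : 0 ≤ c) (hτ : 0 ≤ τ) (hT : 0 ≤ T) {t : ℝ}
    (ht : t ∈ Ioo 0 T) (h : t < T - τ ∨ c = 0) {C : ℝ}
    {G : ℝ → CostSpace T ε c →L[ℝ] PastControl τ} (hC : ∀ t, ‖G t‖ ≤ C)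
    (hG : ∀ t ψ, G t ψ =ᵐ[delayMeasure τ] fun s => ε / 2 * (Iic T).indicator ψ (t - s))
    (x : PastControl τ) :
    HasDerivAt (fun u => pastResponse T ε c u x) (-ContinuousLinearMap.adjoint (G t) x) t := by
  obtain ⟨y, hy, hyx⟩ := mem_closure_iff_seq_limit.1 ((denseRange_volterraOp hτ) x)
  choose g hg using hy
  -- Uniform convergence needs an open set of times on which the alternative persists.
  obtain ⟨S, hSo, htS, hS⟩ : ∃ S : Set ℝ, IsOpen S ∧ t ∈ S ∧
      ∀ u ∈ S, u ∈ Ioo 0 T ∧ (u < T - τ ∨ c = 0) := by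
    rcases h with h | h
    · exact ⟨Ioo 0 T ∩ Iio (T - τ), isOpen_Ioo.inter isOpen_Iio, ⟨ht, h⟩,
        fun u hu => ⟨hu.1, Or.inl hu.2⟩⟩
    · exact ⟨Ioo 0 T, isOpen_Ioo, ht, fun u hu => ⟨hu, Or.inr h⟩⟩
  have hdist : Tendsto (fun n => ‖y n - x‖) atTop (𝓝 0) := tendsto_iff_norm_sub_tendsto_zero.1 hyx
  refine hasDerivAt_of_tendstoUniformlyOn (l := atTop) (f := fun n u => pastResponse T ε c u (y n))
    (f' := fun n u => -ContinuousLinearMap.adjoint (G u) (y n))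
    (g' := fun u => -ContinuousLinearMap.adjoint (G u) x) hSo ?_ ?_ ?_ htS
  · rw [Metric.tendstoUniformlyOn_iff]
    intro δ hδ
    have h1 : Tendsto (fun n => C * ‖y n - x‖) atTop (𝓝 0) := by simpa using hdist.const_mul C
    filter_upwards [h1.eventually (gt_mem_nhds hδ)] with n hn u _
    rw [dist_eq_norm, neg_sub_neg, ← map_sub]
    refine ((ContinuousLinearMap.le_opNorm _ _).trans ?_).trans_lt hn
    rw [LinearIsometryEquiv.norm_map]
    exact mul_le_mul_of_nonneg_right (hC u) (norm_nonneg _)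
  · refine Eventually.of_forall fun n u hu => ?_
    rw [← hg n, adjoint_pullbackOp_volterraOp hε hc hτ hT (hS u hu).1.1.le (hS u hu).2 (hG u)]
    exact hasDerivAt_pastResponse_volterraOp hε.le hc hT (hS u hu).1 (g n)
  · intro u hu
    rw [tendsto_iff_norm_sub_tendsto_zero]
    refine squeeze_zero (fun _ => norm_nonneg _) (fun n => ?_)
      (by simpa using hdist.const_mul (‖oneVec τ‖ * ‖stepVec T ε c 0‖))
    rw [← pastResponse_sub hε.le hc hT (hS u hu).1.1.le]
    exact norm_pastResponse_le hε.le hc hT (hS u hu).1.1.le _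

/-- The second component is represented by `s ↦ 2a ⟨v_{t-s}, costate⟩`. Its value at `s = 0` is the
first component, which is the compatibility condition of `D(A*)`. The factor `a` serves both signs,
`∂_z U` and `D_ν U`. -/
lemma explicit_graphAdjoint_grad (hε : 0 < ε) (hc : 0 ≤ c) (hτ : 0 ≤ τ) (hT : 0 ≤ T) {t : ℝ}
    (ht : t ∈ Ioo 0 T) (h : t < T - τ ∨ c = 0) {G : CostSpace T ε c →L[ℝ] PastControl τ}
    (hG : ∀ ψ, G ψ =ᵐ[delayMeasure τ] fun s => ε / 2 * (Iic T).indicator ψ (t - s))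
    (x : State τ) (a : ℝ) :
    GraphAdjoint (a • (explicitCoeffs T τ σ ε c).grad t x)
      (0, G ((2 * a) • costate T τ ε c t x)) := by
  have ht' := Ioo_subset_Icc_self ht
  set ψ := costate T τ ε c t x with hψ
  refine ⟨fun s => inner ℝ (stepVec T ε c (t - s)) ((2 * a) • ψ), G ((2 * a) • ψ), ⟨?_, ?_⟩, ?_, rfl⟩
  · have hmem : MemLp (fun s => inner ℝ (stepVec T ε c (t - s)) ((2 * a) • ψ)) 2
        (delayMeasure τ) := by
      refine MemLp.of_bound (C := ‖stepVec T ε c 0‖ * ‖(2 * a) • ψ‖) ?_ ?_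
      · exact (((stronglyMeasurable_stepVec hε.le hc).comp_measurable
          (measurable_const.sub measurable_id)).inner stronglyMeasurable_const).aestronglyMeasurable
      · filter_upwards [ae_norm_stepVec_sub_le hε.le hc hT ht.1.le] with s hs
        exact (norm_inner_le_norm _ _).trans (mul_le_mul_of_nonneg_right hs (norm_nonneg _))
    have heq : (a • (explicitCoeffs T τ σ ε c).grad t x).2
        = toH τ fun s => inner ℝ (stepVec T ε c (t - s)) ((2 * a) • ψ) := by
      refine ext_inner_right ℝ fun y => ?_
      rw [inner_toH hmem, real_inner_comm]
      simp only [Coeffs.grad, Prod.smul_snd]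
      rw [real_inner_smul_right, explicit_inner_grad₁ hε.le hc hτ hT ht',
        inner_pastResponse hε.le hc hT ht.1.le, ← integral_const_mul, ← integral_const_mul]
      refine integral_congr_ae (ae_of_all _ fun s => ?_)
      simp only [real_inner_smul_right]
      ring
    rw [heq]
    exact toH_ae hmem
  · intro s hs
    simp only
    rw [intervalIntegral_pullbackOp hε hc h hG _ hs, sub_neg_eq_add]
    ring
  · simp only [Coeffs.grad, Prod.smul_fst, sub_zero, smul_eq_mul]
    rw [explicit_grad₀ hε.le hc hτ hT ht', real_inner_smul_right]
    ring

/-- Where the gradient of the ansatz is regular, the master equation holds with the adjoint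
transport terms, for all states and measures. -/
theorem Coeffs.SolvesRiccati.masterEquationAt_adjointPairing {E : Coeffs} (hε : 0 < ε) (hc : 0 ≤ c)
    (hτ : 0 < τ) (hT : 0 ≤ T) (hE : E.Admissible T τ) (hR : E.SolvesRiccati T τ σ ε c) {t : ℝ}
    (ht : t ∈ Ioo 0 T) (htτ : t ≠ T - τ) (h : t < T - τ ∨ c = 0) (z : State τ)
    {ν : Measure (State τ)} (hν : IsP1 ν) :
    MasterEquationAt AdjointPairing σ ε (ansatz τ E) t z ν := by
  have hA := explicitCoeffs_admissible (σ := σ) hε.le hc hτ.le hT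
  have hag := (explicitCoeffs_solvesRiccati (σ := σ) hε.le hc hτ.le hT).agree hτ.le hA hE hR
  refine MasterEquationAt.congr (fun t ht => hag.ansatz_eq ht) ht ?_
  obtain ⟨C, -, hex⟩ := exists_pullbackOp (T := T) (τ := τ) (c := c) hε
  choose G hGn hG using hex
  set x := deviation z ν with hx
  set ψ := costate T τ ε c t x with hψ
  have hW := hasDerivAt_pastResponse hε hc hτ.le hT ht h hGn hG x.2
  have hgr := fun a => explicit_graphAdjoint_grad (σ := σ) hε hc hτ.le hT ht h (hG t) x a
  refine hA.masterEquationAt_of_quad hτ ht htτ hν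
    (explicit_quadEquationAt hε.le hc hτ.le hT ht htτ x hW)
    (ℓ := pairing z (0, G t ((2 * (-1 : ℝ)) • ψ)))
    (L := fun y => pairing y (0, G t ((2 * (1 : ℝ)) • ψ)))
    ⟨_, by have := hgr (-1); rwa [neg_one_smul] at this, rfl⟩
    (ae_of_all _ fun y => ⟨_, by have := hgr 1; rwa [one_smul] at this, rfl⟩) (integrable_pairing hν.2 _) ?_
  rw [integral_pairing hν.2, ← mean₀_eq, ← mean₁_eq]
  have h1 : inner ℝ (ContinuousLinearMap.adjoint (G t) x.2) ψ
      = inner ℝ (mean₁ ν) (G t ψ) - inner ℝ z.2 (G t ψ) := by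
    rw [ContinuousLinearMap.adjoint_inner_left, ← inner_sub_left]
    rfl
  simp only [pairing, map_smul, real_inner_smul_right, inner_neg_left, mul_zero, zero_add]
  rw [show x.1 = mean₀ ν - z.1 from rfl, ← hψ, ← hx, h1]
  ring

end AdjointForm

end DelayMFG
end

noncomputable section

namespace DelayMFG

/-! ### The quadratic form along curves of states -/

section Curves

variable {T τ : ℝ} {E : Coeffs}

lemma pairing_smul_right (a : ℝ) (x p : State τ) : pairing x (a • p) = a * pairing x p := by
  simp [pairing, real_inner_smul_right]; ring

lemma pairing_sub_right (x p q : State τ) : pairing x (p - q) = pairing x p - pairing x q := by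
  simp [pairing, inner_sub_right]; ring

lemma Coeffs.Admissible.exists_pairing_grad_le (hE : E.Admissible T τ) :
    ∃ C, 0 ≤ C ∧ ∀ t ∈ Icc 0 T, ∀ x y : State τ, |pairing (E.grad t x) y| ≤ C * ‖x‖ * ‖y‖ := by
  obtain ⟨C₀, h₀⟩ := isCompact_Icc.exists_bound_of_continuousOn hE.continuousOn₀
  obtain ⟨C₁, hC₁, h₁⟩ := hE.exists_norm_vec₁_le
  obtain ⟨C₂, hC₂, h₂⟩ := hE.exists_norm_op₂_le
  refine ⟨2 * |C₀| + 4 * C₁ + 2 * C₂, by positivity, fun t ht x y => ?_⟩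
  have hx1 : |x.1| ≤ ‖x‖ := norm_fst_le x
  have hx2 : ‖x.2‖ ≤ ‖x‖ := norm_snd_le x
  have hg0 : |E.grad₀ t x| ≤ (2 * |C₀| + 2 * C₁) * ‖x‖ := by
    have e1 : |2 * E.E₀ t * x.1| ≤ 2 * |C₀| * ‖x‖ := by
      rw [abs_mul, abs_mul, abs_two]
      have h := (h₀ t ht).trans (le_abs_self _)
      rw [Real.norm_eq_abs] at h
      exact mul_le_mul (mul_le_mul_of_nonneg_left h zero_le_two) hx1 (abs_nonneg _) (by positivity)
    have e2 : |2 * inner ℝ (E.vec₁ τ t) x.2| ≤ 2 * C₁ * ‖x‖ := by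
      rw [abs_mul, abs_two, mul_assoc]
      gcongr
      exact (abs_real_inner_le_norm _ _).trans (mul_le_mul (h₁ t ht) hx2 (norm_nonneg _) hC₁)
    rw [Coeffs.grad₀]
    linarith [abs_sub (2 * E.E₀ t * x.1) (2 * inner ℝ (E.vec₁ τ t) x.2)]
  have hg1 : ‖E.grad₁ t x‖ ≤ (2 * C₁ + 2 * C₂) * ‖x‖ := by
    rw [Coeffs.grad₁, norm_smul, Real.norm_two]
    have e1 : ‖E.op₂ τ t x.2‖ ≤ C₂ * ‖x‖ :=
      ((E.op₂ τ t).le_opNorm _).trans (mul_le_mul (h₂ t ht) hx2 (norm_nonneg _) hC₂)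
    have e2 : ‖x.1 • E.vec₁ τ t‖ ≤ ‖x‖ * C₁ := by
      rw [norm_smul]
      exact mul_le_mul hx1 (h₁ t ht) (norm_nonneg _) (norm_nonneg _)
    linarith [norm_sub_le (E.op₂ τ t x.2) (x.1 • E.vec₁ τ t)]
  have hy1 : |y.1| ≤ ‖y‖ := norm_fst_le y
  have hy2 : ‖y.2‖ ≤ ‖y‖ := norm_snd_le y
  have e1 : |E.grad₀ t x * y.1| ≤ (2 * |C₀| + 2 * C₁) * ‖x‖ * ‖y‖ := by
    rw [abs_mul]
    exact mul_le_mul hg0 hy1 (abs_nonneg _) (by positivity)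
  have e2 : |inner ℝ (E.grad₁ t x) y.2| ≤ (2 * C₁ + 2 * C₂) * ‖x‖ * ‖y‖ :=
    (abs_real_inner_le_norm _ _).trans (mul_le_mul hg1 hy2 (norm_nonneg _) (by positivity))
  refine (abs_add_le _ _).trans ((add_le_add e1 e2).trans_eq ?_)
  ring

lemma Coeffs.pairing_grad_self (t : ℝ) (x : State τ) :
    pairing (E.grad t x) x = 2 * (E.quad t x - E.E₃ t) := by
  simp only [pairing, Coeffs.grad, Coeffs.grad₀, Coeffs.grad₁, Coeffs.quad, real_inner_smul_left,
    inner_sub_left]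
  rw [real_inner_comm x.2 (E.op₂ τ t x.2)]
  ring

/-- An exact Taylor formula. It separates the time dependence at a fixed state from the increment of
the state, as the coefficient operators are known to be continuous in time only weakly. -/
lemma Coeffs.Admissible.quad_eq_add (hE : E.Admissible T τ) {t : ℝ} (ht : t ∈ Icc 0 T)
    (x y : State τ) :
    E.quad t y = E.quad t x + pairing (E.grad t x) (y - x)
      + 1 / 2 * pairing (E.grad t (y - x)) (y - x) := by
  have h := hE.quad_add ht x (y - x) 1
  rw [one_smul, add_sub_cancel, one_mul, one_pow, one_mul] at h
  rw [h, Coeffs.pairing_grad_self]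
  ring

lemma Coeffs.Admissible.continuousOn_pairing_grad (hE : E.Admissible T τ) (x y : State τ) :
    ContinuousOn (fun t => pairing (E.grad t x) y) (Icc 0 T) := by
  have h : ∀ t, pairing (E.grad t x) y = (2 * E.E₀ t * x.1 - 2 * inner ℝ (E.vec₁ τ t) x.2) * y.1
      + 2 * (inner ℝ y.2 (E.op₂ τ t x.2) - x.1 * inner ℝ (E.vec₁ τ t) y.2) := fun t => by
    simp only [pairing, Coeffs.grad, Coeffs.grad₀, Coeffs.grad₁, real_inner_smul_left,
      inner_sub_left]
    rw [real_inner_comm y.2 (E.op₂ τ t x.2)]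
  simp only [h]
  have h0 := hE.continuousOn₀
  have h1 := hE.continuousOn_inner_vec₁ x.2
  have h2 := hE.continuousOn_inner_vec₁ y.2
  have h3 := hE.continuousOn_inner_op₂ y.2 x.2
  fun_prop

lemma Coeffs.Admissible.continuousOn_quad_curve (hE : E.Admissible T τ) {X : ℝ → State τ}
    (hX : Continuous X) : ContinuousOn (fun t => E.quad t (X t)) (Icc 0 T) := by
  obtain ⟨C, hC, hb⟩ := hE.exists_pairing_grad_le
  intro t ht
  have h0 : Tendsto (fun r => ‖X r - X t‖) (𝓝[Icc 0 T] t) (𝓝 0) := by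
    have h : Tendsto (fun r => ‖X r - X t‖) (𝓝 t) (𝓝 ‖X t - X t‖) :=
      ((hX.sub continuous_const).norm).tendsto t
    rw [sub_self, norm_zero] at h
    exact h.mono_left nhdsWithin_le_nhds
  have h1 : Tendsto (fun r => pairing (E.grad r (X t)) (X r - X t)) (𝓝[Icc 0 T] t) (𝓝 0) := by
    refine squeeze_zero_norm' ?_ (by simpa using h0.const_mul (C * ‖X t‖))
    filter_upwards [self_mem_nhdsWithin] with r hr
    exact hb r hr _ _
  have h2 : Tendsto (fun r => 1 / 2 * pairing (E.grad r (X r - X t)) (X r - X t))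
      (𝓝[Icc 0 T] t) (𝓝 0) := by
    have h3 : Tendsto (fun r => pairing (E.grad r (X r - X t)) (X r - X t))
        (𝓝[Icc 0 T] t) (𝓝 0) := by
      refine squeeze_zero_norm' ?_ (by simpa using (h0.const_mul C).mul h0)
      filter_upwards [self_mem_nhdsWithin] with r hr
      exact hb r hr _ _
    have h4 := h3.const_mul (1 / 2)
    rwa [mul_zero] at h4
  have h4 := ((hE.continuousOn_quad (X t) t ht).tendsto.add h1).add h2
  rw [add_zero, add_zero] at h4
  refine h4.congr' ?_
  filter_upwards [self_mem_nhdsWithin] with r hr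
  exact (hE.quad_eq_add hr _ _).symm

lemma Coeffs.Admissible.hasDerivAt_quad_curve (hE : E.Admissible T τ) {t : ℝ} (ht : t ∈ Ioo 0 T)
    {X : ℝ → State τ} {w : State τ} (hX : HasDerivAt X w t) {D : ℝ}
    (hD : HasDerivAt (fun r => E.quad r (X t)) D t) :
    HasDerivAt (fun r => E.quad r (X r)) (D + pairing (E.grad t (X t)) w) t := by
  obtain ⟨C, hC, hb⟩ := hE.exists_pairing_grad_le
  have hI : ∀ᶠ r in 𝓝 t, r ∈ Icc 0 T := Icc_mem_nhds ht.1 ht.2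
  have hO : (fun r => X r - X t) =O[𝓝 t] fun r => r - t := hX.isBigO_sub
  have hY : (fun r => X r - X t - (r - t) • w) =o[𝓝 t] fun r => r - t :=
    hasDerivAt_iff_isLittleO.1 hX
  have h1 : HasDerivAt (fun r => pairing (E.grad r (X t)) (X r - X t))
      (pairing (E.grad t (X t)) w) t := by
    rw [hasDerivAt_iff_isLittleO]
    -- The uniform bound on the gradient controls the remainder of the curve; against the fixed
    -- velocity `w`, weak continuity in time is enough.
    have e1 : (fun r => pairing (E.grad r (X t)) (X r - X t - (r - t) • w))
        =o[𝓝 t] fun r => r - t := by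
      refine Asymptotics.IsBigO.trans_isLittleO (Asymptotics.IsBigO.of_bound (C * ‖X t‖) ?_) hY
      filter_upwards [hI] with r hr
      exact hb r hr _ _
    have e2 : (fun r => (r - t) * (pairing (E.grad r (X t)) w - pairing (E.grad t (X t)) w))
        =o[𝓝 t] fun r => r - t := by
      have h := (hE.continuousOn_pairing_grad (X t) w).continuousAt (Icc_mem_nhds ht.1 ht.2)
      have h' : (fun r => pairing (E.grad r (X t)) w - pairing (E.grad t (X t)) w)
          =o[𝓝 t] fun _ => (1 : ℝ) := by
        rw [Asymptotics.isLittleO_one_iff]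
        simpa using h.tendsto.sub_const (pairing (E.grad t (X t)) w)
      simpa using (Asymptotics.isBigO_refl (fun r : ℝ => r - t) (𝓝 t)).mul_isLittleO h'
    refine (e1.add e2).congr_left fun r => ?_
    rw [pairing_sub_right, pairing_smul_right, sub_self (X t),
      show pairing (E.grad t (X t)) (0 : State τ) = 0 by simp [pairing], smul_eq_mul]
    ring
  have h2 : HasDerivAt (fun r => 1 / 2 * pairing (E.grad r (X r - X t)) (X r - X t)) 0 t := by
    rw [hasDerivAt_iff_isLittleO]
    have e1 : (fun r => 1 / 2 * pairing (E.grad r (X r - X t)) (X r - X t))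
        =O[𝓝 t] fun r => (r - t) * (r - t) := by
      refine Asymptotics.IsBigO.const_mul_left ?_ _
      refine Asymptotics.IsBigO.trans (Asymptotics.IsBigO.of_bound C ?_) (hO.norm_left.mul hO.norm_left)
      filter_upwards [hI] with r hr
      refine (hb r hr _ _).trans_eq ?_
      simp [mul_assoc]
    have e2 : (fun r : ℝ => (r - t) * (r - t)) =o[𝓝 t] fun r => r - t := by
      have h' : (fun r : ℝ => r - t) =o[𝓝 t] fun _ => (1 : ℝ) := by
        rw [Asymptotics.isLittleO_one_iff]
        have : Tendsto (fun r : ℝ => r - t) (𝓝 t) (𝓝 (t - t)) := tendsto_id.sub_const t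
        rwa [sub_self] at this
      simpa using (Asymptotics.isBigO_refl (fun r : ℝ => r - t) (𝓝 t)).mul_isLittleO h'
    refine (e1.trans_isLittleO e2).congr_left fun r => ?_
    simp [pairing]
  have h3 := (hD.add h1).add h2
  rw [add_zero] at h3
  refine h3.congr_of_eventuallyEq ?_
  filter_upwards [hI] with r hr
  exact hE.quad_eq_add hr _ _

end Curves

/-! ### The flow of `A` on smooth states -/

section Flow

variable {τ : ℝ} {θ : ℝ → ℝ}

/-- The state at time `r` of the flow of `A` whose past is `s ↦ θ(r - s)`, started at time `t` with
first component `x₀`. -/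
def flow (τ : ℝ) (θ : ℝ → ℝ) (t x₀ r : ℝ) : State τ :=
  (x₀ + ∫ u in t..r, θ u, toH τ fun s => θ (r - s))

lemma memLp_comp_sub (hθ : Continuous θ) (hs : HasCompactSupport θ) (r : ℝ) :
    MemLp (fun s => θ (r - s)) 2 (delayMeasure τ) := by
  obtain ⟨C, hC⟩ := hs.exists_bound_of_continuous hθ
  exact MemLp.of_bound (by fun_prop) C (ae_of_all _ fun s => hC _)

lemma norm_toH_le {f : ℝ → ℝ} {C : ℝ} (hf : MemLp f 2 (delayMeasure τ)) (hC : 0 ≤ C)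
    (h : ∀ s, |f s| ≤ C) :
    ‖toH τ f‖ ≤ (measureUnivNNReal (delayMeasure τ) : ℝ) ^ (ENNReal.toReal 2)⁻¹ * C := by
  refine Lp.norm_le_of_ae_bound hC ?_
  filter_upwards [toH_ae hf] with s hs
  rw [hs]
  exact h s

lemma toH_sub {f g : ℝ → ℝ} (hf : MemLp f 2 (delayMeasure τ)) (hg : MemLp g 2 (delayMeasure τ)) :
    toH τ f - toH τ g = toH τ fun s => f s - g s := by
  refine Lp.ext ?_
  filter_upwards [Lp.coeFn_sub (toH τ f) (toH τ g), toH_ae hf, toH_ae hg, toH_ae (hf.sub hg)]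
    with s h1 h2 h3 h4
  rw [h1, Pi.sub_apply, h2, h3]
  exact h4.symm

lemma smul_toH {f : ℝ → ℝ} (hf : MemLp f 2 (delayMeasure τ)) (a : ℝ) :
    a • toH τ f = toH τ fun s => a * f s := by
  refine Lp.ext ?_
  filter_upwards [Lp.coeFn_smul a (toH τ f), toH_ae hf, toH_ae (hf.const_mul a)] with s h1 h2 h3
  rw [h1, Pi.smul_apply, h2, h3, smul_eq_mul]

lemma hasDerivAt_toH_comp_sub (hθ : ContDiff ℝ 2 θ) (hs : HasCompactSupport θ) (r : ℝ) :
    HasDerivAt (fun u => toH τ fun s => θ (u - s)) (toH τ fun s => deriv θ (r - s)) r := by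
  have hθ' : ContDiff ℝ 1 (deriv θ) := by
    have h : ContDiff ℝ (1 + 1) θ := by simpa [one_add_one_eq_two] using hθ
    exact (contDiff_succ_iff_deriv.1 h).2.2
  obtain ⟨L, hL⟩ := hθ'.lipschitzWith_of_hasCompactSupport hs.deriv one_ne_zero
  have hd : ∀ u, HasDerivAt θ (deriv θ u) u := fun u =>
    (hθ.differentiable (by simp) u).hasDerivAt
  -- The Lipschitz constant of `θ'` gives a quadratic remainder uniform in `s`, which passes to the
  -- norm of `H` on a finite measure space.
  have hrem : ∀ u s, |θ (u - s) - θ (r - s) - (u - r) * deriv θ (r - s)| ≤ L * |u - r| * |u - r| := by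
    intro u s
    have h := Convex.norm_image_sub_le_of_norm_hasDerivWithin_le
      (f := fun v => θ (v - s) - v * deriv θ (r - s))
      (f' := fun v => deriv θ (v - s) - 1 * deriv θ (r - s)) (s := uIcc r u) (C := L * |u - r|)
      (x := r) (y := u) (fun v _ => ?_) (fun v hv => ?_) (convex_uIcc r u) left_mem_uIcc
      right_mem_uIcc
    · rw [Real.norm_eq_abs, Real.norm_eq_abs] at h
      refine (le_of_eq ?_).trans h
      congr 1
      ring
    · exact (((hd (v - s)).comp_sub_const v s).sub ((hasDerivAt_id v).mul_const _)).hasDerivWithinAt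
    · rw [one_mul]
      refine (hL.norm_sub_le _ _).trans ?_
      refine mul_le_mul_of_nonneg_left ?_ L.2
      rw [sub_sub_sub_cancel_right, Real.norm_eq_abs]
      exact abs_sub_left_of_mem_uIcc hv
  have hm := fun u => memLp_comp_sub (τ := τ) hθ.continuous hs u
  have hm' := memLp_comp_sub (τ := τ) hθ'.continuous hs.deriv r
  rw [hasDerivAt_iff_isLittleO]
  set c := (measureUnivNNReal (delayMeasure τ) : ℝ) ^ (ENNReal.toReal 2)⁻¹ with hc
  have e1 : (fun u => (toH τ fun s => θ (u - s)) - (toH τ fun s => θ (r - s)) -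
      (u - r) • toH τ fun s => deriv θ (r - s)) =O[𝓝 r] fun u => (u - r) * (u - r) := by
    refine Asymptotics.IsBigO.of_bound (c * L) (Eventually.of_forall fun u => ?_)
    rw [toH_sub (hm u) (hm r), smul_toH hm', toH_sub (f := fun s => θ (u - s) - θ (r - s))
      ((hm u).sub (hm r)) (hm'.const_mul _)]
    refine (norm_toH_le (((hm u).sub (hm r)).sub (hm'.const_mul _)) (by positivity)
      (hrem u)).trans_eq ?_
    rw [norm_mul, Real.norm_eq_abs]
    ring
  refine e1.trans_isLittleO ?_
  have h' : (fun u : ℝ => u - r) =o[𝓝 r] fun _ => (1 : ℝ) := by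
    rw [Asymptotics.isLittleO_one_iff]
    have : Tendsto (fun u : ℝ => u - r) (𝓝 r) (𝓝 (r - r)) := tendsto_id.sub_const r
    rwa [sub_self] at this
  simpa using (Asymptotics.isBigO_refl (fun u : ℝ => u - r) (𝓝 r)).mul_isLittleO h'

lemma hasDerivAt_flow (hθ : ContDiff ℝ 2 θ) (hs : HasCompactSupport θ) (t x₀ r : ℝ) :
    HasDerivAt (flow τ θ t x₀) (θ r, toH τ fun s => deriv θ (r - s)) r :=
  ((intervalIntegral.integral_hasDerivAt_right (hθ.continuous.intervalIntegrable _ _)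
    (hθ.continuous.stronglyMeasurableAtFilter _ _) hθ.continuous.continuousAt).const_add x₀).prodMk
    (hasDerivAt_toH_comp_sub hθ hs r)

/-- The hypothesis on `θ` is the boundary condition at `s = -τ`. The image under `A` is the velocity
of the flow, so the curve solves `X' = A X`. -/
lemma graphA_flow (hθ : ContDiff ℝ 2 θ) (hs : HasCompactSupport θ) (t x₀ : ℝ) {r : ℝ}
    (h0 : θ (r + τ) = 0) :
    GraphA (flow τ θ t x₀ r) (θ r, toH τ fun s => deriv θ (r - s)) := by
  have hc : Continuous (deriv θ) := hθ.continuous_deriv (by norm_num)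
  have hm := memLp_comp_sub (τ := τ) hc hs.deriv r
  refine ⟨fun s => θ (r - s), -toH τ fun s => deriv θ (r - s),
    ⟨toH_ae (memLp_comp_sub hθ.continuous hs r), fun s hs' => ?_⟩, by
      simpa using h0, by simp⟩
  have h1 : ((-toH τ fun s => deriv θ (r - s) : PastControl τ) : ℝ → ℝ)
      =ᵐ[delayMeasure τ] fun s => -deriv θ (r - s) := by
    filter_upwards [Lp.coeFn_neg (toH τ fun s => deriv θ (r - s)), toH_ae hm] with s h2 h3
    rw [h2, Pi.neg_apply, h3]
  rw [intervalIntegral_congr_coe h1 hs', intervalIntegral.integral_eq_sub_of_hasDerivAt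
    (f := fun s => θ (r - s))]
  · ring
  · intro u _
    have h := ((hθ.differentiable (by simp) (r - u)).hasDerivAt).comp_const_sub r u
    exact h
  · exact (by fun_prop : Continuous fun s => -deriv θ (r - s)).intervalIntegrable _ _

lemma integral_comp_sub_le {f : ℝ → ℝ} (hf : Integrable f) (h0 : ∀ u, 0 ≤ f u) (r : ℝ) :
    ∫ s, f (r - s) ∂delayMeasure τ ≤ ∫ u, f u := by
  rw [← integral_sub_left_eq_self f volume r]
  exact setIntegral_le_integral (hf.comp_sub_left r) (ae_of_all _ fun s => h0 _)

/-- The past is measured in `L¹` because that norm of a bump is one whatever its width; the Picard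
constants then stay bounded as bumps concentrate. -/
lemma abs_fst_flow_add_le (hθ : Continuous θ) (hs : HasCompactSupport θ) (t x₀ r : ℝ) :
    |(flow τ θ t x₀ r).1| + ∫ s, |(flow τ θ t x₀ r).2 s| ∂delayMeasure τ
      ≤ |x₀| + 2 * ∫ u, |θ u| := by
  have hi : Integrable fun u => |θ u| := (hθ.integrable_of_hasCompactSupport hs).abs
  have h1 : |x₀ + ∫ u in t..r, θ u| ≤ |x₀| + ∫ u, |θ u| := by
    refine (abs_add_le _ _).trans (add_le_add le_rfl ?_)
    refine (intervalIntegral.norm_integral_le_integral_norm_uIoc (f := θ)).trans ?_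
    exact setIntegral_le_integral hi (ae_of_all _ fun s => abs_nonneg _)
  have h2 : ∫ s, |(flow τ θ t x₀ r).2 s| ∂delayMeasure τ ≤ ∫ u, |θ u| := by
    refine (le_of_eq (integral_congr_ae ?_)).trans
      (integral_comp_sub_le hi (fun u => abs_nonneg _) r)
    filter_upwards [toH_ae (memLp_comp_sub hθ hs r)] with s h
    rw [show (flow τ θ t x₀ r).2 = toH τ fun s => θ (r - s) from rfl, h]
  simp only [flow] at h2 ⊢
  linarith

end Flow

end DelayMFG
end

noncomputable section

namespace DelayMFG

/-! ### Recovering the coefficients from the quadratic form -/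

section Recover

variable {T τ : ℝ} {E E' : Coeffs}

/-- A smooth probability density carried by the interval `(a, b)`. -/
structure IsBump (θ : ℝ → ℝ) (a b : ℝ) : Prop where
  contDiff : ContDiff ℝ 2 θ
  nonneg : ∀ u, 0 ≤ θ u
  integral_eq : ∫ u, θ u = 1
  mem_of_ne : ∀ u, θ u ≠ 0 → u ∈ Ioo a b

lemma exists_isBump {a b : ℝ} (hab : a < b) : ∃ θ, IsBump θ a b := by
  let φ : ContDiffBump ((a + b) / 2) := ⟨(b - a) / 4, (b - a) / 2, by linarith, by linarith⟩
  refine ⟨φ.normed volume, φ.contDiff_normed (n := 2), φ.nonneg_normed, φ.integral_normed,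
    fun u hu => ?_⟩
  have h : u ∈ Function.support (φ.normed volume) := hu
  rw [φ.support_normed_eq, Real.ball_eq_Ioo] at h
  have e : φ.rOut = (b - a) / 2 := rfl
  rw [e] at h
  exact ⟨by linarith [h.1], by linarith [h.2]⟩

lemma IsBump.hasCompactSupport {θ : ℝ → ℝ} {a b : ℝ} (h : IsBump θ a b) : HasCompactSupport θ :=
  HasCompactSupport.of_support_subset_isCompact isCompact_Icc
    fun u hu => Ioo_subset_Icc_self (h.mem_of_ne u hu)

lemma IsBump.integrable {θ : ℝ → ℝ} {a b : ℝ} (h : IsBump θ a b) : Integrable θ :=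
  h.contDiff.continuous.integrable_of_hasCompactSupport h.hasCompactSupport

lemma IsBump.integral_abs {θ : ℝ → ℝ} {a b : ℝ} (h : IsBump θ a b) : ∫ u, |θ u| = 1 := by
  rw [← h.integral_eq]
  exact integral_congr_ae (ae_of_all _ fun u => abs_of_nonneg (h.nonneg u))

lemma IsBump.memLp {θ : ℝ → ℝ} {a b : ℝ} (h : IsBump θ a b) (t : ℝ) :
    MemLp (fun s => θ (t - s)) 2 (delayMeasure τ) :=
  memLp_comp_sub h.contDiff.continuous h.hasCompactSupport t

lemma IsBump.integral_delay {θ : ℝ → ℝ} {a b t : ℝ} (h : IsBump θ a b) (ha : t ≤ a)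
    (hb : b ≤ t + τ) : ∫ s, θ (t - s) ∂delayMeasure τ = 1 := by
  rw [setIntegral_eq_integral_of_forall_compl_eq_zero, integral_sub_left_eq_self θ volume t,
    h.integral_eq]
  intro s hs
  by_contra hne
  have h' := h.mem_of_ne _ hne
  exact hs ⟨by linarith [h'.2], by linarith [h'.1]⟩

/-- An average of values close to `a` is close to `a`. -/
lemma abs_integral_mul_sub_le {α : Type*} [MeasurableSpace α] {μ : Measure α} {f w : α → ℝ}
    {a η : ℝ} (hw : Integrable w μ) (hfw : Integrable (fun x => f x * w x) μ)
    (h0 : ∀ᵐ x ∂μ, 0 ≤ w x) (h1 : ∫ x, w x ∂μ = 1)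
    (h : ∀ᵐ x ∂μ, w x ≠ 0 → |f x - a| ≤ η) : |∫ x, f x * w x ∂μ - a| ≤ η := by
  have e : ∫ x, f x * w x ∂μ - a = ∫ x, (f x - a) * w x ∂μ := by
    simp only [sub_mul]
    rw [integral_sub hfw (hw.const_mul a), integral_const_mul, h1, mul_one]
  rw [e]
  refine (norm_integral_le_of_norm_le (f := fun x => (f x - a) * w x) (hw.const_mul η) ?_).trans_eq (by
    rw [integral_const_mul, h1, mul_one])
  filter_upwards [h0, h] with x hx0 hx
  rw [norm_mul, Real.norm_of_nonneg hx0]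
  rcases eq_or_ne (w x) 0 with hz | hz
  · simp [hz]
  · exact mul_le_mul_of_nonneg_right (hx hz) hx0

lemma integral_congr_toH {f : ℝ → ℝ} {g : ℝ → ℝ} (hf : MemLp f 2 (delayMeasure τ)) :
    ∫ s, g s * toH τ f s ∂delayMeasure τ = ∫ s, g s * f s ∂delayMeasure τ := by
  refine integral_congr_ae ?_
  filter_upwards [toH_ae hf] with s hs
  rw [hs]

/-- The kernel argument is `-τ - s`, so `s₀` is reached when `t - s = t + τ + s₀`; a bump
concentrated there averages `E₁` near `s₀`. -/
lemma Coeffs.Admissible.exists_inner_vec₁_near (hE : E.Admissible T τ) {t s₀ : ℝ}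
    (h : (t, s₀) ∈ dom₁ T τ) {η : ℝ} (hη : 0 < η) :
    ∃ δ > 0, ∀ θ a b, IsBump θ a b → t ≤ a → b ≤ t + τ → t + τ + s₀ - δ ≤ a → b ≤ t + τ + s₀ + δ →
      |inner ℝ (E.vec₁ τ t) (toH τ fun s => θ (t - s)) - E.E₁ t s₀| ≤ η := by
  obtain ⟨δ, hδ, hcont⟩ := Metric.continuousOn_iff.1 hE.continuousOn₁ (t, s₀) h η hη
  refine ⟨δ, hδ, fun θ a b hθ ha hb ha' hb' => ?_⟩
  have hm := hθ.memLp (τ := τ) t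
  obtain ⟨C, hC⟩ := hE.bounded₁
  rw [hE.inner_vec₁ h.1, integral_congr_toH hm]
  have hi : Integrable (fun s => θ (t - s)) (delayMeasure τ) := hm.integrable one_le_two
  refine abs_integral_mul_sub_le hi ?_ (ae_of_all _ fun s => hθ.nonneg _)
    (hθ.integral_delay ha hb) ?_
  · refine hi.bdd_mul (c := C) (hE.aestronglyMeasurable₁ h.1) ?_
    filter_upwards [ae_mem_dom₁ h.1] with s hs
    exact hC _ _ hs
  · filter_upwards [ae_mem_dom₁ h.1] with s hs hne
    have h1 := hθ.mem_of_ne _ hne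
    have h2 := hcont _ hs (by
      rw [Prod.dist_eq, dist_self, Real.dist_eq, max_lt_iff, abs_lt]
      exact ⟨hδ, by linarith [h1.1], by linarith [h1.2]⟩)
    exact h2.le

lemma Coeffs.Admissible.exists_inner_op₂_near (hE : E.Admissible T τ) {t s₀ r₀ : ℝ}
    (h : (t, s₀, r₀) ∈ dom₂ T τ) {η : ℝ} (hη : 0 < η) :
    ∃ δ > 0, ∀ θ a b, IsBump θ a b → t ≤ a → b ≤ t + τ → t + τ + s₀ - δ ≤ a → b ≤ t + τ + s₀ + δ →
      ∀ θ' a' b', IsBump θ' a' b' → t ≤ a' → b' ≤ t + τ → t + τ + r₀ - δ ≤ a' →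
        b' ≤ t + τ + r₀ + δ →
      |inner ℝ (toH τ fun s => θ (t - s)) (E.op₂ τ t (toH τ fun s => θ' (t - s))) - E.E₂ t s₀ r₀|
        ≤ η := by
  obtain ⟨δ, hδ, hcont⟩ := Metric.continuousOn_iff.1 hE.continuousOn₂ (t, s₀, r₀) h η hη
  refine ⟨δ, hδ, fun θ a b hθ ha hb hsa hsb θ' a' b' hθ' ha' hb' hra hrb => ?_⟩
  have hm := hθ.memLp (τ := τ) t
  have hm' := hθ'.memLp (τ := τ) t
  set x := toH τ fun s => θ (t - s) with hx
  set y := toH τ fun s => θ' (t - s) with hy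
  have e1 : ∀ᵐ p ∂(delayMeasure τ).prod (delayMeasure τ), x p.1 = θ (t - p.1) :=
    Measure.quasiMeasurePreserving_fst.ae (toH_ae hm)
  have e2 : ∀ᵐ p ∂(delayMeasure τ).prod (delayMeasure τ), y p.2 = θ' (t - p.2) :=
    Measure.quasiMeasurePreserving_snd.ae (toH_ae hm')
  rw [hE.inner_op₂ h.1]
  refine abs_integral_mul_sub_le (integrable_mul_prod x y) (hE.integrable₂ h.1 x y) ?_ ?_ ?_
  · filter_upwards [e1, e2] with p h1 h2
    rw [h1, h2]
    exact mul_nonneg (hθ.nonneg _) (hθ'.nonneg _)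
  · rw [integral_prod_mul (x : ℝ → ℝ) (y : ℝ → ℝ), integral_congr_ae (toH_ae hm),
      integral_congr_ae (toH_ae hm'), hθ.integral_delay ha hb, hθ'.integral_delay ha' hb', one_mul]
  · filter_upwards [ae_mem_dom₂ h.1, e1, e2] with p hp h1 h2 hne
    rw [h1, h2] at hne
    have h3 := hθ.mem_of_ne _ (left_ne_zero_of_mul hne)
    have h4 := hθ'.mem_of_ne _ (right_ne_zero_of_mul hne)
    have h5 := hcont _ hp (by
      rw [Prod.dist_eq, Prod.dist_eq, dist_self, Real.dist_eq, Real.dist_eq, max_lt_iff, max_lt_iff,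
        abs_lt, abs_lt]
      exact ⟨hδ, ⟨by linarith [h3.1], by linarith [h3.2]⟩, by linarith [h4.1], by linarith [h4.2]⟩)
    exact h5.le

lemma exists_isBump_near (hτ : 0 < τ) {t s₀ δ : ℝ} (hs : s₀ ∈ Icc (-τ) 0) (hδ : 0 < δ) :
    ∃ θ a b, IsBump θ a b ∧ t ≤ a ∧ b ≤ t + τ ∧ t + τ + s₀ - δ ≤ a ∧ b ≤ t + τ + s₀ + δ := by
  -- Truncating to `[t, t + τ]` keeps the whole mass of the bump in the delay window; at an endpoint
  -- the interval becomes one-sided but stays nonempty.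
  have h : max t (t + τ + s₀ - δ) < min (t + τ) (t + τ + s₀ + δ) := by
    rw [max_lt_iff, lt_min_iff, lt_min_iff]
    exact ⟨⟨by linarith, by linarith [hs.1]⟩, by linarith [hs.2], by linarith⟩
  obtain ⟨θ, hθ⟩ := exists_isBump h
  exact ⟨θ, _, _, hθ, le_max_left _ _, min_le_left _ _, le_max_right _ _, min_le_right _ _⟩

/-- The difference of the quadratic forms of two families of coefficients, without `E₃`. -/
def Coeffs.quadDiff (E E' : Coeffs) (t : ℝ) (x : State τ) : ℝ :=
  (E.quad t x - E.E₃ t) - (E'.quad t x - E'.E₃ t)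

lemma toH_add {f g : ℝ → ℝ} (hf : MemLp f 2 (delayMeasure τ)) (hg : MemLp g 2 (delayMeasure τ)) :
    toH τ f + toH τ g = toH τ fun s => f s + g s := by
  refine Lp.ext ?_
  filter_upwards [Lp.coeFn_add (toH τ f) (toH τ g), toH_ae hf, toH_ae hg, toH_ae (hf.add hg)]
    with s h1 h2 h3 h4
  rw [h1, Pi.add_apply, h2, h3]
  exact h4.symm

/-- Bounds on the difference of the quadratic forms at smooth states yield bounds on the
differences of the coefficients. -/
lemma Coeffs.Admissible.diffLE_of_quadDiff_le (hτ : 0 < τ) (hE : E.Admissible T τ)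
    (hE' : E'.Admissible T τ) {g : ℝ → ℝ}
    (h : ∀ t ∈ Icc 0 T, ∀ x₀ θ, |x₀| ≤ 1 → ContDiff ℝ 2 θ → HasCompactSupport θ →
      (∀ u, t + τ ≤ u → θ u = 0) → ∫ u, |θ u| ≤ 2 →
      |E.quadDiff E' t ((x₀, toH τ fun s => θ (t - s)) : State τ)| ≤ g t) :
    E.DiffLE T τ E' g := by
  have hsupp : ∀ {θ : ℝ → ℝ} {a b t : ℝ}, IsBump θ a b → b ≤ t + τ → ∀ u, t + τ ≤ u → θ u = 0 :=
    fun hθ hb u hu => by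
      by_contra hne
      linarith [(hθ.mem_of_ne u hne).2]
  refine ⟨fun t ht => ?_, fun t ht s hs hts => ?_, fun t ht s hs r hr hts htr => ?_⟩
  · have h1 := h t ht 1 (fun _ => 0) (by simp) contDiff_const (HasCompactSupport.zero)
      (fun _ _ => rfl) (by simp)
    have e : toH τ (fun _ => (0 : ℝ)) = 0 := by
      have := toH_sub (τ := τ) (MemLp.zero' (p := 2) (ε := ℝ)) (MemLp.zero' (p := 2) (ε := ℝ))
      simpa using this.symm
    simpa [Coeffs.quadDiff, Coeffs.quad, e] using h1
  · refine le_of_forall_pos_le_add fun η hη => ?_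
    have hd : (t, s) ∈ dom₁ T τ := ⟨ht, hs, hts⟩
    obtain ⟨δ, hδ, hn⟩ := hE.exists_inner_vec₁_near hd (half_pos hη)
    obtain ⟨δ', hδ', hn'⟩ := hE'.exists_inner_vec₁_near hd (half_pos hη)
    obtain ⟨θ, a, b, hθ, ha, hb, ha', hb'⟩ := exists_isBump_near (t := t) hτ hs (lt_min hδ hδ')
    have h1 := hn θ a b hθ ha hb (by linarith [min_le_left δ δ']) (by linarith [min_le_left δ δ'])
    have h2 := hn' θ a b hθ ha hb (by linarith [min_le_right δ δ'])
      (by linarith [min_le_right δ δ'])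
    -- Comparing `x₀ = 1` with `x₀ = -1` isolates the cross term.
    have h3 := h t ht 1 θ (by simp) hθ.contDiff hθ.hasCompactSupport (hsupp hθ hb)
      (by rw [hθ.integral_abs]; norm_num)
    have h4 := h t ht (-1) θ (by simp) hθ.contDiff hθ.hasCompactSupport (hsupp hθ hb)
      (by rw [hθ.integral_abs]; norm_num)
    simp only [Coeffs.quadDiff, Coeffs.quad] at h3 h4
    rw [abs_le] at h1 h2 h3 h4 ⊢
    constructor <;> linarith [h1.1, h1.2, h2.1, h2.2, h3.1, h3.2, h4.1, h4.2]
  · refine le_of_forall_pos_le_add fun η hη => ?_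
    have hd := mem_dom₂_of_ne ht hs hr hts htr
    obtain ⟨δ, hδ, hn⟩ := hE.exists_inner_op₂_near hd (half_pos hη)
    obtain ⟨δ', hδ', hn'⟩ := hE'.exists_inner_op₂_near hd (half_pos hη)
    have hl := min_le_left δ δ'
    have hr' := min_le_right δ δ'
    obtain ⟨θ, a, b, hθ, ha, hb, hsa, hsb⟩ := exists_isBump_near (t := t) hτ hs (lt_min hδ hδ')
    obtain ⟨θ', a', b', hθ', ha', hb', hra, hrb⟩ :=
      exists_isBump_near (t := t) hτ hr (lt_min hδ hδ')
    have h1 := hn θ a b hθ ha hb (by linarith) (by linarith) θ' a' b' hθ' ha' hb' (by linarith)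
      (by linarith)
    have h2 := hn' θ a b hθ ha hb (by linarith) (by linarith) θ' a' b' hθ' ha' hb' (by linarith)
      (by linarith)
    have hi : ∫ u, (|θ u| + |θ' u|) = 2 := by
      rw [integral_add hθ.integrable.abs hθ'.integrable.abs, hθ.integral_abs, hθ'.integral_abs]
      norm_num
    have hi' := hθ.integrable.abs.add hθ'.integrable.abs
    -- Polarization with the sum and the difference of two bumps isolates the bilinear term; this is
    -- why the `L¹` bound allowed is `2`.
    have h3 := h t ht 0 (fun u => θ u + θ' u) (by simp) (hθ.contDiff.add hθ'.contDiff)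
      (hθ.hasCompactSupport.add hθ'.hasCompactSupport)
      (fun u hu => by simp only [hsupp hθ hb u hu, hsupp hθ' hb' u hu, add_zero]) (by
        rw [← hi]
        exact integral_mono_of_nonneg (ae_of_all _ fun _ => abs_nonneg _) hi'
          (ae_of_all _ fun u => abs_add_le _ _))
    have h4 := h t ht 0 (fun u => θ u - θ' u) (by simp) (hθ.contDiff.sub hθ'.contDiff)
      (hθ.hasCompactSupport.sub hθ'.hasCompactSupport)
      (fun u hu => by simp only [hsupp hθ hb u hu, hsupp hθ' hb' u hu, sub_zero]) (by
        rw [← hi]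
        exact integral_mono_of_nonneg (ae_of_all _ fun _ => abs_nonneg _) hi'
          (ae_of_all _ fun u => abs_sub _ _))
    rw [← toH_add (hθ.memLp t) (hθ'.memLp t)] at h3
    rw [← toH_sub (hθ.memLp t) (hθ'.memLp t)] at h4
    simp only [Coeffs.quadDiff, Coeffs.quad, map_add, map_sub, inner_add_left, inner_add_right,
      inner_sub_left, inner_sub_right] at h3 h4
    set x := toH τ fun s => θ (t - s)
    set y := toH τ fun s => θ' (t - s)
    rw [hE.inner_op₂_comm ht y x, hE'.inner_op₂_comm ht y x] at h3 h4
    rw [abs_le] at h1 h2 h3 h4 ⊢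
    constructor <;> linarith [h1.1, h1.2, h2.1, h2.2, h3.1, h3.2, h4.1, h4.2]

end Recover

end DelayMFG
end

noncomputable section

namespace DelayMFG

/-! ### Solutions of the master equation solve the Riccati system -/

section MasterToRiccati

variable {T τ σ ε c : ℝ} {E E' : Coeffs}

/-- Symmetry of `E₂` moves the argument `0` into the second slot, which is the form bounded by
`Coeffs.FeedbackLE` and `Coeffs.DiffLE`. -/
lemma Coeffs.Admissible.feedback_eq (hE : E.Admissible T τ) (hτ : 0 ≤ τ) {t : ℝ} (ht : t ∈ Icc 0 T)
    (h : t ≠ T - τ) (x : State τ) :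
    E.feedback t x = (E.E₀ t + E.E₁ t 0) * x.1
      - ∫ s, (E.E₁ t (-τ - s) + E.E₂ t (-τ - s) 0) * x.2 s ∂delayMeasure τ := by
  have h0 : (0 : ℝ) ∈ Icc (-τ) 0 := ⟨by linarith, le_rfl⟩
  rw [Coeffs.feedback, inner_eq_integral]
  congr 1
  refine integral_congr_ae ?_
  filter_upwards [Lp.coeFn_add (E.vec₁ τ t) (E.vec₂ τ t), toH_ae (hE.memLp₁ ht),
    toH_ae (hE.memLp₂ hτ ht h), ae_mem_dom₁ ht] with s h1 h2 h3 h4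
  rw [h1, Pi.add_apply, Coeffs.vec₁, Coeffs.vec₂, h2, h3, hE.symm _ _ _
    (mem_dom₂_of_ne ht h0 h4.2.1 (fun h' => h (by linarith)) h4.2.2)]

lemma Coeffs.Admissible.integrable_feedback (hE : E.Admissible T τ) (hτ : 0 ≤ τ) {t : ℝ}
    (ht : t ∈ Icc 0 T) (h : t ≠ T - τ) (x : PastControl τ) :
    Integrable (fun s => (E.E₁ t (-τ - s) + E.E₂ t (-τ - s) 0) * x s) (delayMeasure τ) := by
  have h0 : (0 : ℝ) ∈ Icc (-τ) 0 := ⟨by linarith, le_rfl⟩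
  refine (L2.integrable_inner (𝕜 := ℝ) x (E.vec₁ τ t + E.vec₂ τ t)).congr ?_
  filter_upwards [Lp.coeFn_add (E.vec₁ τ t) (E.vec₂ τ t), toH_ae (hE.memLp₁ ht),
    toH_ae (hE.memLp₂ hτ ht h), ae_mem_dom₁ ht] with s h1 h2 h3 h4
  rw [h1, Pi.add_apply, Coeffs.vec₁, Coeffs.vec₂, h2, h3, hE.symm _ _ _
    (mem_dom₂_of_ne ht h0 h4.2.1 (fun h' => h (by linarith)) h4.2.2)]
  rfl

lemma abs_mul_sub_integral_le {a C : ℝ} {k : ℝ → ℝ} (ha : |a| ≤ C)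
    (hk : ∀ᵐ s ∂delayMeasure τ, |k s| ≤ C) (x : State τ) :
    |a * x.1 - ∫ s, k s * x.2 s ∂delayMeasure τ|
      ≤ C * (|x.1| + ∫ s, |x.2 s| ∂delayMeasure τ) := by
  have h1 : |a * x.1| ≤ C * |x.1| := by
    rw [abs_mul]
    exact mul_le_mul_of_nonneg_right ha (abs_nonneg _)
  have h2 : |∫ s, k s * x.2 s ∂delayMeasure τ| ≤ C * ∫ s, |x.2 s| ∂delayMeasure τ := by
    rw [← integral_const_mul]
    refine norm_integral_le_of_norm_le (f := fun s => k s * x.2 s)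
      ((integrable_coe x.2).abs.const_mul C) ?_
    filter_upwards [hk] with s hs
    rw [norm_mul]
    exact mul_le_mul_of_nonneg_right hs (abs_nonneg _)
  rw [mul_add]
  exact (abs_sub _ _).trans (add_le_add h1 h2)

lemma Coeffs.FeedbackLE.abs_feedback_le {C : ℝ} (hC : E.FeedbackLE T τ C) (hE : E.Admissible T τ)
    (hτ : 0 ≤ τ) {t : ℝ} (ht : t ∈ Icc 0 T) (h : t ≠ T - τ) (x : State τ) :
    |E.feedback t x| ≤ C * (|x.1| + ∫ s, |x.2 s| ∂delayMeasure τ) := by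
  rw [hE.feedback_eq hτ ht h]
  refine abs_mul_sub_integral_le (k := fun s => E.E₁ t (-τ - s) + E.E₂ t (-τ - s) 0)
    (hC.1 t ht h) ?_ x
  filter_upwards [ae_mem_dom₁ ht] with s hs
  exact hC.2 t ht _ hs.2.1 h hs.2.2

lemma Coeffs.DiffLE.abs_feedback_sub_le {f : ℝ → ℝ} (hB : E.DiffLE T τ E' f)
    (hE : E.Admissible T τ) (hE' : E'.Admissible T τ) (hτ : 0 ≤ τ) {t : ℝ} (ht : t ∈ Icc 0 T)
    (h : t ≠ T - τ) (x : State τ) :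
    |E.feedback t x - E'.feedback t x|
      ≤ 2 * f t * (|x.1| + ∫ s, |x.2 s| ∂delayMeasure τ) := by
  have e : E.feedback t x - E'.feedback t x
      = ((E.E₀ t + E.E₁ t 0) - (E'.E₀ t + E'.E₁ t 0)) * x.1
        - ∫ s, ((E.E₁ t (-τ - s) + E.E₂ t (-τ - s) 0)
          - (E'.E₁ t (-τ - s) + E'.E₂ t (-τ - s) 0)) * x.2 s ∂delayMeasure τ := by
    simp only [sub_mul _ _ (x.2 _)]
    rw [integral_sub (hE.integrable_feedback hτ ht h x.2) (hE'.integrable_feedback hτ ht h x.2),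
      hE.feedback_eq hτ ht h, hE'.feedback_eq hτ ht h]
    ring
  rw [e]
  refine abs_mul_sub_integral_le (k := fun s => (E.E₁ t (-τ - s) + E.E₂ t (-τ - s) 0)
    - (E'.E₁ t (-τ - s) + E'.E₂ t (-τ - s) 0)) (hB.abs_sub_feedback₀_le hτ ht h) ?_ x
  filter_upwards [ae_mem_dom₁ ht] with s hs
  exact hB.abs_sub_feedback₁_le hτ ht hs.2.1 h hs.2.2

lemma IsMasterSolution.quadEquationAt (hU : IsMasterSolution T σ ε c (ansatz τ E))
    (hE : E.Admissible T τ) (hτ : 0 < τ) {t : ℝ} (ht : t ∈ Ioo 0 T) (htτ : t ≠ T - τ)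
    {x w : State τ} (hx : GraphA x w) : E.QuadEquationAt σ ε t x (pairing w (E.grad t x)) := by
  have hx' : GraphA (-x) (-w) := by
    rw [graphA_iff hτ.le] at hx ⊢
    simp only [Prod.snd_neg, Prod.fst_neg, map_neg, inner_neg_right, hx.1, hx.2, and_self]
  refine hE.quadEquationAt_of_master hτ ht htτ hx
    (hU.equation t ht htτ _ _ hx' _ (isP1_dirac 0) ⟨fun _ => 0, integrable_zero _ _ _, ?_⟩)
  rw [ae_dirac_eq]
  exact graphA_zero hτ.le

lemma IsMasterSolution.quad_terminal (hU : IsMasterSolution T σ ε c (ansatz τ E))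
    (hE : E.Admissible T τ) (hT : 0 ≤ T) (x : State τ) : E.quad T x = c / 2 * x.1 ^ 2 := by
  have h := hU.terminal (-x) _ (isP1_dirac 0)
  rw [hE.ansatz_eq (right_mem_Icc.2 hT), deviation_dirac, zero_sub, neg_neg, mean₀_eq,
    integral_dirac] at h
  simpa using h

lemma Coeffs.quad_zero (t : ℝ) : E.quad t (0 : State τ) = E.E₃ t := by
  simp [Coeffs.quad]

lemma IsMasterSolution.hasDerivAt_E₃ (hU : IsMasterSolution T σ ε c (ansatz τ E))
    (hE : E.Admissible T τ) (hτ : 0 < τ) {t : ℝ} (ht : t ∈ Ioo 0 T) (htτ : t ≠ T - τ) :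
    HasDerivAt E.E₃ (-(σ ^ 2 * E.E₀ t)) t := by
  have h := hU.quadEquationAt hE hτ ht htτ (graphA_zero hτ.le)
  rw [Coeffs.QuadEquationAt] at h
  simp only [Coeffs.quad_zero] at h
  refine h.congr_deriv ?_
  simp [pairing, Coeffs.feedback]

/-- Along `X' = A X` the chain rule produces `⟨A X, grad⟩`, which cancels the transport term;
subtracting `E₃` removes the noise term. -/
lemma IsMasterSolution.hasDerivAt_quad_flow (hU : IsMasterSolution T σ ε c (ansatz τ E))
    (hE : E.Admissible T τ) (hτ : 0 < τ) {r : ℝ} (hr : r ∈ Ioo 0 T) (hrτ : r ≠ T - τ) {θ : ℝ → ℝ}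
    (hθ : ContDiff ℝ 2 θ) (hs : HasCompactSupport θ) (h0 : θ (r + τ) = 0) (t x₀ : ℝ) :
    HasDerivAt (fun u => E.quad u (flow τ θ t x₀ u) - E.E₃ u)
      (2 * E.feedback r (flow τ θ t x₀ r) ^ 2 - ε / 2 * (flow τ θ t x₀ r).1 ^ 2) r := by
  have h1 := hU.quadEquationAt hE hτ hr hrτ (graphA_flow hθ hs t x₀ h0)
  have h2 := (hE.hasDerivAt_quad_curve hr (hasDerivAt_flow hθ hs t x₀ r) h1).sub
    (hU.hasDerivAt_E₃ hE hτ hr hrτ)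
  refine h2.congr_deriv ?_
  rw [pairing_comm (E.grad r _)]
  ring

/-- One Picard step along the flow of `A`. -/
lemma Coeffs.DiffLE.step_of_isMasterSolution {f g : ℝ → ℝ} {C : ℝ} (hτ : 0 < τ)
    (hE : E.Admissible T τ) (hE' : E'.Admissible T τ)
    (hU : IsMasterSolution T σ ε c (ansatz τ E)) (hU' : IsMasterSolution T σ ε c (ansatz τ E'))
    (hC : E.FeedbackLE T τ C) (hC' : E'.FeedbackLE T τ C)
    (hB : E.DiffLE T τ E' f) (hg : ContinuousOn g (Icc 0 T)) (hgT : g T = 0)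
    (hg' : ∀ u ∈ Ioo 0 T, HasDerivAt g (-(200 * C * f u)) u) :
    E.DiffLE T τ E' g := by
  refine hE.diffLE_of_quadDiff_le hτ hE' fun t ht x₀ θ hx₀ hθ hs h0 hi => ?_
  have hT : 0 ≤ T := ht.1.trans ht.2
  have hX : Continuous (flow τ θ t x₀) :=
    continuous_iff_continuousAt.2 fun r => (hasDerivAt_flow hθ hs t x₀ r).continuousAt
  have hsub : Icc t T ⊆ Icc 0 T := Icc_subset_Icc_left ht.1
  have h := abs_sub_le_of_hasDerivAt_off_point (p := T - τ) (g := g) ht.2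
    (f := fun u => E.quadDiff E' u (flow τ θ t x₀ u))
    (f' := fun u => (2 * E.feedback u (flow τ θ t x₀ u) ^ 2 - ε / 2 * (flow τ θ t x₀ u).1 ^ 2)
      - (2 * E'.feedback u (flow τ θ t x₀ u) ^ 2 - ε / 2 * (flow τ θ t x₀ u).1 ^ 2))
    (g' := fun u => 200 * C * f u)
    ((((hE.continuousOn_quad_curve hX).sub hE.continuousOn₃).sub
      ((hE'.continuousOn_quad_curve hX).sub hE'.continuousOn₃)).mono hsub) (hg.mono hsub) ?_ ?_ ?_
  · have e1 : E.quadDiff E' T (flow τ θ t x₀ T) = 0 := by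
      rw [Coeffs.quadDiff, ← Coeffs.quad_zero (τ := τ), ← Coeffs.quad_zero (τ := τ),
        hU.quad_terminal hE hT, hU.quad_terminal hE hT, hU'.quad_terminal hE' hT,
        hU'.quad_terminal hE' hT]
      ring
    have e2 : flow τ θ t x₀ t = (x₀, toH τ fun s => θ (t - s)) := by simp [flow]
    simpa only [e1, e2, sub_zero, hgT] using h
  · intro u hu hne
    have hu' : u ∈ Ioo 0 T := ⟨ht.1.trans_lt hu.1, hu.2⟩
    have hz : θ (u + τ) = 0 := h0 _ (by linarith [hu.1])
    exact (hU.hasDerivAt_quad_flow hE hτ hu' hne hθ hs hz t x₀).sub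
      (hU'.hasDerivAt_quad_flow hE' hτ hu' hne hθ hs hz t x₀)
  · intro u hu _
    exact hg' u ⟨ht.1.trans_lt hu.1, hu.2⟩
  · intro u hu hne
    have hu' : u ∈ Icc 0 T := hsub (Ioo_subset_Icc_self hu)
    set X := flow τ θ t x₀ u
    set N := |X.1| + ∫ s, |X.2 s| ∂delayMeasure τ with hN
    -- Here `|x₀| ≤ 1` and the `L¹` norm of `θ` is at most `2`, so the bound is `1 + 2 * 2`.
    have hN5 : N ≤ 5 := by
      have := abs_fst_flow_add_le (τ := τ) hθ.continuous hs t x₀ u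
      linarith
    have hN0 : 0 ≤ N := add_nonneg (abs_nonneg _) (integral_nonneg fun _ => abs_nonneg _)
    have hC0 : 0 ≤ C := (abs_nonneg _).trans (hC.1 u hu' hne)
    have hf0 : 0 ≤ f u := (abs_nonneg _).trans (hB.le₀ u hu')
    have h1 : |E.feedback u X - E'.feedback u X| ≤ 10 * f u :=
      (hB.abs_feedback_sub_le hE hE' hτ.le hu' hne X).trans (by nlinarith)
    have h2 : |E.feedback u X| ≤ 5 * C :=
      (hC.abs_feedback_le hE hτ.le hu' hne X).trans (by nlinarith)
    have h3 : |E'.feedback u X| ≤ 5 * C :=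
      (hC'.abs_feedback_le hE' hτ.le hu' hne X).trans (by nlinarith)
    have h4 : |E.feedback u X + E'.feedback u X| ≤ 10 * C := by
      linarith [abs_add_le (E.feedback u X) (E'.feedback u X)]
    have e : (2 * E.feedback u X ^ 2 - ε / 2 * X.1 ^ 2) - (2 * E'.feedback u X ^ 2 - ε / 2 * X.1 ^ 2)
        = 2 * ((E.feedback u X - E'.feedback u X) * (E.feedback u X + E'.feedback u X)) := by
      ring
    -- The running cost cancels and the difference of squares is bounded by `2 * (10 * f) * (10 *
    -- C)`, the source of the constant `200`.
    rw [e, abs_mul, abs_mul, abs_two]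
    have h5 := mul_le_mul h1 h4 (abs_nonneg _) (by positivity)
    linarith

/-- The coefficients of a solution of the master equation are unique. -/
theorem IsMasterSolution.agree (hτ : 0 < τ) (hT : 0 ≤ T) (hE : E.Admissible T τ)
    (hE' : E'.Admissible T τ) (hU : IsMasterSolution T σ ε c (ansatz τ E))
    (hU' : IsMasterSolution T σ ε c (ansatz τ E')) : E.Agree T τ E' := by
  obtain ⟨C, hC, hC'⟩ := hE.exists_common_feedbackLE hE' hτ.le
  have hD := hE.diffLE_zero_of_step (M := 200 * C) hE' fun f g hB hg hgT hg' =>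
    hB.step_of_isMasterSolution hτ hE hE' hU hU' hC hC' hg hgT hg'
  refine hD.agree (p := T - τ) hE hE' ?_ (fun t ht h => hU.hasDerivAt_E₃ hE hτ ht h)
    fun t ht h => hU'.hasDerivAt_E₃ hE' hτ ht h
  rw [← Coeffs.quad_zero (τ := τ), ← Coeffs.quad_zero (τ := τ), hU.quad_terminal hE hT,
    hU'.quad_terminal hE' hT]

/-- Whether coefficients solve the Riccati system depends on their values on the domains only. -/
lemma Coeffs.Agree.solvesRiccati (h : E.Agree T τ E') (hτ : 0 < τ) (hT : 0 ≤ T)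
    (hR : E'.SolvesRiccati T τ σ ε c) : E.SolvesRiccati T τ σ ε c := by
  obtain ⟨h0, h1, h2⟩ := h
  have hz : (0 : ℝ) ∈ Icc (-τ) 0 := ⟨by linarith, le_rfl⟩
  have hm : -τ ∈ Icc (-τ) 0 := ⟨le_rfl, by linarith⟩
  have hfb : ∀ t ∈ Ioo 0 T, t ≠ T - τ → E.E₀ t + E.E₁ t 0 = E'.E₀ t + E'.E₁ t 0 :=
    fun t ht hne => by
      have ht' := Ioo_subset_Icc_self ht
      rw [(h0 t ht').1, h1 t 0 ⟨ht', hz, fun h' => hne (by simp only at h'; linarith)⟩]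
  have hfb₁ : ∀ t ∈ Ioo 0 T, ∀ s ∈ Ioo (-τ) 0, t ≠ T - τ → T - t ≠ s + τ →
      E.E₁ t s + E.E₂ t s 0 = E'.E₁ t s + E'.E₂ t s 0 := fun t ht s hs hne hts => by
    have ht' := Ioo_subset_Icc_self ht
    have hs' := Ioo_subset_Icc_self hs
    rw [h1 t s ⟨ht', hs', hts⟩,
      h2 t s 0 (mem_dom₂_of_ne ht' hs' hz hts fun h' => hne (by linarith))]
  have hnear : ∀ t ∈ Ioo 0 T, ∀ᶠ h in 𝓝 (0 : ℝ), t + h ∈ Icc 0 T := fun t ht =>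
    (by fun_prop : Continuous fun h : ℝ => t + h).continuousAt.eventually
      (by simp only [add_zero]; exact Icc_mem_nhds ht.1 ht.2)
  have hnear' : ∀ s ∈ Ioo (-τ) 0, ∀ᶠ h in 𝓝 (0 : ℝ), s - h ∈ Icc (-τ) 0 := fun s hs =>
    (by fun_prop : Continuous fun h : ℝ => s - h).continuousAt.eventually
      (by simp only [sub_zero]; exact Icc_mem_nhds hs.1 hs.2)
  have hTT : T ∈ Icc 0 T := right_mem_Icc.2 hT
  refine ⟨fun t ht hne => ?_, fun t ht s hs hne hts => ?_, fun t ht s hs r hr hne hts htr => ?_,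
    fun t ht => ?_, ?_, fun s hs => ?_, fun s hs r hr hsr => ?_, ?_, fun t ht => ?_,
    fun t s hts => ?_⟩
  · rw [hfb t ht hne]
    refine (hR.ode₀ t ht hne).congr_of_eventuallyEq ?_
    filter_upwards [Icc_mem_nhds ht.1 ht.2] with u hu
    exact (h0 u hu).1
  · rw [hfb t ht hne, hfb₁ t ht s hs hne hts]
    refine (hR.pde₁ t ht s hs hne hts).congr_of_eventuallyEq ?_
    filter_upwards [hnear t ht, hnear' s hs] with h ht' hs'
    exact h1 _ _ ⟨ht', hs', fun h' => hts (by simp only at h'; linarith)⟩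
  · rw [hfb₁ t ht s hs hne hts, hfb₁ t ht r hr hne htr]
    refine (hR.pde₂ t ht s hs r hr hne hts htr).congr_of_eventuallyEq ?_
    filter_upwards [hnear t ht, hnear' s hs, hnear' r hr] with h ht' hs' hr'
    exact h2 _ _ _ (mem_dom₂_of_ne ht' hs' hr' (fun h' => hts (by linarith))
      fun h' => htr (by linarith))
  · rw [(h0 t (Ioo_subset_Icc_self ht)).1]
    refine (hR.ode₃ t ht).congr_of_eventuallyEq ?_
    filter_upwards [Icc_mem_nhds ht.1 ht.2] with u hu
    exact (h0 u hu).2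
  · rw [(h0 T hTT).1, hR.terminal₀]
  · rw [h1 T s ⟨hTT, ⟨hs.1.le, hs.2⟩, fun h' => by simp only at h'; linarith [hs.1]⟩,
      hR.terminal₁ s hs]
  · rw [h2 T s r ⟨hTT, hs, hr, fun h' => hsr ?_⟩, hR.terminal₂ s hs r hr hsr]
    simp only at h'
    have h3 := le_max_left s r
    have h4 := le_max_right s r
    exact Prod.ext (by simp only; linarith [hs.1]) (by simp only; linarith [hr.1])
  · rw [(h0 T hTT).2, hR.terminal₃]
  · rw [(h0 t (Ico_subset_Icc_self ht)).1,
      h1 t (-τ) ⟨Ico_subset_Icc_self ht, hm, fun h' => by simp only at h'; linarith [ht.2]⟩,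
      hR.lateral₁ t ht]
  · rw [h1 t s hts, h2 t s (-τ) ⟨hts.1, hts.2.1, hm, by
      simp only [max_eq_left hts.2.1.1]; exact hts.2.2⟩, hR.lateral₂ t s hts]

/-- If the ansatz solves the master equation, then its coefficients solve the Riccati system. -/
theorem IsMasterSolution.solvesRiccati (hε : 0 ≤ ε) (hc : 0 ≤ c) (hτ : 0 < τ) (hT : 0 ≤ T)
    (hE : E.Admissible T τ) (hU : IsMasterSolution T σ ε c (ansatz τ E)) :
    E.SolvesRiccati T τ σ ε c := by
  have hA := explicitCoeffs_admissible (σ := σ) hε hc hτ.le hT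
  have hR := explicitCoeffs_solvesRiccati (σ := σ) hε hc hτ.le hT
  -- The explicit coefficients also give a master solution; uniqueness identifies `E` with them on
  -- the domains, and the Riccati system transfers.
  exact (hU.agree hτ hT hE hA (Coeffs.SolvesRiccati.isMasterSolution hε hc hτ hT hA hR)).solvesRiccati
    hτ hT hR

end MasterToRiccati

end DelayMFG
end
theorem mainTheorem4 (T τ σ ε c : ℝ) (hτ : 0 < τ) (hτT : τ ≤ T) (hσ : 0 < σ) (hε : 0 < ε)
    (hc : 0 ≤ c) :
    -- the Riccati system has exactly one solution
    (∃ E : DelayMFG.Coeffs, (E.Admissible T τ ∧ E.SolvesRiccati T τ σ ε c) ∧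
      ∀ E' : DelayMFG.Coeffs, E'.Admissible T τ → E'.SolvesRiccati T τ σ ε c →
        E'.Agree T τ E) ∧
    -- the ansatz solves the master equation exactly when its coefficients solve the system
    (∀ E : DelayMFG.Coeffs, E.Admissible T τ →
      (DelayMFG.IsMasterSolution T σ ε c (DelayMFG.ansatz τ E) ↔
        E.SolvesRiccati T τ σ ε c)) ∧
    -- where `∂_z U` is regular, the transport terms are `∫ z₁ (d/ds) ∂_{z₁} U ds` and
    -- `∫ ∫ y₁ (d/ds) D_{μ₁} U ds dμ₁`, and `z` and `ν` are arbitrary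
    (∀ E : DelayMFG.Coeffs, E.Admissible T τ → E.SolvesRiccati T τ σ ε c →
      ∀ t ∈ Set.Ioo 0 T, t ≠ T - τ → (t < T - τ ∨ c = 0) →
        ∀ (z : DelayMFG.State τ) (ν : MeasureTheory.Measure (DelayMFG.State τ)),
          DelayMFG.IsP1 ν →
          DelayMFG.MasterEquationAt DelayMFG.AdjointPairing σ ε (DelayMFG.ansatz τ E) t z ν) := by
  have hT : 0 ≤ T := hτ.le.trans hτT
  have hA := DelayMFG.explicitCoeffs_admissible (σ := σ) hε.le hc hτ.le hT
  have hR := DelayMFG.explicitCoeffs_solvesRiccati (σ := σ) hε.le hc hτ.le hT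
  exact ⟨⟨_, ⟨hA, hR⟩, fun _ hE' hR' => hR'.agree hτ.le hE' hA hR⟩,
    fun _ hE => ⟨fun hU => hU.solvesRiccati hε.le hc hτ hT hE,
      fun hR => hR.isMasterSolution hε.le hc hτ hT hE⟩,
    fun _ hE hR _ ht htτ h z _ hν =>
      hR.masterEquationAt_adjointPairing hε hc hτ hT hE ht htτ h z hν⟩
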